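/- Let $d\ge 2$, $T>0$, and let $\mathbb{T}^d=\mathbb{R}^d/(2\pi\mathbb{Z}^d)$. Let $b:(0,T)\times\mathbb{T}^d\to\mathbb{R}^d$ be a vector field with distributional divergence $\operatorname{div} b$ (in the space variable) such that $$b\in L^2(0,T;L^2(\mathbb{T}^d)),\qquad \operatorname{div} b\in L^2(0,T;L^2(\mathbb{T}^d)) \tag{A1}$$ and $$\begin{cases} b\in L^{p_1}(0,T;L^{q_1}(\mathbb{T}^d)) & \text{with } q_1\in(d,+\infty],\ p_1\in\big(\tfrac{2q_1}{q_1-d},+\infty\big],\\[2pt] \operatorname{div} b\in L^{p_2}(0,T;L^{q_2}(\mathbb{T}^d)) & \text{with } q_2\in\big(\tfrac d2,+\infty\big],\ p_2\in\big(\tfrac{2q_2}{2q_2-d},+\infty\big], \end{cases}\tag{A4}$$ that is, $\frac{2}{p_1}+\frac{d}{q_1}<1$ and $\frac{2}{p_2}+\frac{d}{q_2}<2$ (with $1/\infty=0$). Then for every $\nu>0$ and every $u_0\in L^2(\mathbb{T}^d)$, uniqueness holds in the class of weak $L^\infty(0,T;L^2(\mathbb{T}^d))$ solutions of the Cauchy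 problem $$\partial_t u=\nu\Delta u+b\cdot\nabla u,\qquad u(0)=u_0.$$ Here a weak $L^\infty(0,T;L^2(\mathbb{T}^d))$ solution is a real-valued $u\in L^\infty(0,T;L^2(\mathbb{T}^d))$ such that for every $\varphi\in C^\infty(\mathbb{T}^d)$ and for a.e. $t\in(0,T)$, $$\langle u(t),\varphi\rangle-\langle u_0,\varphi\rangle=-\int_0^t\langle u(s),\operatorname{div}(b(s)\varphi)\rangle\,ds+\nu\int_0^t\langle u(s),\Delta\varphi\rangle\,ds,$$ where $\operatorname{div}(b\varphi)=(\operatorname{div} b)\,\varphi+b\cdot\nabla\varphi$ and $\langle\cdot,\cdot\rangle$ is the $L^2(\mathbb{T}^d)$ pairing. Uniqueness means that any two such solutions $u,v$ satisfy $u(t)=v(t)$ in $L^2(\mathbb{T}^d)$ for a.e. $t\in(0,T)$; if moreover $u$ and $v$ are continuous from $[0,T]$ to $L^2(\mathbb{T}^d)$ with the weak topology, then $u(t)=v(t)$ for every $t\in[0,T]$. -/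

import Mathlib

open MeasureTheory Set
open scoped ENNReal

instance fact_two_pi_pos : Fact ((0 : ℝ) < 2 * Real.pi) := ⟨Real.two_pi_pos⟩

/-- The `d`-dimensional torus `ℝ^d / (2πℤ)^d`, with its product Lebesgue measure `volume`. -/
abbrev Torus (d : ℕ) : Type := Fin d → AddCircle (2 * Real.pi)

/-- The partial derivative `∂_i φ` of a function on the torus. -/
noncomputable def torusPartial {d : ℕ} (i : Fin d) (φ : Torus d → ℝ) (x : Torus d) : ℝ :=
  deriv (fun s : ℝ => φ (x + Pi.single i (s : AddCircle (2 * Real.pi)))) 0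

/-- The Laplacian `Δφ = ∑ i, ∂_i ∂_i φ` of a function on the torus. -/
noncomputable def torusLaplacian {d : ℕ} (φ : Torus d → ℝ) (x : Torus d) : ℝ :=
  ∑ i : Fin d, torusPartial i (torusPartial i φ) x

/-- `φ ∈ C^∞(𝕋^d)`: the periodic lift of `φ` to `ℝ^d` is smooth. -/
def TorusSmooth {d : ℕ} (φ : Torus d → ℝ) : Prop :=
  ContDiff ℝ ((⊤ : ℕ∞) : WithTop ℕ∞) (fun y : Fin d → ℝ => φ (fun i => (y i : AddCircle (2 * Real.pi))))

/-- `f ∈ L^p(0,T; L^q(𝕋^d; E))`: `f` is (a.e. equal to) a jointly measurable function on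
`(0,T) × 𝕋^d`, and the `L^p(0,T)` norm of `t ↦ ‖f(t,·)‖_{L^q}` is finite. The values
`p = ∞` and `q = ∞` (essential suprema) are included. -/
def MemLpLq {d : ℕ} {E : Type*} [NormedAddCommGroup E] (T : ℝ) (p q : ℝ≥0∞)
    (f : ℝ → Torus d → E) : Prop :=
  AEStronglyMeasurable (fun z : ℝ × Torus d => f z.1 z.2)
      ((volume.restrict (Ioc 0 T)).prod volume) ∧
    eLpNorm (fun t : ℝ => eLpNorm (f t) q volume) p (volume.restrict (Ioc 0 T)) < ∞

/-- `g` is the distributional divergence of the vector field `b` on the torus. -/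
def IsTorusDiv {d : ℕ} (b : Torus d → EuclideanSpace ℝ (Fin d)) (g : Torus d → ℝ) : Prop :=
  ∀ φ : Torus d → ℝ, TorusSmooth φ →
    ∫ x, ∑ i : Fin d, b x i * torusPartial i φ x = - ∫ x, g x * φ x

/-- `u` is a weak `L^∞(0,T; L^2(𝕋^d))` solution of the Cauchy problem
`∂_t u = ν Δu + b·∇u`, `u(0) = u₀`. Here `g` is the distributional divergence of `b`, so that
`div (b φ) = g φ + b·∇φ`. The equation is required for almost every time, which is the natural
meaning for elements of `L^∞(0,T; L^2)`. -/
def IsWeakSol {d : ℕ} (T ν : ℝ) (b : ℝ → Torus d → EuclideanSpace ℝ (Fin d))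
    (g : ℝ → Torus d → ℝ) (u₀ : Torus d → ℝ) (u : ℝ → Torus d → ℝ) : Prop :=
  MemLpLq T ∞ 2 u ∧
    ∀ φ : Torus d → ℝ, TorusSmooth φ →
      ∀ᵐ t ∂(volume.restrict (Ioc 0 T)),
        (∫ x, u t x * φ x) - ∫ x, u₀ x * φ x =
          - (∫ s in (0 : ℝ)..t,
              ∫ x, u s x * (g s x * φ x + ∑ i : Fin d, b s x i * torusPartial i φ x))
          + ν * ∫ s in (0 : ℝ)..t, ∫ x, u s x * torusLaplacian φ x

/-- `u ∈ C([0,T]; L^2_w)`: every `u(t)`, `t ∈ [0,T]`, is in `L^2(𝕋^d)`, and `t ↦ u(t)` is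
continuous for the weak topology of `L^2(𝕋^d)`. -/
def WeaklyContinuousL2 {d : ℕ} (T : ℝ) (u : ℝ → Torus d → ℝ) : Prop :=
  (∀ t ∈ Icc 0 T, MemLp (u t) 2 volume) ∧
    ∀ f : Torus d → ℝ, MemLp f 2 volume →
      ContinuousOn (fun t : ℝ => ∫ x, u t x * f x) (Icc 0 T)

/-! By linearity the difference `w` of two solutions is bounded in `L^2` and satisfies the weak
formulation with zero initial data. Testing with the real and imaginary parts of `exp (i k·x)`
gives, for each Fourier mode, a scalar integral equation with damping `ν|k|²`. Duhamel's formula and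
summation over finitely many modes yield, for every trigonometric polynomial `ψ`, with `P_θ` the
heat flow, `|∫ w(t) ψ| ≤ ∫_0^t ∫ |w| |g| |P_{ν(t-s)} ψ| + |w| ∑_i |b_i| |∂_i P_{ν(t-s)} ψ| dx ds`
(`enorm_integral_mul_trigPoly_le`).

The heat flow maps `L^r` to `L^s` with norm of order `θ^{-(d/2)(1/r-1/s)}`, and a derivative costs a
further `θ^{-1/2}` (`eLpNorm_heatTrig_le`, `eLpNorm_heatTrigPartial_le`). Hölder's inequality and
duality over trigonometric polynomials (`eLpNorm_le_of_trigPoly`) then bound `‖w(t)‖_m` by a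
Volterra integral whose kernels are `(t-s)^{-1/2-(d/2)(1/q₁+1/m₁-1/m)}` against `‖b‖_{q₁}‖w‖_{m₁}`
and `(t-s)^{-(d/2)(1/q₂+1/m₂-1/m)}` against `‖g‖_{q₂}‖w‖_{m₂}` (`exists_eLpNorm_le_lintegral`).

For `m = m₁ = m₂` the conditions `2/p₁ + d/q₁ < 1` and `2/p₂ + d/q₂ < 2` say exactly that these
kernels lie in the dual spaces `L^{p₁'}` and `L^{p₂'}` in time. With the weight `e^{-nt}` their
norms tend to `0` as `n → ∞`, so the inequality becomes a strict contraction and `‖w(t)‖_m` vanishes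
for a.e. `t` (`ae_eq_zero_of_le_volterra`).

Hölder's inequality requires `1/q₂ + 1/m ≤ 1`. If `q₂ ≥ 2`, the exponent `m = 2` serves. If `q₂ <
2`, integrability of `w` is first raised from `L^2` to `L^{q₂'}` in small steps: each step spends
some of the strict room in the condition on `b`, and the divergence term is treated as a known
source `g w`, controlled by `g ∈ L^2 L^2` and `w ∈ L^∞ L^2` (`exists_ae_eq_zero_of_volterra_scale`).
-/

/-! ### Exponentials on the torus and their derivatives. -/

/-- The exponential monomial `x ↦ exp (i k·x)` on the torus. -/
noncomputable def torusMonomial {d : ℕ} (k : Fin d → ℤ) : C(Torus d, ℂ) where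
  toFun x := ∏ i, fourier (k i) (x i)
  continuous_toFun := by fun_prop

/-- The canonical projection `ℝ^d → 𝕋^d`. -/
noncomputable def torusMk {d : ℕ} (y : Fin d → ℝ) : Torus d := fun i => (y i : AddCircle (2 * Real.pi))

section Monomial
variable {d : ℕ} (k : Fin d → ℤ)

lemma torusMonomial_apply (x : Torus d) : torusMonomial k x = ∏ i, fourier (k i) (x i) := rfl

lemma fourier_two_pi_coe (n : ℤ) (y : ℝ) :
    fourier n (y : AddCircle (2 * Real.pi)) = Complex.exp (Complex.I * (n * y)) := by
  rw [fourier_coe_apply]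
  congr 1
  have : (Real.pi : ℂ) ≠ 0 := by exact_mod_cast Real.pi_ne_zero
  push_cast
  field_simp

lemma torusMonomial_mk (y : Fin d → ℝ) :
    torusMonomial k (torusMk y) = Complex.exp (Complex.I * ∑ i, (k i : ℂ) * y i) := by
  simp only [torusMonomial_apply, torusMk, fourier_two_pi_coe]
  rw [← Complex.exp_sum, Finset.mul_sum]

lemma norm_torusMonomial (x : Torus d) : ‖torusMonomial k x‖ = 1 := by
  rw [torusMonomial_apply, norm_prod]
  exact Finset.prod_eq_one fun i _ => by rw [fourier_apply]; exact Circle.norm_coe _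

lemma torusMonomial_neg (x : Torus d) :
    torusMonomial (-k) x = starRingEnd ℂ (torusMonomial k x) := by
  simp only [torusMonomial_apply, Pi.neg_apply, fourier_neg, map_prod]

lemma torusMonomial_add_index (l : Fin d → ℤ) (x : Torus d) :
    torusMonomial (k + l) x = torusMonomial k x * torusMonomial l x := by
  simp only [torusMonomial_apply, Pi.add_apply, fourier_add, ← Finset.prod_mul_distrib]

lemma torusMonomial_add (x z : Torus d) :
    torusMonomial k (x + z) = torusMonomial k x * torusMonomial k z := by
  simp only [torusMonomial_apply, ← Finset.prod_mul_distrib]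
  refine Finset.prod_congr rfl fun i _ => ?_
  simp [fourier_apply, smul_add, AddCircle.toCircle_add]

lemma torusMonomial_zero : torusMonomial (0 : Fin d → ℤ) = 1 := by
  ext x
  simp [torusMonomial_apply]

lemma hasDerivAt_torusMonomial (i : Fin d) (x : Torus d) :
    HasDerivAt (fun s : ℝ => torusMonomial k (x + Pi.single i (s : AddCircle (2 * Real.pi))))
      (Complex.I * k i * torusMonomial k x) 0 := by
  have h : (fun s : ℝ => torusMonomial k (x + Pi.single i (s : AddCircle (2 * Real.pi))))
      = fun s : ℝ => torusMonomial k x * Complex.exp (Complex.I * (k i * s)) := by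
    funext s
    rw [torusMonomial_add]
    congr 1
    rw [torusMonomial_apply, Finset.prod_eq_single i]
    · rw [Pi.single_eq_same, fourier_two_pi_coe]
    · intro j _ hj
      simp [Pi.single_eq_of_ne hj]
    · simp
  rw [h]
  have h1 : HasDerivAt (fun s : ℝ => Complex.I * (k i * (s : ℂ))) (Complex.I * k i) 0 := by
    have := ((hasDerivAt_id (0:ℝ)).ofReal_comp.const_mul (k i : ℂ)).const_mul Complex.I
    simpa using this
  have h2 := (h1.cexp).const_mul (torusMonomial k x)
  convert! h2 using 1
  simp; ring

lemma contDiff_torusMonomial {n : WithTop ℕ∞} :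
    ContDiff ℝ n (fun y : Fin d → ℝ => torusMonomial k (torusMk y)) := by
  simp only [torusMonomial_mk]
  refine ContDiff.cexp ?_
  refine contDiff_const.mul ?_
  refine ContDiff.sum fun i _ => contDiff_const.mul ?_
  exact Complex.ofRealCLM.contDiff.comp (contDiff_apply ℝ ℝ i)

lemma torusSmooth_re : TorusSmooth (fun x => (torusMonomial k x).re) :=
  Complex.reCLM.contDiff.comp (contDiff_torusMonomial k)

lemma torusSmooth_im : TorusSmooth (fun x => (torusMonomial k x).im) :=
  Complex.imCLM.contDiff.comp (contDiff_torusMonomial k)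

/-- Test functions are real, so `L` stands for either the real or the imaginary part; the free
factor `c` lets the formula be iterated for second derivatives. -/
lemma torusPartial_clm (L : ℂ →L[ℝ] ℝ) (c : ℂ) (i : Fin d) :
    torusPartial i (fun x => L (c * torusMonomial k x))
      = fun x => L (c * (Complex.I * k i) * torusMonomial k x) := by
  funext x
  have h1 : HasDerivAt
      (fun s : ℝ => c * torusMonomial k (x + Pi.single i (s : AddCircle (2 * Real.pi))))
      (c * (Complex.I * k i) * torusMonomial k x) 0 := by
    rw [mul_assoc c]
    exact (hasDerivAt_torusMonomial k i x).const_mul c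
  exact (L.hasFDerivAt.comp_hasDerivAt (0 : ℝ) h1).deriv

lemma torusLaplacian_clm (L : ℂ →L[ℝ] ℝ) :
    torusLaplacian (fun x => L (torusMonomial k x))
      = fun x => -(∑ i, (k i : ℝ) ^ 2) * L (torusMonomial k x) := by
  funext x
  have h : ∀ i, torusPartial i (torusPartial i (fun x => L (torusMonomial k x))) x
      = -((k i : ℝ) ^ 2) * L (torusMonomial k x) := by
    intro i
    have h1 : (fun x => L (torusMonomial k x)) = fun x => L (1 * torusMonomial k x) := by simp
    rw [h1, torusPartial_clm, torusPartial_clm]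
    have : (1 * (Complex.I * (k i : ℂ)) * (Complex.I * (k i : ℂ)) * torusMonomial k x)
      = (-((k i : ℝ) ^ 2)) • torusMonomial k x := by
      rw [Complex.real_smul]
      push_cast
      linear_combination (k i : ℂ) ^ 2 * torusMonomial k x * Complex.I_sq
    beta_reduce
    rw [this, L.map_smul]
    simp
  simp only [torusLaplacian, h]
  rw [← Finset.sum_mul, Finset.sum_neg_distrib]

lemma torusPartial_re (i : Fin d) (x : Torus d) :
    torusPartial i (fun x => (torusMonomial k x).re) x
      = (Complex.I * k i * torusMonomial k x).re := by
  have := congrFun (torusPartial_clm k Complex.reCLM 1 i) x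
  simpa using this

lemma torusPartial_im (i : Fin d) (x : Torus d) :
    torusPartial i (fun x => (torusMonomial k x).im) x
      = (Complex.I * k i * torusMonomial k x).im := by
  have := congrFun (torusPartial_clm k Complex.imCLM 1 i) x
  simpa using this

end Monomial

/-! ### Density and orthogonality of the exponentials. -/

section Density
variable {d : ℕ}

/-- The star subalgebra of `C(Torus d, ℂ)` generated by the exponential monomials. -/
noncomputable def torusMonomialSubalgebra (d : ℕ) : StarSubalgebra ℂ C(Torus d, ℂ) where
  toSubalgebra := Algebra.adjoin ℂ (range torusMonomial)
  star_mem' := by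
    change Algebra.adjoin ℂ (range torusMonomial) ≤ star (Algebra.adjoin ℂ (range torusMonomial))
    refine Algebra.adjoin_le ?_
    rintro _ ⟨n, rfl⟩
    refine Algebra.subset_adjoin ⟨-n, ?_⟩
    ext1 x
    simp only [torusMonomial_neg, starRingEnd_apply, ContinuousMap.star_apply]

/-- Products of exponentials are exponentials, so the generated algebra is no larger than the linear
span. -/
theorem torusMonomialSubalgebra_coe :
    (torusMonomialSubalgebra d).toSubalgebra.toSubmodule = Submodule.span ℂ (range torusMonomial) := by
  apply Algebra.adjoin_eq_span_of_subset
  refine .trans (fun x ↦ Submonoid.closure_induction (fun _ ↦ id) ⟨0, ?_⟩ ?_) Submodule.subset_span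
  · exact torusMonomial_zero
  · rintro _ _ _ _ ⟨m, rfl⟩ ⟨n, rfl⟩
    refine ⟨m + n, ?_⟩
    ext z
    exact torusMonomial_add_index m n z

theorem torusMonomialSubalgebra_separatesPoints : (torusMonomialSubalgebra d).SeparatesPoints := by
  intro x y hxy
  rw [Ne, funext_iff, not_forall] at hxy
  obtain ⟨i, hi⟩ := hxy
  have key : ∀ z : Torus d, torusMonomial (Pi.single i 1) z = AddCircle.toCircle (z i) := by
    intro z
    rw [torusMonomial_apply, Finset.prod_eq_single i]
    · rw [Pi.single_eq_same, fourier_one]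
    · intro j _ hj
      simp [Pi.single_eq_of_ne hj]
    · simp
  refine ⟨_, ⟨torusMonomial (Pi.single i 1), Algebra.subset_adjoin ⟨Pi.single i 1, rfl⟩, rfl⟩, ?_⟩
  beta_reduce
  rw [key, key]
  intro h
  exact hi (AddCircle.injective_toCircle Real.two_pi_pos.ne' (Circle.ext h))

theorem span_torusMonomial_closure_eq_top :
    (Submodule.span ℂ (range (torusMonomial (d := d)))).topologicalClosure = ⊤ := by
  rw [← torusMonomialSubalgebra_coe]
  exact congr_arg (Subalgebra.toSubmodule <| StarSubalgebra.toSubalgebra ·)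
    (ContinuousMap.starSubalgebra_topologicalClosure_eq_top_of_separatesPoints _
      (torusMonomialSubalgebra_separatesPoints (d := d)))

lemma integral_fourier_two_pi (n : ℤ) :
    ∫ x : AddCircle (2 * Real.pi), fourier n x = if n = 0 then (2 * Real.pi : ℂ) else 0 := by
  split_ifs with h
  · subst h
    simp [Measure.real, AddCircle.measure_univ, Real.pi_pos.le]
  · have h1 := fourierCoeff_fourier (T := 2 * Real.pi) n
    have h2 := congrFun h1 0
    rw [Pi.single_eq_of_ne (Ne.symm h)] at h2
    simp only [fourierCoeff, neg_zero, fourier_zero, one_smul] at h2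
    rw [AddCircle.integral_haarAddCircle] at h2
    have : (2 * Real.pi)⁻¹ ≠ 0 := by positivity
    exact (smul_eq_zero.mp h2).resolve_left this

lemma integral_torusMonomial (k : Fin d → ℤ) :
    ∫ x : Torus d, torusMonomial k x = if k = 0 then (2 * Real.pi : ℂ) ^ d else 0 := by
  simp only [torusMonomial_apply]
  rw [integral_fintype_prod_volume_eq_prod (fun i (x : AddCircle (2 * Real.pi)) => fourier (k i) x)]
  simp only [integral_fourier_two_pi]
  split_ifs with h
  · subst h
    simp
  · obtain ⟨i, hi⟩ := Function.ne_iff.mp h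
    exact Finset.prod_eq_zero (Finset.mem_univ i) (if_neg hi)

end Density

/-! ### The Gaussian on the line: Fourier transform, pointwise bounds, theta sums. -/

section GaussianOneDim

/-- The heat kernel on the line at time `θ`. -/
noncomputable def lineHeatKernel (θ x : ℝ) : ℝ :=
  (Real.sqrt (4 * Real.pi * θ))⁻¹ * Real.exp (-(4 * θ)⁻¹ * x ^ 2)

lemma lineHeatKernel_nonneg (θ x : ℝ) : 0 ≤ lineHeatKernel θ x := by
  unfold lineHeatKernel; positivity

lemma continuous_lineHeatKernel (θ : ℝ) : Continuous (lineHeatKernel θ) := by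
  unfold lineHeatKernel; fun_prop

variable {θ : ℝ}

lemma integrable_lineHeatKernel (hθ : 0 < θ) : Integrable (lineHeatKernel θ) :=
  (integrable_exp_neg_mul_sq (by positivity : 0 < (4 * θ)⁻¹)).const_mul _

lemma integrable_mul_lineHeatKernel (hθ : 0 < θ) : Integrable (fun x => x * lineHeatKernel θ x) := by
  have := (integrable_mul_exp_neg_mul_sq (by positivity : 0 < (4 * θ)⁻¹)).const_mul
    (Real.sqrt (4 * Real.pi * θ))⁻¹
  refine this.congr (Filter.Eventually.of_forall fun x => ?_)
  simp only [lineHeatKernel]; ring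

lemma integral_lineHeatKernel_mul_cexp (hθ : 0 < θ) (t : ℝ) :
    ∫ x : ℝ, (lineHeatKernel θ x : ℂ) * Complex.exp (Complex.I * (t * x))
      = Complex.exp (-θ * t ^ 2) := by
  have hb : 0 < (((4 * θ)⁻¹ : ℝ) : ℂ).re := by
    rw [Complex.ofReal_re]; positivity
  have h := fourierIntegral_gaussian hb t
  have h2 : ∀ x : ℝ, (lineHeatKernel θ x : ℂ) * Complex.exp (Complex.I * (t * x))
      = (((Real.sqrt (4 * Real.pi * θ))⁻¹ : ℝ) : ℂ) *
        (Complex.exp (Complex.I * t * x) * Complex.exp (-(((4 * θ)⁻¹ : ℝ) : ℂ) * x ^ 2)) := by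
    intro x
    simp only [lineHeatKernel]
    push_cast
    ring_nf
  simp_rw [h2]
  rw [integral_const_mul, h]
  have h3 : ((Real.pi : ℂ) / (((4 * θ)⁻¹ : ℝ) : ℂ)) ^ (1 / 2 : ℂ)
      = ((Real.sqrt (4 * Real.pi * θ) : ℝ) : ℂ) := by
    rw [Real.sqrt_eq_rpow, Complex.ofReal_cpow (by positivity)]
    push_cast
    congr 1
    field_simp
  rw [h3, ← mul_assoc, ← Complex.ofReal_mul, inv_mul_cancel₀ (by positivity)]
  have : (θ : ℂ) ≠ 0 := by exact_mod_cast hθ.ne'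
  rw [Complex.ofReal_one, one_mul]
  congr 1
  push_cast
  field_simp

lemma integral_lineHeatKernel (hθ : 0 < θ) : ∫ x, lineHeatKernel θ x = 1 := by
  have h := integral_lineHeatKernel_mul_cexp hθ 0
  simp only [Complex.ofReal_zero, zero_mul, mul_zero, Complex.exp_zero, mul_one, ne_eq,
    OfNat.ofNat_ne_zero, not_false_eq_true, zero_pow] at h
  rw [integral_complex_ofReal] at h
  exact_mod_cast h

/-- The total derivative of the kernel times `exp (i t x)` integrates to zero. The weight `x / (2θ)`
is minus the logarithmic derivative of the kernel, hence the multiplier `i t` of differentiation. -/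
lemma integral_mul_lineHeatKernel_mul_cexp (hθ : 0 < θ) (t : ℝ) :
    ∫ x : ℝ, ((x / (2 * θ) * lineHeatKernel θ x : ℝ) : ℂ) * Complex.exp (Complex.I * (t * x))
      = Complex.I * t * Complex.exp (-θ * t ^ 2) := by
  have hn : ∀ x : ℝ, ‖Complex.exp (Complex.I * (t * x))‖ = 1 := fun x => by
    rw [mul_comm, ← Complex.ofReal_mul, Complex.norm_exp_ofReal_mul_I]
  have hi1 : Integrable
      (fun x : ℝ => (lineHeatKernel θ x : ℂ) * Complex.exp (Complex.I * (t * x))) := by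
    refine (integrable_lineHeatKernel hθ).mono (by
      refine Continuous.aestronglyMeasurable ?_
      have := continuous_lineHeatKernel θ
      fun_prop) (Filter.Eventually.of_forall fun x => ?_)
    rw [norm_mul, hn, mul_one, Complex.norm_real]
  have hi2 : Integrable (fun x : ℝ =>
      ((x / (2 * θ) * lineHeatKernel θ x : ℝ) : ℂ) * Complex.exp (Complex.I * (t * x))) := by
    refine ((integrable_mul_lineHeatKernel hθ).div_const (2 * θ)).mono (by
      refine Continuous.aestronglyMeasurable ?_
      have := continuous_lineHeatKernel θ
      fun_prop) (Filter.Eventually.of_forall fun x => ?_)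
    rw [norm_mul, hn, mul_one, Complex.norm_real]
    apply le_of_eq
    congr 1
    ring
  have hd : ∀ x : ℝ, HasDerivAt
      (fun x : ℝ => (lineHeatKernel θ x : ℂ) * Complex.exp (Complex.I * (t * x)))
      (Complex.I * t * ((lineHeatKernel θ x : ℂ) * Complex.exp (Complex.I * (t * x))) -
        ((x / (2 * θ) * lineHeatKernel θ x : ℝ) : ℂ) * Complex.exp (Complex.I * (t * x))) x := by
    intro x
    have h1 : HasDerivAt (lineHeatKernel θ) (-(x / (2 * θ)) * lineHeatKernel θ x) x := by
      unfold lineHeatKernel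
      have := (((hasDerivAt_pow 2 x).const_mul (-(4 * θ)⁻¹)).exp).const_mul
        (Real.sqrt (4 * Real.pi * θ))⁻¹
      convert! this using 1
      field_simp
      ring
    have h2 : HasDerivAt (fun x : ℝ => Complex.exp (Complex.I * (t * x)))
        (Complex.exp (Complex.I * (t * x)) * (Complex.I * t)) x := by
      have : HasDerivAt (fun x : ℝ => Complex.I * (t * (x : ℂ))) (Complex.I * t) x := by
        simpa using ((hasDerivAt_id x).ofReal_comp.const_mul (t : ℂ)).const_mul Complex.I
      exact this.cexp
    convert! h1.ofReal_comp.mul h2 using 1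
    push_cast
    ring
  have h0 := integral_eq_zero_of_hasDerivAt_of_integrable hd ((hi1.const_mul _).sub hi2) hi1
  rw [integral_sub (hi1.const_mul _) hi2, integral_const_mul,
    integral_lineHeatKernel_mul_cexp hθ] at h0
  exact (sub_eq_zero.mp h0).symm

/-- Doubling the time halves the Gaussian exponent; the other half remains as a factor that can
absorb polynomial growth. -/
lemma lineHeatKernel_eq (hθ : 0 < θ) (x : ℝ) :
    lineHeatKernel θ x = Real.sqrt 2 * Real.exp (-(8 * θ)⁻¹ * x ^ 2) * lineHeatKernel (2 * θ) x := by
  unfold lineHeatKernel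
  have h1 : Real.sqrt (4 * Real.pi * (2 * θ)) = Real.sqrt 2 * Real.sqrt (4 * Real.pi * θ) := by
    rw [← Real.sqrt_mul (by norm_num)]; congr 1; ring
  have h2 : -(4 * θ)⁻¹ * x ^ 2 = -(8 * θ)⁻¹ * x ^ 2 + -(4 * (2 * θ))⁻¹ * x ^ 2 := by
    field_simp; ring
  rw [h1, h2, Real.exp_add]
  have h3 : 0 < Real.sqrt 2 := by positivity
  have h4 : 0 < Real.sqrt (4 * Real.pi * θ) := by have := Real.pi_pos; positivity
  field_simp

lemma lineHeatKernel_le (hθ : 0 < θ) (x : ℝ) :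
    lineHeatKernel θ x ≤ 2 * lineHeatKernel (2 * θ) x := by
  rw [lineHeatKernel_eq hθ]
  refine mul_le_mul_of_nonneg_right ?_ (lineHeatKernel_nonneg _ _)
  have h1 : Real.exp (-(8 * θ)⁻¹ * x ^ 2) ≤ 1 := by
    rw [Real.exp_le_one_iff, neg_mul]
    have : 0 ≤ (8 * θ)⁻¹ * x ^ 2 := by positivity
    linarith
  have h2 : Real.sqrt 2 ≤ 2 := by rw [Real.sqrt_le_left (by norm_num)]; norm_num
  nlinarith [Real.exp_pos (-(8 * θ)⁻¹ * x ^ 2), Real.sqrt_nonneg 2]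

/-- In the variable `u = |x|/√θ` the weight is `u / (2√θ)`, and the spare factor `exp (-u²/8) ≤ (1 +
u²/8)⁻¹` absorbs `u`. This is where a derivative acquires its price `θ^{-1/2}`. -/
lemma abs_mul_lineHeatKernel_le (hθ : 0 < θ) (x : ℝ) :
    |x / (2 * θ)| * lineHeatKernel θ x ≤ 2 * (Real.sqrt θ)⁻¹ * lineHeatKernel (2 * θ) x := by
  rw [lineHeatKernel_eq hθ, ← mul_assoc]
  refine mul_le_mul_of_nonneg_right ?_ (lineHeatKernel_nonneg _ _)
  set s := Real.sqrt θ with hs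
  have hs0 : 0 < s := Real.sqrt_pos.mpr hθ
  have hss : s ^ 2 = θ := Real.sq_sqrt hθ.le
  set u := |x| / s with hu
  have hu0 : 0 ≤ u := by positivity
  have hx : |x / (2 * θ)| = u / 2 * s⁻¹ := by
    rw [abs_div, abs_of_pos (by positivity : 0 < 2 * θ), hu, ← hss]
    field_simp
  have he : Real.exp (-(8 * θ)⁻¹ * x ^ 2) ≤ (1 + u ^ 2 / 8)⁻¹ := by
    rw [neg_mul, Real.exp_neg]
    have : (8 * θ)⁻¹ * x ^ 2 = u ^ 2 / 8 := by
      rw [hu, div_pow, sq_abs, hss]; field_simp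
    rw [this]
    gcongr
    linarith [Real.add_one_le_exp (u ^ 2 / 8)]
  have h2 : Real.sqrt 2 ≤ 3 / 2 := by rw [Real.sqrt_le_left (by norm_num)]; norm_num
  rw [hx]
  have hi : 0 < s⁻¹ := by positivity
  have key : u / 2 * (Real.sqrt 2 * Real.exp (-(8 * θ)⁻¹ * x ^ 2)) ≤ 2 := by
    calc u / 2 * (Real.sqrt 2 * Real.exp (-(8 * θ)⁻¹ * x ^ 2))
        ≤ u / 2 * (3 / 2 * (1 + u ^ 2 / 8)⁻¹) := by gcongr
      _ ≤ 2 := by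
        rw [← mul_assoc, ← div_eq_mul_inv, div_le_iff₀ (by positivity)]
        nlinarith [sq_nonneg (u - 2)]
  calc u / 2 * s⁻¹ * (Real.sqrt 2 * Real.exp (-(8 * θ)⁻¹ * x ^ 2))
      = s⁻¹ * (u / 2 * (Real.sqrt 2 * Real.exp (-(8 * θ)⁻¹ * x ^ 2))) := by ring
    _ ≤ s⁻¹ * 2 := by gcongr
    _ = 2 * s⁻¹ := by ring

lemma sum_range_exp_neg_mul_sq_le (hθ : 0 < θ) (N : ℕ) :
    ∑ n ∈ Finset.range (N + 1), Real.exp (-θ * (n : ℝ) ^ 2) ≤ 1 + Real.sqrt (Real.pi / θ) / 2 := by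
  -- The term `n = 0` supplies the `1`; the others are right-endpoint sums of a decreasing function,
  -- hence below its integral.
  rw [Finset.sum_range_succ']
  have hanti : AntitoneOn (fun x : ℝ => Real.exp (-θ * x ^ 2)) (Icc (0 : ℝ) (0 + N)) := by
    intro x hx y hy hxy
    simp only [Real.exp_le_exp, neg_mul, neg_le_neg_iff]
    have := hx.1
    gcongr
  have h1 := hanti.sum_le_integral
  have h2 : ∫ x in (0 : ℝ)..(0 + N), Real.exp (-θ * x ^ 2) ≤ Real.sqrt (Real.pi / θ) / 2 := by
    rw [← integral_gaussian_Ioi, intervalIntegral.integral_of_le (by simp)]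
    exact setIntegral_mono_set (integrable_exp_neg_mul_sq hθ).integrableOn
      (Filter.Eventually.of_forall fun x => (Real.exp_pos _).le)
      (Ioc_subset_Ioi_self.eventuallyLE)
  simp only [zero_add] at h1 h2
  simp only [Nat.cast_zero, ne_eq, OfNat.ofNat_ne_zero, not_false_eq_true, zero_pow, mul_zero,
    Real.exp_zero]
  linarith

lemma sum_int_exp_neg_mul_sq_le (hθ : 0 < θ) (F : Finset ℤ) :
    ∑ n ∈ F, Real.exp (-θ * (n : ℝ) ^ 2) ≤ 2 + Real.sqrt (Real.pi / θ) := by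
  set N := F.sup Int.natAbs
  have hmaps : ∀ n ∈ F, Int.natAbs n ∈ Finset.range (N + 1) := fun n hn =>
    Finset.mem_range.mpr (Nat.lt_succ_of_le (Finset.le_sup (f := Int.natAbs) hn))
  rw [← Finset.sum_fiberwise_of_maps_to hmaps]
  calc ∑ m ∈ Finset.range (N + 1), ∑ n ∈ F with n.natAbs = m, Real.exp (-θ * (n : ℝ) ^ 2)
      ≤ ∑ m ∈ Finset.range (N + 1), 2 * Real.exp (-θ * (m : ℝ) ^ 2) := by
        refine Finset.sum_le_sum fun m _ => ?_
        calc ∑ n ∈ F with n.natAbs = m, Real.exp (-θ * (n : ℝ) ^ 2)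
            = ∑ n ∈ F with n.natAbs = m, Real.exp (-θ * (m : ℝ) ^ 2) := by
              refine Finset.sum_congr rfl fun n hn => ?_
              rw [← (Finset.mem_filter.mp hn).2, Nat.cast_natAbs, Int.cast_abs, sq_abs]
          _ = ((F.filter fun n => n.natAbs = m).card : ℝ) * Real.exp (-θ * (m : ℝ) ^ 2) := by
              rw [Finset.sum_const, nsmul_eq_mul]
          _ ≤ 2 * Real.exp (-θ * (m : ℝ) ^ 2) := by
              gcongr
              have : (F.filter fun n => n.natAbs = m) ⊆ {(m : ℤ), -(m : ℤ)} := by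
                intro n hn
                have := (Finset.mem_filter.mp hn).2
                simp only [Finset.mem_insert, Finset.mem_singleton]
                omega
              exact_mod_cast (Finset.card_le_card this).trans Finset.card_le_two
    _ = 2 * ∑ m ∈ Finset.range (N + 1), Real.exp (-θ * (m : ℝ) ^ 2) := by rw [Finset.mul_sum]
    _ ≤ 2 + Real.sqrt (Real.pi / θ) := by linarith [sum_range_exp_neg_mul_sq_le hθ N]

/-- For times bounded by `Θ` the additive constant `2` is at most `2√Θ/√θ`, which leaves a pure
power of `θ`. -/
lemma sum_int_exp_neg_mul_sq_le_mul {Θ : ℝ} (hθ : 0 < θ) (hθ' : θ ≤ Θ) (F : Finset ℤ) :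
    ∑ n ∈ F, Real.exp (-θ * (n : ℝ) ^ 2) ≤ (2 * Real.sqrt Θ + 2) * (Real.sqrt θ)⁻¹ := by
  refine (sum_int_exp_neg_mul_sq_le hθ F).trans ?_
  have h0 : 0 < Real.sqrt θ := Real.sqrt_pos.mpr hθ
  have h1 : Real.sqrt Real.pi ≤ 2 := by
    rw [Real.sqrt_le_left (by norm_num)]; linarith [Real.pi_lt_four]
  have h2 : Real.sqrt θ ≤ Real.sqrt Θ := Real.sqrt_le_sqrt hθ'
  rw [Real.sqrt_div Real.pi_pos.le, ← div_eq_mul_inv, le_div_iff₀ h0, add_mul,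
    div_mul_cancel₀ _ h0.ne']
  linarith

end GaussianOneDim

/-! ### The heat flow on the torus as an average over Gaussian translates. -/

section HeatAverage
variable {d : ℕ} {θ : ℝ}

/-- The heat kernel on `ℝ^d` at time `θ`. -/
noncomputable def heatDensity (θ : ℝ) (y : Fin d → ℝ) : ℝ := ∏ i, lineHeatKernel θ (y i)

lemma heatDensity_nonneg (θ : ℝ) (y : Fin d → ℝ) : 0 ≤ heatDensity θ y :=
  Finset.prod_nonneg fun _ _ => lineHeatKernel_nonneg _ _

lemma continuous_heatDensity (θ : ℝ) : Continuous (heatDensity (d := d) θ) :=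
  continuous_finsetProd _ fun i _ => (continuous_lineHeatKernel θ).comp (continuous_apply i)

lemma continuous_torusMk : Continuous (torusMk (d := d)) :=
  continuous_pi fun i => (AddCircle.continuous_mk' _).comp (continuous_apply i)

lemma integrable_heatDensity (hθ : 0 < θ) : Integrable (heatDensity (d := d) θ) :=
  Integrable.fintype_prod (f := fun _ => lineHeatKernel θ) fun _ => integrable_lineHeatKernel hθ

lemma integral_heatDensity (hθ : 0 < θ) : ∫ y, heatDensity (d := d) θ y = 1 := by
  unfold heatDensity
  rw [integral_fintype_prod_volume_eq_prod (fun _ => lineHeatKernel θ)]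
  simp [integral_lineHeatKernel hθ]

lemma torusMonomial_mk_prod (k : Fin d → ℤ) (y : Fin d → ℝ) :
    torusMonomial k (torusMk y) = ∏ i, Complex.exp (Complex.I * (((k i : ℝ) : ℂ) * y i)) := by
  simp only [torusMonomial_apply, torusMk, fourier_two_pi_coe, Complex.ofReal_intCast]

/-- Averaging over Gaussian translates acts diagonally on exponentials, with the heat multiplier;
the integral splits over coordinates. -/
lemma integral_heatDensity_mul_torusMonomial (hθ : 0 < θ) (k : Fin d → ℤ) (x : Torus d) :
    ∫ y, (heatDensity θ y : ℂ) * torusMonomial k (x + torusMk y)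
      = Real.exp (-θ * ∑ i, (k i : ℝ) ^ 2) * torusMonomial k x := by
  have h : ∀ y : Fin d → ℝ, (heatDensity θ y : ℂ) * torusMonomial k (x + torusMk y)
      = torusMonomial k x * ∏ i, ((lineHeatKernel θ (y i) : ℂ) *
          Complex.exp (Complex.I * (((k i : ℝ) : ℂ) * y i))) := by
    intro y
    rw [torusMonomial_add, torusMonomial_mk_prod, heatDensity, Finset.prod_mul_distrib]
    push_cast
    ring
  simp_rw [h]
  rw [integral_const_mul, integral_fintype_prod_volume_eq_prod (fun i (y : ℝ) =>
    (lineHeatKernel θ y : ℂ) * Complex.exp (Complex.I * (((k i : ℝ) : ℂ) * y)))]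
  simp_rw [integral_lineHeatKernel_mul_cexp hθ]
  rw [← Complex.exp_sum, ← Finset.mul_sum, mul_comm]
  push_cast
  rfl

/-- Only the `j`-th one-dimensional factor differs from the unweighted case, and it produces the
multiplier of `∂_j`. -/
lemma integral_coord_heatDensity_mul_torusMonomial (hθ : 0 < θ) (k : Fin d → ℤ) (x : Torus d)
    (j : Fin d) :
    ∫ y, ((y j / (2 * θ) * heatDensity θ y : ℝ) : ℂ) * torusMonomial k (x + torusMk y)
      = Real.exp (-θ * ∑ i, (k i : ℝ) ^ 2) * (Complex.I * k j * torusMonomial k x) := by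
  have h : ∀ y : Fin d → ℝ,
      ((y j / (2 * θ) * heatDensity θ y : ℝ) : ℂ) * torusMonomial k (x + torusMk y)
      = torusMonomial k x * ∏ i, (((if i = j then y i / (2 * θ) * lineHeatKernel θ (y i) else
          lineHeatKernel θ (y i) : ℝ) : ℂ) *
          Complex.exp (Complex.I * (((k i : ℝ) : ℂ) * y i))) := by
    intro y
    rw [torusMonomial_add, torusMonomial_mk_prod, heatDensity, Finset.prod_mul_distrib]
    have : ∀ i, (if i = j then y i / (2 * θ) * lineHeatKernel θ (y i) else lineHeatKernel θ (y i))
        = (if i = j then y i / (2 * θ) else 1) * lineHeatKernel θ (y i) := by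
      intro i; split_ifs <;> simp
    simp_rw [this]
    rw [← Complex.ofReal_prod, Finset.prod_mul_distrib, Finset.prod_ite_eq']
    simp only [Finset.mem_univ, if_true]
    push_cast
    ring
  simp_rw [h]
  rw [integral_const_mul, integral_fintype_prod_volume_eq_prod (fun i (y : ℝ) =>
    ((if i = j then y / (2 * θ) * lineHeatKernel θ y else lineHeatKernel θ y : ℝ) : ℂ) *
      Complex.exp (Complex.I * (((k i : ℝ) : ℂ) * y)))]
  have h2 : ∀ i, (∫ y : ℝ,
      ((if i = j then y / (2 * θ) * lineHeatKernel θ y else lineHeatKernel θ y : ℝ) : ℂ) *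
      Complex.exp (Complex.I * (((k i : ℝ) : ℂ) * y)))
      = (if i = j then Complex.I * (k i : ℝ) else 1) * Complex.exp (-θ * ((k i : ℝ) : ℂ) ^ 2) := by
    intro i
    split_ifs with hi
    · exact integral_mul_lineHeatKernel_mul_cexp hθ _
    · rw [one_mul]; exact integral_lineHeatKernel_mul_cexp hθ _
  simp_rw [h2]
  rw [Finset.prod_mul_distrib, Finset.prod_ite_eq', ← Complex.exp_sum, ← Finset.mul_sum]
  simp only [Finset.mem_univ, if_true]
  push_cast
  ring

/-- The average of `F` over Gaussian translates, for nonnegative `F`. -/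
noncomputable def heatAvg (θ : ℝ) (F : Torus d → ℝ≥0∞) (x : Torus d) : ℝ≥0∞ :=
  ∫⁻ y, ENNReal.ofReal (heatDensity θ y) * F (x + torusMk y)

lemma lintegral_heatDensity (hθ : 0 < θ) :
    ∫⁻ y, ENNReal.ofReal (heatDensity (d := d) θ y) = 1 := by
  rw [← ofReal_integral_eq_lintegral_ofReal (integrable_heatDensity hθ)
    (Filter.Eventually.of_forall (heatDensity_nonneg θ)), integral_heatDensity hθ,
    ENNReal.ofReal_one]

lemma abs_coord_mul_heatDensity_le (hθ : 0 < θ) (j : Fin d) (y : Fin d → ℝ) :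
    |y j / (2 * θ)| * heatDensity θ y ≤ 2 ^ d * (Real.sqrt θ)⁻¹ * heatDensity (2 * θ) y := by
  unfold heatDensity
  have e1 : |y j / (2 * θ)| * ∏ i, lineHeatKernel θ (y i)
      = ∏ i, ((if i = j then |y i / (2 * θ)| else 1) * lineHeatKernel θ (y i)) := by
    rw [Finset.prod_mul_distrib, Finset.prod_ite_eq']; simp
  have e2 : 2 ^ d * (Real.sqrt θ)⁻¹ * ∏ i, lineHeatKernel (2 * θ) (y i)
      = ∏ i, ((2 * if i = j then (Real.sqrt θ)⁻¹ else 1) * lineHeatKernel (2 * θ) (y i)) := by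
    rw [Finset.prod_mul_distrib, Finset.prod_mul_distrib, Finset.prod_ite_eq']; simp
  rw [e1, e2]
  refine Finset.prod_le_prod (fun i _ => ?_) fun i _ => ?_
  · refine mul_nonneg ?_ (lineHeatKernel_nonneg _ _)
    split_ifs <;> positivity
  · split_ifs
    · exact abs_mul_lineHeatKernel_le hθ _
    · simpa using lineHeatKernel_le hθ (y i)

/-- The gradient of the heat flow is dominated by the heat flow at twice the time, so bounds for
`heatAvg` alone suffice. -/
lemma lintegral_coord_heatDensity_le (hθ : 0 < θ) (j : Fin d) (F : Torus d → ℝ≥0∞) (x : Torus d) :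
    ∫⁻ y, ENNReal.ofReal (|y j / (2 * θ)| * heatDensity θ y) * F (x + torusMk y)
      ≤ ENNReal.ofReal (2 ^ d * (Real.sqrt θ)⁻¹) * heatAvg (2 * θ) F x := by
  rw [heatAvg, ← lintegral_const_mul' _ _ ENNReal.ofReal_ne_top]
  refine lintegral_mono fun y => ?_
  rw [← mul_assoc, ← ENNReal.ofReal_mul (by positivity)]
  exact mul_le_mul_left (ENNReal.ofReal_le_ofReal (abs_coord_mul_heatDensity_le hθ j y)) _

/-- Jensen's inequality: `heatAvg` averages against a probability measure. -/
lemma heatAvg_rpow_le (hθ : 0 < θ) {r : ℝ} (hr : 1 ≤ r) {F : Torus d → ℝ≥0∞} (hF : Measurable F)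
    (x : Torus d) : heatAvg θ F x ^ r ≤ heatAvg θ (fun z => F z ^ r) x := by
  have hm : Measurable (fun y : Fin d → ℝ => ENNReal.ofReal (heatDensity θ y)) :=
    (continuous_heatDensity θ).measurable.ennreal_ofReal
  have hmF : Measurable (fun y : Fin d → ℝ => F (x + torusMk y)) :=
    hF.comp (continuous_torusMk.measurable.const_add x)
  set μ : Measure (Fin d → ℝ) := volume.withDensity (fun y => ENNReal.ofReal (heatDensity θ y))
    with hμ
  have : IsProbabilityMeasure μ :=
    ⟨by rw [hμ, withDensity_apply _ MeasurableSet.univ, Measure.restrict_univ,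
      lintegral_heatDensity hθ]⟩
  have h1 : ∀ G : Torus d → ℝ≥0∞, Measurable G →
      heatAvg θ G x = ∫⁻ y, G (x + torusMk y) ∂μ := by
    intro G hG
    have := lintegral_withDensity_eq_lintegral_mul (volume : Measure (Fin d → ℝ)) hm
      (g := fun y => G (x + torusMk y)) (hG.comp (continuous_torusMk.measurable.const_add x))
    rw [hμ, this]
    rfl
  rw [h1 F hF, h1 _ (hF.pow_const r)]
  have h2 := eLpNorm'_le_eLpNorm'_of_exponent_le (μ := μ) one_pos hr
    (f := fun y : Fin d → ℝ => F (x + torusMk y)) hmF.aestronglyMeasurable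
  simp only [eLpNorm', enorm_eq_self, ENNReal.rpow_one, div_one] at h2
  calc _ ≤ ((∫⁻ y, F (x + torusMk y) ^ r ∂μ) ^ (1 / r)) ^ r := by gcongr
    _ = _ := by rw [← ENNReal.rpow_mul, one_div_mul_cancel (by positivity), ENNReal.rpow_one]

/-- Tonelli and translation invariance of the measure on the torus: the heat flow preserves mass. -/
lemma lintegral_heatAvg (hθ : 0 < θ) {F : Torus d → ℝ≥0∞} (hF : Measurable F) :
    ∫⁻ x, heatAvg θ F x = ∫⁻ x, F x := by
  unfold heatAvg
  have hm : Measurable (fun y : Fin d → ℝ => ENNReal.ofReal (heatDensity θ y)) :=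
    (continuous_heatDensity θ).measurable.ennreal_ofReal
  rw [lintegral_lintegral_swap]
  · have : ∀ y : Fin d → ℝ, ∫⁻ x : Torus d, ENNReal.ofReal (heatDensity θ y) * F (x + torusMk y)
        = ENNReal.ofReal (heatDensity θ y) * ∫⁻ x, F x := by
      intro y
      rw [lintegral_const_mul' _ _ ENNReal.ofReal_ne_top, lintegral_add_right_eq_self]
    simp_rw [this]
    rw [lintegral_mul_const _ hm, lintegral_heatDensity hθ, one_mul]
  · exact ((hm.comp measurable_snd).mul (hF.comp (measurable_fst.add
      (continuous_torusMk.measurable.comp measurable_snd)))).aemeasurable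

lemma measurable_heatAvg {F : Torus d → ℝ≥0∞} (hF : Measurable F) : Measurable (heatAvg θ F) := by
  have hm : Measurable (fun y : Fin d → ℝ => ENNReal.ofReal (heatDensity θ y)) :=
    (continuous_heatDensity θ).measurable.ennreal_ofReal
  exact Measurable.lintegral_prod_right' (f := fun z : Torus d × (Fin d → ℝ) =>
    ENNReal.ofReal (heatDensity θ z.2) * F (z.1 + torusMk z.2))
    ((hm.comp measurable_snd).mul (hF.comp (measurable_fst.add
      (continuous_torusMk.measurable.comp measurable_snd))))

end HeatAverage

/-! ### Smoothing from `L¹` to `L^∞`. -/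

section HeatSmoothing
variable {d : ℕ}

/-- The trigonometric polynomial with coefficients `c` on the finite set `S`. -/
noncomputable def trigPoly (S : Finset (Fin d → ℤ)) (c : (Fin d → ℤ) → ℂ) : C(Torus d, ℂ) :=
  ∑ k ∈ S, c k • torusMonomial k

lemma trigPoly_apply (S : Finset (Fin d → ℤ)) (c : (Fin d → ℤ) → ℂ) (x : Torus d) :
    trigPoly S c x = ∑ k ∈ S, c k * torusMonomial k x := by
  simp [trigPoly, ContinuousMap.coe_sum]

lemma exists_trigPoly_of_mem_span {f : C(Torus d, ℂ)}
    (hf : f ∈ Submodule.span ℂ (range (torusMonomial (d := d)))) :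
    ∃ S c, f = trigPoly S c := by
  obtain ⟨c, rfl⟩ := (Finsupp.mem_span_range_iff_exists_finsupp).mp hf
  exact ⟨c.support, c, rfl⟩

lemma exists_trigPoly_norm_sub_lt (f : C(Torus d, ℂ)) {ε : ℝ} (hε : 0 < ε) :
    ∃ S c, ‖f - trigPoly S c‖ < ε := by
  have h : f ∈ closure (Submodule.span ℂ (range (torusMonomial (d := d))) : Set C(Torus d, ℂ)) := by
    rw [← Submodule.topologicalClosure_coe, span_torusMonomial_closure_eq_top]
    trivial
  obtain ⟨g, hg, hfg⟩ := Metric.mem_closure_iff.mp h ε hε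
  obtain ⟨S, c, rfl⟩ := exists_trigPoly_of_mem_span hg
  exact ⟨S, c, by rwa [dist_eq_norm] at hfg⟩

lemma integrable_continuousMap (f : C(Torus d, ℂ)) : Integrable f :=
  f.continuous.integrable_of_hasCompactSupport (HasCompactSupport.of_compactSpace _)

lemma integral_trigPoly_mul (S : Finset (Fin d → ℤ)) (c : (Fin d → ℤ) → ℂ) {k : Fin d → ℤ}
    (hk : k ∈ S) :
    ∫ x, trigPoly S c x * torusMonomial (-k) x = (2 * Real.pi : ℂ) ^ d * c k := by
  have h : ∀ x, trigPoly S c x * torusMonomial (-k) x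
      = ∑ l ∈ S, c l * torusMonomial (l + -k) x := by
    intro x
    rw [trigPoly_apply, Finset.sum_mul]
    refine Finset.sum_congr rfl fun l _ => ?_
    rw [torusMonomial_add_index]; ring
  simp_rw [h]
  rw [integral_finsetSum _ fun l _ => (integrable_continuousMap _).const_mul _]
  simp_rw [integral_const_mul, integral_torusMonomial]
  rw [Finset.sum_eq_single k]
  · simp [mul_comm]
  · intro l _ hl
    rw [if_neg (fun h => hl (by rwa [← sub_eq_add_neg, sub_eq_zero] at h)), mul_zero]
  · exact fun h => absurd hk h

/-- Orthogonality recovers `(2π)^d c k` as an integral against a unimodular function; the factor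
`(2π)^d ≥ 1` is discarded. -/
lemma norm_coeff_trigPoly_le (S : Finset (Fin d → ℤ)) (c : (Fin d → ℤ) → ℂ) {k : Fin d → ℤ}
    (hk : k ∈ S) : ‖c k‖ ≤ ∫ x, ‖trigPoly S c x‖ := by
  have h1 : ‖∫ x, trigPoly S c x * torusMonomial (-k) x‖ ≤ ∫ x, ‖trigPoly S c x‖ := by
    refine (norm_integral_le_integral_norm _).trans_eq ?_
    simp only [norm_mul, norm_torusMonomial, mul_one]
  rw [integral_trigPoly_mul S c hk, norm_mul, norm_pow] at h1
  refine le_trans ?_ h1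
  refine le_mul_of_one_le_left (norm_nonneg _) (one_le_pow₀ ?_)
  rw [norm_mul, Complex.norm_ofNat, Complex.norm_real, Real.norm_of_nonneg Real.pi_pos.le]
  linarith [Real.pi_gt_three]

lemma sum_exp_neg_mul_sq_le {θ B : ℝ}
    (hB : ∀ F : Finset ℤ, ∑ n ∈ F, Real.exp (-θ * (n : ℝ) ^ 2) ≤ B) (S : Finset (Fin d → ℤ)) :
    ∑ k ∈ S, Real.exp (-θ * ∑ i, (k i : ℝ) ^ 2) ≤ B ^ d := by
  classical
  -- Enlarging `S` to a box makes the sum factor into one-dimensional sums.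
  let Q : Finset (Fin d → ℤ) := Fintype.piFinset fun i => S.image fun k => k i
  have hS : S ⊆ Q := fun k hk =>
    Fintype.mem_piFinset.mpr fun i => Finset.mem_image_of_mem _ hk
  calc ∑ k ∈ S, Real.exp (-θ * ∑ i, (k i : ℝ) ^ 2)
      ≤ ∑ k ∈ Q, Real.exp (-θ * ∑ i, (k i : ℝ) ^ 2) :=
        Finset.sum_le_sum_of_subset_of_nonneg hS fun _ _ _ => (Real.exp_pos _).le
    _ = ∑ k ∈ Q, ∏ i, Real.exp (-θ * (k i : ℝ) ^ 2) := by
        refine Finset.sum_congr rfl fun k _ => ?_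
        rw [← Real.exp_sum, Finset.mul_sum]
    _ = ∏ i : Fin d, ∑ n ∈ S.image (fun k => k i), Real.exp (-θ * ((n : ℤ) : ℝ) ^ 2) := by
        rw [Finset.prod_univ_sum]
    _ ≤ ∏ _i : Fin d, B := Finset.prod_le_prod
        (fun _ _ => Finset.sum_nonneg fun _ _ => (Real.exp_pos _).le) fun _ _ => hB _
    _ = B ^ d := by simp

/-- The constant in the `L¹ → L^∞` smoothing estimate for times `θ ≤ Θ`. -/
noncomputable def heatSupConst (d : ℕ) (Θ θ : ℝ) : ℝ :=
  ((2 * Real.sqrt Θ + 2) * (Real.sqrt θ)⁻¹) ^ d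

lemma integrable_heatDensity_mul {θ : ℝ} (hθ : 0 < θ) (f : C(Torus d, ℂ)) (x : Torus d) :
    Integrable (fun y => (heatDensity θ y : ℂ) * f (x + torusMk y)) := by
  refine ((integrable_heatDensity (d := d) hθ).mul_const ‖f‖).mono ?_
    (Filter.Eventually.of_forall fun y => ?_)
  · refine Continuous.aestronglyMeasurable ?_
    have h1 := continuous_heatDensity (d := d) θ
    have h2 := continuous_torusMk (d := d)
    fun_prop
  · rw [norm_mul, norm_mul, Complex.norm_real, norm_norm]
    gcongr
    exact f.norm_coe_le_norm _

/-- For a trigonometric polynomial each coefficient is at most the `L¹` norm, and the multipliers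
sum to at most `heatSupConst`, which is of order `θ^{-d/2}`. Uniform approximation extends the bound
to continuous functions. -/
lemma norm_integral_heatDensity_mul_le {θ Θ : ℝ} (hθ : 0 < θ) (hθ' : θ ≤ Θ) (f : C(Torus d, ℂ))
    (x : Torus d) :
    ‖∫ y, (heatDensity θ y : ℂ) * f (x + torusMk y)‖ ≤ heatSupConst d Θ θ * ∫ x, ‖f x‖ := by
  have htrig : ∀ S c, ‖∫ y, (heatDensity θ y : ℂ) * trigPoly S c (x + torusMk y)‖
      ≤ heatSupConst d Θ θ * ∫ x, ‖trigPoly S c x‖ := by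
    intro S c
    have h : ∀ y : Fin d → ℝ, (heatDensity θ y : ℂ) * trigPoly S c (x + torusMk y)
        = ∑ k ∈ S, c k * ((heatDensity θ y : ℂ) * torusMonomial k (x + torusMk y)) := by
      intro y
      rw [trigPoly_apply, Finset.mul_sum]
      exact Finset.sum_congr rfl fun k _ => by ring
    simp_rw [h]
    rw [integral_finsetSum _ fun k _ => (integrable_heatDensity_mul hθ _ x).const_mul _]
    simp_rw [integral_const_mul, integral_heatDensity_mul_torusMonomial hθ]
    calc ‖∑ k ∈ S, c k * ((Real.exp (-θ * ∑ i, (k i : ℝ) ^ 2) : ℂ) * torusMonomial k x)‖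
        ≤ ∑ k ∈ S, (∫ x, ‖trigPoly S c x‖) * Real.exp (-θ * ∑ i, (k i : ℝ) ^ 2) := by
          refine (norm_sum_le _ _).trans (Finset.sum_le_sum fun k hk => ?_)
          rw [norm_mul, norm_mul, norm_torusMonomial, mul_one, Complex.norm_real,
            Real.norm_of_nonneg (Real.exp_pos _).le]
          gcongr
          exact norm_coeff_trigPoly_le S c hk
      _ = (∑ k ∈ S, Real.exp (-θ * ∑ i, (k i : ℝ) ^ 2)) * ∫ x, ‖trigPoly S c x‖ := by
          rw [← Finset.mul_sum, mul_comm]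
      _ ≤ _ := by
          refine mul_le_mul_of_nonneg_right ?_ (integral_nonneg fun _ => norm_nonneg _)
          exact sum_exp_neg_mul_sq_le (fun F => sum_int_exp_neg_mul_sq_le_mul hθ hθ' F) S
  have hA : 0 ≤ heatSupConst d Θ θ := by unfold heatSupConst; positivity
  set V : ℝ := (volume : Measure (Torus d)).real univ with hV
  refine le_of_forall_pos_le_add fun ε hε => ?_
  -- Replacing `f` by a `δ`-close polynomial costs `δ` on the left and `δ V` in the `L¹` norm on the
  -- right, `V` being the volume of the torus.
  obtain ⟨δ, hδ, hδε⟩ : ∃ δ : ℝ, 0 < δ ∧ δ + heatSupConst d Θ θ * (δ * V) ≤ ε := by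
    have hK : 0 < 1 + heatSupConst d Θ θ * V := by
      have : 0 ≤ V := measureReal_nonneg
      positivity
    refine ⟨ε / (1 + heatSupConst d Θ θ * V), by positivity, le_of_eq ?_⟩
    field_simp
  obtain ⟨S, c, hSc⟩ := exists_trigPoly_norm_sub_lt f hδ
  have hpt : ∀ z, ‖f z - trigPoly S c z‖ ≤ δ := fun z =>
    ((f - trigPoly S c).norm_coe_le_norm z).trans hSc.le
  have e1 : ‖(∫ y, (heatDensity θ y : ℂ) * f (x + torusMk y)) -
      ∫ y, (heatDensity θ y : ℂ) * trigPoly S c (x + torusMk y)‖ ≤ δ := by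
    rw [← integral_sub (integrable_heatDensity_mul hθ f x)
      (integrable_heatDensity_mul hθ (trigPoly S c) x)]
    calc _ ≤ ∫ y, heatDensity (d := d) θ y * δ := by
          refine norm_integral_le_of_norm_le ((integrable_heatDensity hθ).mul_const _)
            (Filter.Eventually.of_forall fun y => ?_)
          rw [← mul_sub, norm_mul, Complex.norm_real, Real.norm_of_nonneg (heatDensity_nonneg _ _)]
          exact mul_le_mul_of_nonneg_left (hpt _) (heatDensity_nonneg _ _)
      _ = δ := by rw [integral_mul_const, integral_heatDensity hθ, one_mul]
  have e2 : ∫ x, ‖trigPoly S c x‖ ≤ (∫ x, ‖f x‖) + δ * V := by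
    have : ∫ x : Torus d, (‖f x‖ + δ) = (∫ x, ‖f x‖) + δ * V := by
      rw [integral_add (integrable_continuousMap f).norm (integrable_const _), integral_const,
        smul_eq_mul, mul_comm δ V]
    rw [← this]
    refine integral_mono (integrable_continuousMap _).norm
      ((integrable_continuousMap f).norm.add (integrable_const _)) fun z => ?_
    have h1 := hpt z
    have h2 := norm_sub_norm_le (trigPoly S c z) (f z)
    rw [norm_sub_rev] at h2
    simp only
    linarith
  calc ‖∫ y, (heatDensity θ y : ℂ) * f (x + torusMk y)‖
      ≤ ‖∫ y, (heatDensity θ y : ℂ) * trigPoly S c (x + torusMk y)‖ + δ := by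
        linarith [norm_sub_norm_le (∫ y, (heatDensity θ y : ℂ) * f (x + torusMk y))
          (∫ y, (heatDensity θ y : ℂ) * trigPoly S c (x + torusMk y))]
    _ ≤ heatSupConst d Θ θ * ((∫ x, ‖f x‖) + δ * V) + δ := by
        gcongr
        exact (htrig S c).trans (by gcongr)
    _ ≤ _ := by linarith

lemma heatAvg_continuous_le {θ Θ : ℝ} (hθ : 0 < θ) (hθ' : θ ≤ Θ) {φ : Torus d → ℝ}
    (hφ : Continuous φ) (hφ0 : ∀ x, 0 ≤ φ x) (x : Torus d) :
    heatAvg θ (fun z => ENNReal.ofReal (φ z)) x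
      ≤ ENNReal.ofReal (heatSupConst d Θ θ) * ∫⁻ z, ENNReal.ofReal (φ z) := by
  have hA : 0 ≤ heatSupConst d Θ θ := by unfold heatSupConst; positivity
  set f : C(Torus d, ℂ) := ⟨fun z => (φ z : ℂ), by fun_prop⟩ with hf
  have hfn : ∀ z, ‖f z‖ = φ z := fun z => by simp [hf, abs_of_nonneg (hφ0 z)]
  have hi := (integrable_heatDensity_mul hθ f x)
  have h1 := norm_integral_heatDensity_mul_le hθ hθ' f x
  have hi' : Integrable (fun y => heatDensity θ y * φ (x + torusMk y)) := by
    refine hi.norm.congr (Filter.Eventually.of_forall fun y => ?_)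
    simp only [norm_mul, hfn, Complex.norm_real, Real.norm_of_nonneg (heatDensity_nonneg _ _)]
  have e1 : ∫ y, (heatDensity θ y : ℂ) * f (x + torusMk y)
      = ((∫ y, heatDensity θ y * φ (x + torusMk y) : ℝ) : ℂ) := by
    rw [← integral_complex_ofReal]
    simp [hf]
  have hnn : 0 ≤ ∫ y, heatDensity θ y * φ (x + torusMk y) :=
    integral_nonneg fun y => mul_nonneg (heatDensity_nonneg _ _) (hφ0 _)
  simp only [e1, hfn, Complex.norm_real, Real.norm_of_nonneg hnn] at h1
  have hφi : Integrable φ := (integrable_continuousMap f).norm.congr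
    (Filter.Eventually.of_forall fun z => hfn z)
  calc heatAvg θ (fun z => ENNReal.ofReal (φ z)) x
      = ENNReal.ofReal (∫ y, heatDensity θ y * φ (x + torusMk y)) := by
        rw [ofReal_integral_eq_lintegral_ofReal hi' (Filter.Eventually.of_forall fun y =>
          mul_nonneg (heatDensity_nonneg _ _) (hφ0 _))]
        exact lintegral_congr fun y => (ENNReal.ofReal_mul (heatDensity_nonneg _ _)).symm
    _ ≤ ENNReal.ofReal (heatSupConst d Θ θ * ∫ z, φ z) := ENNReal.ofReal_le_ofReal h1
    _ = _ := by
        rw [ENNReal.ofReal_mul hA, ofReal_integral_eq_lintegral_ofReal hφi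
          (Filter.Eventually.of_forall hφ0)]

end HeatSmoothing

/-! ### Heat estimates from `L^r` to `L^s`, with and without a derivative. -/

section HeatLpLq
variable {d : ℕ}

/-- Jensen reduces `L^r → L^∞` to the `L¹ → L^∞` bound for `|f|^r`, and mass preservation gives `L^r
→ L^r`. For `s` between, `|·|^s = |·|^{s-r} |·|^r` interpolates: the first factor is bounded
uniformly, the second is integrated. -/
lemma eLpNorm_heatAvg_le {θ Θ : ℝ} (hθ : 0 < θ) (hθ' : θ ≤ Θ) (f : C(Torus d, ℂ))
    {r s : ℝ≥0∞} (hr : 1 ≤ r) (hr' : r ≠ ∞) (hrs : r ≤ s) :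
    eLpNorm (heatAvg θ fun z => ‖f z‖ₑ) s volume
      ≤ ENNReal.ofReal (heatSupConst d Θ θ) ^ (r⁻¹ - s⁻¹).toReal * eLpNorm f r volume := by
  set F : Torus d → ℝ≥0∞ := fun z => ‖f z‖ₑ with hF
  have hFm : Measurable F := f.continuous.measurable.enorm
  set ρ := r.toReal with hρ
  have hρ1 : 1 ≤ ρ := by
    rw [hρ, ← ENNReal.toReal_one]
    exact (ENNReal.toReal_le_toReal ENNReal.one_ne_top hr').mpr hr
  have hρ0 : 0 < ρ := one_pos.trans_le hρ1
  have hr0 : r ≠ 0 := (one_pos.trans_le hr).ne'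
  set A := ENNReal.ofReal (heatSupConst d Θ θ) with hA
  have hApos : 0 < heatSupConst d Θ θ := by
    unfold heatSupConst
    have := Real.sqrt_pos.mpr hθ
    positivity
  have hA0 : A ≠ 0 := by simpa [hA] using hApos
  have hAt : A ≠ ∞ := ENNReal.ofReal_ne_top
  set N := eLpNorm f r volume with hN
  have hNr : N ^ ρ = ∫⁻ z, F z ^ ρ := by
    rw [hN, eLpNorm_eq_lintegral_rpow_enorm_toReal hr0 hr', ← ENNReal.rpow_mul,
      one_div_mul_cancel hρ0.ne', ENNReal.rpow_one]
  have hsup : ∀ x, heatAvg θ F x ^ ρ ≤ A * N ^ ρ := by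
    intro x
    refine (heatAvg_rpow_le hθ hρ1 hFm x).trans ?_
    have e : (fun z => F z ^ ρ) = fun z => ENNReal.ofReal (‖f z‖ ^ ρ) := by
      funext z
      rw [← ENNReal.ofReal_rpow_of_nonneg (norm_nonneg _) hρ0.le, ofReal_norm]
    rw [hNr]
    simp only [e]
    exact heatAvg_continuous_le hθ hθ' (by
      exact f.continuous.norm.rpow_const fun _ => Or.inr hρ0.le)
      (fun z => by positivity) x
  have hsup' : ∀ x, heatAvg θ F x ≤ A ^ (1 / ρ) * N := by
    intro x
    have := ENNReal.rpow_le_rpow (hsup x) (by positivity : 0 ≤ 1 / ρ)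
    rwa [ENNReal.mul_rpow_of_nonneg _ _ (by positivity), ← ENNReal.rpow_mul, ← ENNReal.rpow_mul,
      mul_one_div_cancel hρ0.ne', ENNReal.rpow_one, ENNReal.rpow_one] at this
  have hint : ∫⁻ x, heatAvg θ F x ^ ρ ≤ N ^ ρ := by
    rw [hNr, ← lintegral_heatAvg hθ (hFm.pow_const ρ)]
    exact lintegral_mono fun x => heatAvg_rpow_le hθ hρ1 hFm x
  have hrinv : (r⁻¹).toReal = 1 / ρ := by rw [ENNReal.toReal_inv, one_div]
  rcases eq_or_ne s ∞ with rfl | hs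
  · rw [ENNReal.inv_top, tsub_zero, hrinv, eLpNorm_exponent_top]
    exact eLpNormEssSup_le_of_ae_enorm_bound (Filter.Eventually.of_forall fun x => by
      rw [enorm_eq_self]; exact hsup' x)
  · have hs0 : s ≠ 0 := (one_pos.trans_le (hr.trans hrs)).ne'
    set σ := s.toReal with hσ
    have hρσ : ρ ≤ σ := (ENNReal.toReal_le_toReal hr' hs).mpr hrs
    have hσ0 : 0 < σ := hρ0.trans_le hρσ
    have hexp : (r⁻¹ - s⁻¹).toReal = 1 / ρ - 1 / σ := by
      rw [ENNReal.toReal_sub_of_le (ENNReal.inv_le_inv.mpr hrs) (ENNReal.inv_ne_top.mpr hr0),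
        ENNReal.toReal_inv, ENNReal.toReal_inv, one_div, one_div]
    rw [hexp, eLpNorm_eq_lintegral_rpow_enorm_toReal hs0 hs]
    simp only [enorm_eq_self]
    have hNσ : (A ^ (1 / ρ) * N) ^ (σ - ρ) * N ^ ρ = (A ^ (1 / ρ - 1 / σ) * N) ^ σ := by
      rw [ENNReal.mul_rpow_of_nonneg _ _ (sub_nonneg.mpr hρσ),
        ENNReal.mul_rpow_of_nonneg _ _ hσ0.le, ← ENNReal.rpow_mul, ← ENNReal.rpow_mul, mul_assoc,
        ← ENNReal.rpow_add_of_nonneg _ _ (sub_nonneg.mpr hρσ) hρ0.le, sub_add_cancel]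
      congr 2
      field_simp
    calc (∫⁻ x, heatAvg θ F x ^ σ) ^ (1 / σ)
        ≤ ((A ^ (1 / ρ - 1 / σ) * N) ^ σ) ^ (1 / σ) := by
          refine ENNReal.rpow_le_rpow ?_ (by positivity)
          rw [← hNσ]
          calc ∫⁻ x, heatAvg θ F x ^ σ
              ≤ ∫⁻ x, (A ^ (1 / ρ) * N) ^ (σ - ρ) * heatAvg θ F x ^ ρ := by
                refine lintegral_mono fun x => ?_
                calc heatAvg θ F x ^ σ = heatAvg θ F x ^ (σ - ρ) * heatAvg θ F x ^ ρ := by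
                      rw [← ENNReal.rpow_add_of_nonneg _ _ (sub_nonneg.mpr hρσ) hρ0.le,
                        sub_add_cancel]
                  _ ≤ _ := by
                      gcongr
                      exact hsup' x
            _ = (A ^ (1 / ρ) * N) ^ (σ - ρ) * ∫⁻ x, heatAvg θ F x ^ ρ :=
                lintegral_const_mul _ ((measurable_heatAvg hFm).pow_const ρ)
            _ ≤ _ := by gcongr
      _ = _ := by rw [← ENNReal.rpow_mul, mul_one_div_cancel hσ0.ne', ENNReal.rpow_one]

/-- The heat flow at time `θ` applied to a trigonometric polynomial. -/
noncomputable def heatTrig (θ : ℝ) (S : Finset (Fin d → ℤ)) (c : (Fin d → ℤ) → ℂ) : C(Torus d, ℂ) :=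
  trigPoly S fun k => Real.exp (-θ * ∑ i, (k i : ℝ) ^ 2) * c k

/-- The `j`-th partial derivative of `heatTrig θ S c`. -/
noncomputable def heatTrigPartial (θ : ℝ) (S : Finset (Fin d → ℤ)) (c : (Fin d → ℤ) → ℂ)
    (j : Fin d) : C(Torus d, ℂ) :=
  trigPoly S fun k => Real.exp (-θ * ∑ i, (k i : ℝ) ^ 2) * (Complex.I * k j) * c k

lemma integrable_coord_heatDensity_mul {θ : ℝ} (hθ : 0 < θ) (f : C(Torus d, ℂ)) (x : Torus d)
    (j : Fin d) :
    Integrable (fun y => ((y j / (2 * θ) * heatDensity θ y : ℝ) : ℂ) * f (x + torusMk y)) := by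
  refine (((integrable_heatDensity (d := d) (by positivity : 0 < 2 * θ)).const_mul
    (2 ^ d * (Real.sqrt θ)⁻¹)).mul_const ‖f‖).mono ?_ (Filter.Eventually.of_forall fun y => ?_)
  · refine Continuous.aestronglyMeasurable ?_
    have h1 := continuous_heatDensity (d := d) θ
    have h2 := continuous_torusMk (d := d)
    fun_prop
  · rw [norm_mul, norm_mul, Complex.norm_real, norm_norm]
    gcongr
    · rw [norm_mul, Real.norm_eq_abs, Real.norm_of_nonneg (heatDensity_nonneg _ _)]
      exact (abs_coord_mul_heatDensity_le hθ j y).trans (le_abs_self _)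
    · exact f.norm_coe_le_norm _

/-- The Fourier multiplier definition agrees with the Gaussian average, which is dominated by the
average of the absolute value. -/
lemma enorm_heatTrig_le {θ : ℝ} (hθ : 0 < θ) (S : Finset (Fin d → ℤ)) (c : (Fin d → ℤ) → ℂ)
    (x : Torus d) : ‖heatTrig θ S c x‖ₑ ≤ heatAvg θ (fun z => ‖trigPoly S c z‖ₑ) x := by
  have h : heatTrig θ S c x = ∫ y, (heatDensity θ y : ℂ) * trigPoly S c (x + torusMk y) := by
    have h : ∀ y : Fin d → ℝ, (heatDensity θ y : ℂ) * trigPoly S c (x + torusMk y)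
        = ∑ k ∈ S, c k * ((heatDensity θ y : ℂ) * torusMonomial k (x + torusMk y)) := by
      intro y
      rw [trigPoly_apply, Finset.mul_sum]
      exact Finset.sum_congr rfl fun k _ => by ring
    simp_rw [h]
    rw [integral_finsetSum _ fun k _ => (integrable_heatDensity_mul hθ _ x).const_mul _]
    simp_rw [integral_const_mul, integral_heatDensity_mul_torusMonomial hθ]
    rw [heatTrig, trigPoly_apply]
    exact Finset.sum_congr rfl fun k _ => by ring
  rw [h]
  refine (enorm_integral_le_lintegral_enorm _).trans (lintegral_mono fun y => ?_)
  rw [enorm_mul, ← ofReal_norm, Complex.norm_real, Real.norm_of_nonneg (heatDensity_nonneg _ _)]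

lemma enorm_heatTrigPartial_le {θ : ℝ} (hθ : 0 < θ) (S : Finset (Fin d → ℤ))
    (c : (Fin d → ℤ) → ℂ) (j : Fin d) (x : Torus d) :
    ‖heatTrigPartial θ S c j x‖ₑ ≤ ENNReal.ofReal (2 ^ d * (Real.sqrt θ)⁻¹) *
      heatAvg (2 * θ) (fun z => ‖trigPoly S c z‖ₑ) x := by
  have h : heatTrigPartial θ S c j x =
      ∫ y, ((y j / (2 * θ) * heatDensity θ y : ℝ) : ℂ) * trigPoly S c (x + torusMk y) := by
    have h : ∀ y : Fin d → ℝ,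
        ((y j / (2 * θ) * heatDensity θ y : ℝ) : ℂ) * trigPoly S c (x + torusMk y)
        = ∑ k ∈ S, c k * (((y j / (2 * θ) * heatDensity θ y : ℝ) : ℂ) *
          torusMonomial k (x + torusMk y)) := by
      intro y
      rw [trigPoly_apply, Finset.mul_sum]
      exact Finset.sum_congr rfl fun k _ => by ring
    simp_rw [h]
    rw [integral_finsetSum _ fun k _ => (integrable_coord_heatDensity_mul hθ _ x j).const_mul _]
    simp_rw [integral_const_mul, integral_coord_heatDensity_mul_torusMonomial hθ]
    rw [heatTrigPartial, trigPoly_apply]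
    exact Finset.sum_congr rfl fun k _ => by ring
  rw [h]
  refine (enorm_integral_le_lintegral_enorm _).trans ?_
  refine le_trans (lintegral_mono fun y => ?_) (lintegral_coord_heatDensity_le hθ j _ x)
  rw [enorm_mul, ← ofReal_norm (_ : ℂ), Complex.norm_real, norm_mul, Real.norm_eq_abs,
    Real.norm_of_nonneg (heatDensity_nonneg _ _)]

lemma eLpNorm_heatTrig_le {θ Θ : ℝ} (hθ : 0 < θ) (hθ' : θ ≤ Θ) (S : Finset (Fin d → ℤ))
    (c : (Fin d → ℤ) → ℂ) {r s : ℝ≥0∞} (hr : 1 ≤ r) (hr' : r ≠ ∞) (hrs : r ≤ s) :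
    eLpNorm (heatTrig θ S c) s volume
      ≤ ENNReal.ofReal (heatSupConst d Θ θ) ^ (r⁻¹ - s⁻¹).toReal *
        eLpNorm (trigPoly S c) r volume :=
  (eLpNorm_mono_enorm fun x => (enorm_heatTrig_le hθ S c x).trans_eq (enorm_eq_self _).symm).trans
    (eLpNorm_heatAvg_le hθ hθ' _ hr hr' hrs)

lemma eLpNorm_heatTrigPartial_le {θ Θ : ℝ} (hθ : 0 < θ) (hθ' : 2 * θ ≤ Θ)
    (S : Finset (Fin d → ℤ)) (c : (Fin d → ℤ) → ℂ) (j : Fin d) {r s : ℝ≥0∞} (hr : 1 ≤ r)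
    (hr' : r ≠ ∞) (hrs : r ≤ s) :
    eLpNorm (heatTrigPartial θ S c j) s volume
      ≤ ENNReal.ofReal (2 ^ d * (Real.sqrt θ)⁻¹) *
        (ENNReal.ofReal (heatSupConst d Θ (2 * θ)) ^ (r⁻¹ - s⁻¹).toReal *
        eLpNorm (trigPoly S c) r volume) := by
  refine le_trans ?_ (mul_le_mul_right (eLpNorm_heatAvg_le (by positivity) hθ' _ hr hr' hrs) _)
  refine eLpNorm_le_nnreal_smul_eLpNorm_of_ae_le_mul' (Filter.Eventually.of_forall fun x => ?_) s
  rw [enorm_eq_self]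
  exact enorm_heatTrigPartial_le hθ S c j x

end HeatLpLq

/-! ### Duality against trigonometric polynomials. -/

section Duality
variable {d : ℕ}

lemma exists_trigPoly_eLpNorm_sub_le {φ : Torus d → ℂ} (hφ : MemLp φ 2 volume) {ε : ℝ≥0∞}
    (hε : ε ≠ 0) : ∃ S c, eLpNorm (φ - ⇑(trigPoly S c)) 2 volume ≤ ε := by
  obtain ⟨g, hg, hgm⟩ := hφ.exists_boundedContinuous_eLpNorm_sub_le (by norm_num)
    (ENNReal.half_pos hε).ne'
  set V : ℝ≥0∞ := (volume : Measure (Torus d)) univ ^ ((2 : ℝ≥0∞).toReal)⁻¹ with hV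
  have hVt : V ≠ ∞ := ENNReal.rpow_ne_top_of_nonneg (by positivity) (measure_ne_top _ _)
  obtain ⟨δ, hδ, hδV⟩ : ∃ δ : ℝ, 0 < δ ∧ V * ENNReal.ofReal δ ≤ ε / 2 := by
    obtain ⟨δ, hδ, h⟩ := ENNReal.exists_nnreal_pos_mul_lt hVt (ENNReal.half_pos hε).ne'
    refine ⟨δ, hδ, ?_⟩
    rw [ENNReal.ofReal_coe_nnreal, mul_comm]
    exact h.le
  obtain ⟨S, c, hSc⟩ := exists_trigPoly_norm_sub_lt g.toContinuousMap hδ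
  refine ⟨S, c, ?_⟩
  have h2 : eLpNorm (⇑g - ⇑(trigPoly S c)) 2 volume ≤ ε / 2 := by
    refine le_trans (eLpNorm_le_of_ae_bound (C := δ) (Filter.Eventually.of_forall fun x => ?_)) hδV
    exact ((g.toContinuousMap - trigPoly S c).norm_coe_le_norm x).trans hSc.le
  calc eLpNorm (φ - ⇑(trigPoly S c)) 2 volume
      = eLpNorm ((φ - ⇑g) + (⇑g - ⇑(trigPoly S c))) 2 volume := by
        rw [sub_add_sub_cancel]
    _ ≤ ε / 2 + ε / 2 := (eLpNorm_add_le (hφ.1.sub hgm.1)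
        (hgm.1.sub (trigPoly S c).continuous.aestronglyMeasurable) (by norm_num)).trans
          (add_le_add hg h2)
    _ = ε := ENNReal.add_halves ε

lemma enorm_integral_mul_le_eLpNorm_two {f g : Torus d → ℂ} (hf : AEStronglyMeasurable f volume)
    (hg : AEStronglyMeasurable g volume) :
    ‖∫ x, f x * g x‖ₑ ≤ eLpNorm f 2 volume * eLpNorm g 2 volume := by
  refine (enorm_integral_le_lintegral_enorm _).trans ?_
  have := eLpNorm_smul_le_mul_eLpNorm (p := 2) (q := 2) (r := 1) hg hf
  rw [eLpNorm_one_eq_lintegral_enorm] at this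
  exact this

/-- Trigonometric polynomials are dense in `L^2`, and both sides are continuous in `φ` for the `L^2`
norm: the left since `w ∈ L^2`, the right since `r ≤ 2` on a space of finite measure. The `L^2` norm
of `w` enters the error only and disappears in the limit. -/
lemma enorm_integral_mul_le_of_trigPoly {w : Torus d → ℝ} (hw : MemLp w 2 volume) {r N : ℝ≥0∞}
    (hr : 1 ≤ r) (hr2 : r ≤ 2) (hN : N ≠ ∞)
    (h : ∀ S c, ‖∫ x, (w x : ℂ) * trigPoly S c x‖ₑ ≤ N * eLpNorm (trigPoly S c) r volume)
    {φ : Torus d → ℂ} (hφ : MemLp φ 2 volume) :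
    ‖∫ x, (w x : ℂ) * φ x‖ₑ ≤ N * eLpNorm φ r volume := by
  have hwc : MemLp (fun x => (w x : ℂ)) 2 volume := hw.ofReal
  set V : ℝ≥0∞ := (volume : Measure (Torus d)) univ ^ (1 / r.toReal - 1 / (2 : ℝ≥0∞).toReal) with hV
  have hVt : V ≠ ∞ := by
    refine ENNReal.rpow_ne_top_of_nonneg ?_ (measure_ne_top _ _)
    have hrt : r ≠ ∞ := ne_top_of_le_ne_top (by norm_num) hr2
    have h1 : 0 < r.toReal := ENNReal.toReal_pos (one_pos.trans_le hr).ne' hrt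
    have h2 : r.toReal ≤ (2 : ℝ≥0∞).toReal := ENNReal.toReal_mono (by norm_num) hr2
    exact sub_nonneg.mpr (one_div_le_one_div_of_le h1 h2)
  set K : ℝ≥0∞ := eLpNorm (fun x => (w x : ℂ)) 2 volume + N * V with hK
  have hKt : K ≠ ∞ := ENNReal.add_ne_top.mpr ⟨hwc.2.ne, ENNReal.mul_ne_top hN hVt⟩
  refine ENNReal.le_of_forall_pos_le_add fun ε hε _ => ?_
  obtain ⟨δ, hδ, hδK⟩ := ENNReal.exists_nnreal_pos_mul_lt hKt
    (ENNReal.coe_ne_zero.mpr hε.ne')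
  obtain ⟨S, c, hSc⟩ := exists_trigPoly_eLpNorm_sub_le hφ (ENNReal.coe_ne_zero.mpr hδ.ne')
  set T := trigPoly S c
  have hT : MemLp T 2 volume := T.continuous.memLp_of_hasCompactSupport (HasCompactSupport.of_compactSpace _)
  have hd : eLpNorm (φ - ⇑T) r volume ≤ δ * V :=
    (eLpNorm_le_eLpNorm_mul_rpow_measure_univ hr2 (hφ.1.sub hT.1)).trans (by gcongr)
  have e1 : ∫ x, (w x : ℂ) * φ x = (∫ x, (w x : ℂ) * T x) + ∫ x, (w x : ℂ) * (φ - ⇑T) x := by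
    rw [← integral_add]
    · refine integral_congr_ae (Filter.Eventually.of_forall fun x => ?_)
      simp [← mul_add]
    · exact hwc.integrable_mul hT
    · exact hwc.integrable_mul (hφ.sub hT)
  have e2 : eLpNorm T r volume ≤ eLpNorm φ r volume + eLpNorm (φ - ⇑T) r volume := by
    calc eLpNorm T r volume = eLpNorm (φ - (φ - ⇑T)) r volume := by rw [sub_sub_cancel]
      _ ≤ _ := eLpNorm_sub_le hφ.1 (hφ.1.sub hT.1) hr
  calc ‖∫ x, (w x : ℂ) * φ x‖ₑ
      ≤ ‖∫ x, (w x : ℂ) * T x‖ₑ + ‖∫ x, (w x : ℂ) * (φ - ⇑T) x‖ₑ := by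
        rw [e1]; exact enorm_add_le _ _
    _ ≤ N * (eLpNorm φ r volume + δ * V) + eLpNorm (fun x => (w x : ℂ)) 2 volume * δ := by
        refine add_le_add ((h S c).trans ?_)
          ((enorm_integral_mul_le_eLpNorm_two hwc.1 (hφ.1.sub hT.1)).trans ?_)
        · gcongr; exact e2.trans (by gcongr)
        · gcongr
    _ = N * eLpNorm φ r volume + δ * K := by rw [hK]; ring
    _ ≤ _ := by gcongr

/-- Converse Hölder inequality, without assuming `w ∈ L^m` beforehand: `w` is tested with
truncations of the extremal function `sign(w) |w|^{m-1}`, and the truncation is removed by monotone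
convergence. -/
lemma eLpNorm_le_of_trigPoly {w : Torus d → ℝ} (hwm : Measurable w) (hw : MemLp w 2 volume)
    {m r N : ℝ≥0∞} (hm : 2 ≤ m) (hm' : m ≠ ∞) (hmr : m⁻¹ + r⁻¹ = 1)
    (h : ∀ S c, ‖∫ x, (w x : ℂ) * trigPoly S c x‖ₑ ≤ N * eLpNorm (trigPoly S c) r volume) :
    eLpNorm w m volume ≤ N := by
  rcases eq_or_ne N ∞ with rfl | hN
  · exact le_top
  have hconj : ENNReal.HolderConjugate m r := ⟨by simpa using hmr⟩
  have hr : 1 ≤ r := ENNReal.HolderConjugate.one_le r m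
  have hr2 : r ≤ 2 := by
    by_contra! hlt
    have h1 : r⁻¹ < 2⁻¹ := ENNReal.inv_lt_inv.mpr hlt
    have h2 : m⁻¹ ≤ 2⁻¹ := ENNReal.inv_le_inv.mpr hm
    have := ENNReal.add_lt_add_of_le_of_lt (ne_top_of_le_ne_top (by norm_num) h2) h2 h1
    rw [hmr, ENNReal.inv_two_add_inv_two] at this
    exact lt_irrefl _ this
  have hrt : r ≠ ∞ := ne_top_of_le_ne_top (by norm_num) hr2
  have hr0 : r ≠ 0 := (one_pos.trans_le hr).ne'
  have hm0 : m ≠ 0 := (two_pos.trans_le hm).ne'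
  set p := m.toReal with hp
  set ρ := r.toReal with hρ
  have hp2 : 2 ≤ p := by
    have := (ENNReal.toReal_le_toReal (by norm_num) hm').mpr hm
    simpa using this
  have hρ0 : 0 < ρ := ENNReal.toReal_pos hr0 hrt
  have hsum : 1 / p + 1 / ρ = 1 := by
    have := congrArg ENNReal.toReal hmr
    rw [ENNReal.toReal_add (ENNReal.inv_ne_top.mpr hm0) (ENNReal.inv_ne_top.mpr hr0),
      ENNReal.toReal_inv, ENNReal.toReal_inv, ENNReal.toReal_one] at this
    simpa using this
  have hp0 : 0 < p := by linarith
  have hpρ : (p - 1) * ρ = p := by field_simp at hsum; linarith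
  have hdual := fun φ (hφ : MemLp φ 2 volume) =>
    enorm_integral_mul_le_of_trigPoly hw hr hr2 hN h (φ := φ) hφ
  -- truncated powers
  have key : ∀ n : ℕ, ∫⁻ x, ENNReal.ofReal (min |w x| n) ^ p ≤ N ^ p := by
    intro n
    set t : Torus d → ℝ := fun x => min |w x| n with ht
    have htm : Measurable t := (hwm.abs).min measurable_const
    have ht0 : ∀ x, 0 ≤ t x := fun x => le_min (abs_nonneg _) (Nat.cast_nonneg n)
    have htn : ∀ x, t x ≤ n := fun x => min_le_right _ _
    -- The power `p - 1` is chosen because `(p - 1) ρ = p`: the `L^r` norm of `φ` is then a power of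
    -- the same integral `I` that bounds the pairing from below.
    set φ : Torus d → ℝ := fun x => SignType.sign (w x) * t x ^ (p - 1) with hφ
    have hφm : Measurable φ := by
      refine Measurable.mul ?_ (htm.pow_const _)
      have hs : Measurable (fun y : ℝ => ((SignType.sign y : SignType) : ℝ)) := by
        have : (fun y : ℝ => ((SignType.sign y : SignType) : ℝ))
            = fun y => if 0 < y then 1 else if y < 0 then -1 else 0 := by
          funext y
          rw [sign_apply]
          split_ifs <;> simp
        rw [this]
        exact Measurable.ite measurableSet_Ioi measurable_const
          (Measurable.ite measurableSet_Iio measurable_const measurable_const)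
      exact hs.comp hwm
    have hφabs : ∀ x, |φ x| = t x ^ (p - 1) := by
      intro x
      rw [hφ]
      simp only [abs_mul, abs_of_nonneg (Real.rpow_nonneg (ht0 x) _)]
      rcases eq_or_ne (w x) 0 with h0 | h0
      · have : t x = 0 := by simp [ht, h0]
        rw [this, Real.zero_rpow (by linarith), mul_zero]
      · rcases lt_or_gt_of_ne h0 with h1 | h1
        · simp [sign_neg h1]
        · simp [sign_pos h1]
    have hwφ : ∀ x, w x * φ x = |w x| * t x ^ (p - 1) := by
      intro x
      rw [hφ]
      simp only
      rw [← mul_assoc, mul_comm (w x), sign_mul_self]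
    have hbound : ∀ x, ‖(φ x : ℂ)‖ ≤ (n : ℝ) ^ (p - 1) := by
      intro x
      rw [Complex.norm_real, Real.norm_eq_abs, hφabs]
      exact Real.rpow_le_rpow (ht0 x) (htn x) (by linarith)
    have hφL : MemLp (fun x => (φ x : ℂ)) 2 volume :=
      MemLp.of_bound (Complex.measurable_ofReal.comp hφm).aestronglyMeasurable _
        (Filter.Eventually.of_forall hbound)
    have hd := hdual _ hφL
    set I := ∫⁻ x, ENNReal.ofReal (t x) ^ p with hI
    -- Truncation makes `I` finite, so `I^{1/ρ}` can be cancelled from `I ≤ N I^{1/ρ}`.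
    have hIt : I ≠ ∞ := by
      refine ne_top_of_le_ne_top ?_ (lintegral_mono (g := fun _ => ENNReal.ofReal n ^ p)
        fun x => ENNReal.rpow_le_rpow (ENNReal.ofReal_le_ofReal (htn x)) hp0.le)
      rw [lintegral_const]
      exact ENNReal.mul_ne_top (ENNReal.rpow_ne_top_of_nonneg hp0.le ENNReal.ofReal_ne_top)
        (measure_ne_top _ _)
    have hnorm : eLpNorm (fun x => (φ x : ℂ)) r volume = I ^ (1 / ρ) := by
      rw [eLpNorm_eq_lintegral_rpow_enorm_toReal hr0 hrt, hI]
      congr 1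
      refine lintegral_congr fun x => ?_
      rw [← ofReal_norm, Complex.norm_real, Real.norm_eq_abs, hφabs,
        ← ENNReal.ofReal_rpow_of_nonneg (ht0 x) (by linarith), ← ENNReal.rpow_mul, hpρ]
    have hlow : I ≤ ‖∫ x, (w x : ℂ) * (φ x : ℂ)‖ₑ := by
      have e1 : ∫ x, (w x : ℂ) * (φ x : ℂ) = ((∫ x, |w x| * t x ^ (p - 1) : ℝ) : ℂ) := by
        rw [← integral_complex_ofReal]
        refine integral_congr_ae (Filter.Eventually.of_forall fun x => ?_)
        simp only
        rw [← Complex.ofReal_mul, hwφ x]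
      have hnn : ∀ x, 0 ≤ |w x| * t x ^ (p - 1) := fun x =>
        mul_nonneg (abs_nonneg _) (Real.rpow_nonneg (ht0 x) _)
      have hint : Integrable (fun x => |w x| * t x ^ (p - 1)) := by
        have := (hw.integrable_mul (hφL.re)).congr (Filter.Eventually.of_forall fun x => by
          change w x * ((φ x : ℂ)).re = |w x| * t x ^ (p - 1)
          rw [Complex.ofReal_re, hwφ])
        exact this
      rw [e1, ← ofReal_norm, Complex.norm_real, Real.norm_of_nonneg (integral_nonneg hnn),
        ofReal_integral_eq_lintegral_ofReal hint (Filter.Eventually.of_forall hnn), hI]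
      refine lintegral_mono fun x => ?_
      rw [ENNReal.ofReal_rpow_of_nonneg (ht0 x) hp0.le]
      refine ENNReal.ofReal_le_ofReal ?_
      calc t x ^ p = t x * t x ^ (p - 1) := by
            nth_rw 2 [← Real.rpow_one (t x)]
            rw [← Real.rpow_add_of_nonneg (ht0 x) zero_le_one (by linarith), add_sub_cancel]
        _ ≤ _ := mul_le_mul_of_nonneg_right (min_le_left _ _) (Real.rpow_nonneg (ht0 x) _)
    rw [hnorm] at hd
    have hIN := hlow.trans hd
    rcases eq_or_ne I 0 with h0 | h0
    · rw [h0]; simp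
    have h3 : I ^ (1 / p) ≤ N := by
      have h4 : I = I ^ (1 / p) * I ^ (1 / ρ) := by
        rw [← ENNReal.rpow_add _ _ h0 hIt, hsum, ENNReal.rpow_one]
      refine (ENNReal.mul_le_mul_iff_left ?_ ?_).mp (h4.symm.trans_le hIN)
      · exact (ENNReal.rpow_pos (pos_iff_ne_zero.mpr h0) hIt).ne'
      · exact ENNReal.rpow_ne_top_of_nonneg (by positivity) hIt
    calc I = (I ^ (1 / p)) ^ p := by
          rw [← ENNReal.rpow_mul, one_div_mul_cancel hp0.ne', ENNReal.rpow_one]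
      _ ≤ N ^ p := by gcongr
  have hlim : ∫⁻ x, ‖w x‖ₑ ^ p ≤ N ^ p := by
    have e : ∀ x, ‖w x‖ₑ ^ p = ⨆ n : ℕ, ENNReal.ofReal (min |w x| n) ^ p := by
      intro x
      refine le_antisymm ?_ (iSup_le fun n => ?_)
      · obtain ⟨n, hn⟩ := exists_nat_ge |w x|
        refine le_iSup_of_le n ?_
        rw [min_eq_left hn, Real.enorm_eq_ofReal_abs]
      · rw [Real.enorm_eq_ofReal_abs]
        gcongr
        exact min_le_left _ _
    simp_rw [e]
    rw [lintegral_iSup]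
    · exact iSup_le key
    · intro n
      exact ((hwm.abs.min measurable_const).ennreal_ofReal).pow_const p
    · intro a b hab x
      simp only
      gcongr
  rw [eLpNorm_eq_lintegral_rpow_enorm_toReal hm0 hm']
  calc _ ≤ (N ^ p) ^ (1 / p) := ENNReal.rpow_le_rpow hlim (by positivity)
    _ = N := by rw [← ENNReal.rpow_mul, mul_one_div_cancel hp0.ne', ENNReal.rpow_one]

end Duality

/-! ### Duhamel's formula for a scalar integral equation. -/

section Duhamel

/-- Fubini on the triangle `r ≤ s ≤ t`, the inner integral of `lam e^{lam s}` over `[r,t]` being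
explicit. -/
lemma integral_exp_mul_primitive {t lam : ℝ} {h : ℝ → ℂ} (hh : IntegrableOn h (Ioc 0 t)) :
    ∫ s in Ioc 0 t, ((lam * Real.exp (lam * s) : ℝ) : ℂ) * ∫ r in Ioc 0 s, h r
      = ∫ r in Ioc 0 t, ((Real.exp (lam * t) - Real.exp (lam * r) : ℝ) : ℂ) * h r := by
  set E : ℝ → ℝ := fun s => lam * Real.exp (lam * s) with hE
  have hEc : Continuous E := by fun_prop
  set Φ : ℝ → ℝ → ℂ := fun s r => (Ici r).indicator (fun s => (E s : ℂ)) s * h r with hΦ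
  obtain ⟨K, hK⟩ : ∃ K, ∀ s ∈ Icc 0 t, ‖E s‖ ≤ K :=
    isCompact_Icc.exists_bound_of_continuousOn hEc.continuousOn
  have hint : Integrable (Function.uncurry Φ)
      ((volume.restrict (Ioc 0 t)).prod (volume.restrict (Ioc 0 t))) := by
    have h1 : Integrable (fun z : ℝ × ℝ => h z.2)
        ((volume.restrict (Ioc 0 t)).prod (volume.restrict (Ioc 0 t))) := hh.comp_snd _
    have hm : Measurable (fun z : ℝ × ℝ => (Ici z.2).indicator (fun s => (E s : ℂ)) z.1) := by
      have : (fun z : ℝ × ℝ => (Ici z.2).indicator (fun s => (E s : ℂ)) z.1)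
          = {z : ℝ × ℝ | z.2 ≤ z.1}.indicator fun z => (E z.1 : ℂ) := by
        funext z
        simp only [indicator, mem_Ici, mem_ofPred_eq]
      rw [this]
      exact (Complex.measurable_ofReal.comp (hEc.measurable.comp measurable_fst)).indicator
        (measurableSet_le measurable_snd measurable_fst)
    refine h1.bdd_mul (c := K) hm.aestronglyMeasurable ?_
    rw [Measure.prod_restrict]
    refine (ae_restrict_iff' (measurableSet_Ioc.prod measurableSet_Ioc)).mpr
      (Filter.Eventually.of_forall fun z hz => ?_)
    have hb := hK z.1 (Ioc_subset_Icc_self hz.1)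
    refine (norm_indicator_le_norm_self _ _).trans ?_
    rwa [Complex.norm_real]
  have hswap := integral_integral_swap hint
  have hl : ∀ s ∈ Ioc 0 t, ∫ r in Ioc 0 t, Φ s r = (E s : ℂ) * ∫ r in Ioc 0 s, h r := by
    intro s hs
    have : ∀ r, Φ s r = (Iic s).indicator (fun r => (E s : ℂ) * h r) r := by
      intro r
      simp only [hΦ, indicator, mem_Ici, mem_Iic]
      split_ifs <;> simp
    simp_rw [this]
    rw [setIntegral_indicator measurableSet_Iic, Ioc_inter_Iic, min_eq_right hs.2,
      integral_const_mul]
  have hr : ∀ r ∈ Ioc 0 t, ∫ s in Ioc 0 t, Φ s r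
      = ((Real.exp (lam * t) - Real.exp (lam * r) : ℝ) : ℂ) * h r := by
    intro r hr
    simp only [hΦ]
    rw [integral_mul_const, setIntegral_indicator measurableSet_Ici]
    congr 1
    have : Ioc 0 t ∩ Ici r = Icc r t := by
      ext s
      simp only [mem_inter_iff, mem_Ioc, mem_Ici, mem_Icc]
      constructor
      · rintro ⟨⟨_, h2⟩, h3⟩; exact ⟨h3, h2⟩
      · rintro ⟨h1, h2⟩; exact ⟨⟨hr.1.trans_le h1, h2⟩, h1⟩
    rw [this, integral_Icc_eq_integral_Ioc, integral_complex_ofReal,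
      ← intervalIntegral.integral_of_le hr.2]
    congr 1
    refine intervalIntegral.integral_eq_sub_of_hasDerivAt (f := fun s => Real.exp (lam * s))
      (fun s _ => ?_) (hEc.intervalIntegrable _ _)
    have := ((hasDerivAt_id s).const_mul lam).exp
    simpa [hE, mul_comm] using this
  rw [← setIntegral_congr_fun measurableSet_Ioc hl, hswap,
    setIntegral_congr_fun measurableSet_Ioc hr]

/-- The equation holds only for a.e. time, so the integrating factor is applied by Fubini rather
than by differentiating `a`. In the resulting identity the two integrals of `e^{lam s} a(s)` cancel.
-/
lemma duhamel_of_ae_integral_eq {T lam : ℝ} {a F : ℝ → ℂ} (ha : IntegrableOn a (Ioc 0 T))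
    (hF : IntegrableOn F (Ioc 0 T))
    (h : ∀ᵐ t ∂(volume.restrict (Ioc 0 T)),
      a t = (∫ s in Ioc 0 t, F s) - lam * ∫ s in Ioc 0 t, a s) :
    ∀ᵐ t ∂(volume.restrict (Ioc 0 T)),
      a t = ∫ s in Ioc 0 t, (Real.exp (-lam * (t - s)) : ℂ) * F s := by
  have hae : ∀ᵐ t ∂(volume.restrict (Ioc 0 T)), t ∈ Ioc 0 T := ae_restrict_mem measurableSet_Ioc
  filter_upwards [h, hae] with t ht htT
  have hsub : Ioc 0 t ⊆ Ioc 0 T := Ioc_subset_Ioc_right htT.2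
  have hat : IntegrableOn a (Ioc 0 t) := ha.mono_set hsub
  have hFt : IntegrableOn F (Ioc 0 t) := hF.mono_set hsub
  have hh : IntegrableOn (fun s => F s - lam * a s) (Ioc 0 t) := hFt.sub (hat.const_mul _)
  have hprim : ∀ s ∈ Ioc 0 t, ∫ r in Ioc 0 s, (F r - lam * a r)
      = (∫ r in Ioc 0 s, F r) - lam * ∫ r in Ioc 0 s, a r := by
    intro s hs
    have hs' : Ioc 0 s ⊆ Ioc 0 t := Ioc_subset_Ioc_right hs.2
    rw [integral_sub (hFt.mono_set hs') ((hat.mono_set hs').const_mul _), integral_const_mul]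
  have hbd : ∀ f : ℝ → ℂ, IntegrableOn f (Ioc 0 t) →
      IntegrableOn (fun s => (Real.exp (lam * s) : ℂ) * f s) (Ioc 0 t) := by
    intro f hf
    obtain ⟨K, hK⟩ : ∃ K, ∀ s ∈ Icc 0 t, ‖Real.exp (lam * s)‖ ≤ K :=
      isCompact_Icc.exists_bound_of_continuousOn (by fun_prop)
    refine Integrable.bdd_mul (c := K) hf (by fun_prop) ?_
    refine (ae_restrict_iff' measurableSet_Ioc).mpr (Filter.Eventually.of_forall fun s hs => ?_)
    rw [Complex.norm_real]
    exact hK s (Ioc_subset_Icc_self hs)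
  have key := integral_exp_mul_primitive (lam := lam) hh
  have hL : ∫ s in Ioc 0 t, ((lam * Real.exp (lam * s) : ℝ) : ℂ) *
      ∫ r in Ioc 0 s, (F r - lam * a r)
      = lam * ∫ s in Ioc 0 t, (Real.exp (lam * s) : ℂ) * a s := by
    rw [← integral_const_mul]
    refine integral_congr_ae ?_
    have h' := ae_restrict_of_ae_restrict_of_subset hsub h
    filter_upwards [h', ae_restrict_mem measurableSet_Ioc] with s hs hst
    rw [hprim s hst, ← hs]
    push_cast
    ring
  have hR : ∫ r in Ioc 0 t, ((Real.exp (lam * t) - Real.exp (lam * r) : ℝ) : ℂ) *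
      (F r - lam * a r) = Real.exp (lam * t) * a t -
        (∫ s in Ioc 0 t, (Real.exp (lam * s) : ℂ) * F s) +
        lam * ∫ s in Ioc 0 t, (Real.exp (lam * s) : ℂ) * a s := by
    have e : ∀ r, ((Real.exp (lam * t) - Real.exp (lam * r) : ℝ) : ℂ) * (F r - lam * a r)
        = Real.exp (lam * t) * (F r - lam * a r) -
          ((Real.exp (lam * r) : ℂ) * F r - lam * ((Real.exp (lam * r) : ℂ) * a r)) := by
      intro r; push_cast; ring
    have i3 : IntegrableOn
        (fun r => (Real.exp (lam * r) : ℂ) * F r - lam * ((Real.exp (lam * r) : ℂ) * a r))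
        (Ioc 0 t) := (hbd F hFt).sub ((hbd a hat).const_mul _)
    simp_rw [e]
    rw [integral_sub (hh.const_mul _) i3,
      integral_sub (hbd F hFt) ((hbd a hat).const_mul _), integral_const_mul, integral_const_mul,
      hprim t ⟨htT.1, le_rfl⟩, ← ht]
    ring
  rw [hL, hR] at key
  have e1 : ∫ s in Ioc 0 t, (Real.exp (-lam * (t - s)) : ℂ) * F s
      = Real.exp (-lam * t) * ∫ s in Ioc 0 t, (Real.exp (lam * s) : ℂ) * F s := by
    rw [← integral_const_mul]
    refine integral_congr_ae (Filter.Eventually.of_forall fun s => ?_)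
    simp only
    rw [← mul_assoc, ← Complex.ofReal_mul, ← Real.exp_add]
    ring_nf
  have e2 : ∫ s in Ioc 0 t, (Real.exp (lam * s) : ℂ) * F s = Real.exp (lam * t) * a t := by
    linear_combination key
  rw [e1, e2, ← mul_assoc, ← Complex.ofReal_mul, ← Real.exp_add]
  simp

end Duhamel

/-! ### From the weak formulation to the heat flow representation. -/

section Mild
variable {d : ℕ}

lemma torusLaplacian_re (k : Fin d → ℤ) (x : Torus d) :
    torusLaplacian (fun x => (torusMonomial k x).re) x
      = -(∑ i, (k i : ℝ) ^ 2) * (torusMonomial k x).re :=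
  congrFun (torusLaplacian_clm k Complex.reCLM) x

lemma torusLaplacian_im (k : Fin d → ℤ) (x : Torus d) :
    torusLaplacian (fun x => (torusMonomial k x).im) x
      = -(∑ i, (k i : ℝ) ^ 2) * (torusMonomial k x).im :=
  congrFun (torusLaplacian_clm k Complex.imCLM) x

lemma integrable_mul_continuousMap_snd {μ : Measure ℝ} {f : ℝ × Torus d → ℝ}
    (hf : Integrable f (μ.prod volume)) (φ : C(Torus d, ℂ)) :
    Integrable (fun z => (f z : ℂ) * φ z.2) (μ.prod volume) := by
  refine hf.ofReal.mul_bdd (c := ‖φ‖) ?_ (Filter.Eventually.of_forall fun z =>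
    φ.norm_coe_le_norm _)
  exact (φ.continuous.measurable.comp measurable_snd).aestronglyMeasurable

/-- Each Fourier coefficient of `w` solves a damped scalar equation. Duhamel's formula for the
modes, summed with weights `c k`, moves the heat flow onto the test polynomial. -/
lemma enorm_integral_mul_trigPoly_le {T ν : ℝ} {w g : ℝ → Torus d → ℝ}
    {b : ℝ → Torus d → EuclideanSpace ℝ (Fin d)}
    (hw : Integrable (fun z : ℝ × Torus d => w z.1 z.2)
      ((volume.restrict (Ioc 0 T)).prod volume))
    (hwg : Integrable (fun z : ℝ × Torus d => w z.1 z.2 * g z.1 z.2)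
      ((volume.restrict (Ioc 0 T)).prod volume))
    (hwb : ∀ i, Integrable (fun z : ℝ × Torus d => w z.1 z.2 * b z.1 z.2 i)
      ((volume.restrict (Ioc 0 T)).prod volume))
    (hweak : ∀ φ : Torus d → ℝ, TorusSmooth φ → ∀ᵐ t ∂(volume.restrict (Ioc 0 T)),
      ∫ x, w t x * φ x = - (∫ s in (0 : ℝ)..t,
          ∫ x, w s x * (g s x * φ x + ∑ i : Fin d, b s x i * torusPartial i φ x))
        + ν * ∫ s in (0 : ℝ)..t, ∫ x, w s x * torusLaplacian φ x) :
    ∀ᵐ t ∂(volume.restrict (Ioc 0 T)), ∀ S c,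
      ‖∫ x, (w t x : ℂ) * trigPoly S c x‖ₑ ≤ ∫⁻ s in Ioc 0 t, ∫⁻ x,
        (‖w s x‖ₑ * ‖g s x‖ₑ * ‖heatTrig (ν * (t - s)) S c x‖ₑ +
          ∑ i, ‖w s x‖ₑ * ‖b s x i‖ₑ * ‖heatTrigPartial (ν * (t - s)) S c i x‖ₑ) := by
  set μ := volume.restrict (Ioc (0 : ℝ) T) with hμ
  let H : (Fin d → ℤ) → ℝ × Torus d → ℂ := fun k z =>
    ((w z.1 z.2 * g z.1 z.2 : ℝ) : ℂ) * torusMonomial k z.2 +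
      ∑ i, ((w z.1 z.2 * b z.1 z.2 i : ℝ) : ℂ) * (Complex.I * k i * torusMonomial k z.2)
  let W0 : (Fin d → ℤ) → ℝ × Torus d → ℂ := fun k z => (w z.1 z.2 : ℂ) * torusMonomial k z.2
  have hH : ∀ k, Integrable (H k) (μ.prod volume) := fun k =>
    (integrable_mul_continuousMap_snd hwg (torusMonomial k)).add
      (integrable_finsetSum _ fun i _ =>
        integrable_mul_continuousMap_snd (hwb i) ((Complex.I * k i) • torusMonomial k))
  have hW0 : ∀ k, Integrable (W0 k) (μ.prod volume) := fun k =>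
    integrable_mul_continuousMap_snd hw (torusMonomial k)
  let F : (Fin d → ℤ) → ℝ → ℂ := fun k s => -∫ x, H k (s, x)
  let W : (Fin d → ℤ) → ℝ → ℂ := fun k s => ∫ x, W0 k (s, x)
  have hF : ∀ k, IntegrableOn (F k) (Ioc 0 T) := fun k => (hH k).integral_prod_left.neg
  have hW : ∀ k, IntegrableOn (W k) (Ioc 0 T) := fun k => (hW0 k).integral_prod_left
  have hHs : ∀ k, ∀ᵐ s ∂μ, Integrable (fun x => H k (s, x)) := fun k => (hH k).prod_right_ae
  have hWs : ∀ k, ∀ᵐ s ∂μ, Integrable (fun x => W0 k (s, x)) := fun k => (hW0 k).prod_right_ae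
  have hmode : ∀ k, ∀ᵐ t ∂μ, W k t = (∫ s in Ioc 0 t, F k s)
      - (ν * ∑ i, (k i : ℝ) ^ 2 : ℝ) * ∫ s in Ioc 0 t, W k s := by
    intro k
    have hmem : ∀ᵐ t ∂μ, t ∈ Ioc 0 T := ae_restrict_mem measurableSet_Ioc
    filter_upwards [hweak _ (torusSmooth_re k), hweak _ (torusSmooth_im k), hmem, hWs k]
      with t h1 h2 htT hWt
    have hsub : Ioc 0 t ⊆ Ioc 0 T := Ioc_subset_Ioc_right htT.2
    have hFt := (hF k).mono_set hsub
    have hWt' := (hW k).mono_set hsub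
    have hHs' := ae_restrict_of_ae_restrict_of_subset hsub (hHs k)
    have hWs' := ae_restrict_of_ae_restrict_of_subset hsub (hWs k)
    -- One computation serves the real and the imaginary part; together they give the complex
    -- equation of the mode.
    have clm : ∀ L : ℂ →L[ℝ] ℝ, (∀ (x : Torus d) (c : ℝ) (z : ℂ), L ((c : ℂ) * z) = c * L z) →
        (∫ x, w t x * L (torusMonomial k x) = - (∫ s in (0 : ℝ)..t,
          ∫ x, w s x * (g s x * L (torusMonomial k x) +
            ∑ i : Fin d, b s x i * L (Complex.I * k i * torusMonomial k x)))
        + ν * ∫ s in (0 : ℝ)..t, ∫ x, w s x * (-(∑ i, (k i : ℝ) ^ 2) * L (torusMonomial k x))) →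
        L (W k t) = L ((∫ s in Ioc 0 t, F k s)
          - (ν * ∑ i, (k i : ℝ) ^ 2 : ℝ) * ∫ s in Ioc 0 t, W k s) := by
      intro L hL hLe
      have hL' : ∀ (c : ℝ) (z : ℂ), L ((c : ℂ) * z) = c * L z := hL 0
      have e1 : ∫ x, w t x * L (torusMonomial k x) = L (W k t) := by
        rw [← L.integral_comp_comm hWt]
        exact integral_congr_ae (Filter.Eventually.of_forall fun x => (hL' _ _).symm)
      have e2 : ∫ s in (0 : ℝ)..t, ∫ x, w s x * (g s x * L (torusMonomial k x) +
            ∑ i : Fin d, b s x i * L (Complex.I * k i * torusMonomial k x))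
          = -L (∫ s in Ioc 0 t, F k s) := by
        rw [← L.integral_comp_comm hFt, intervalIntegral.integral_of_le htT.1.le, ← integral_neg]
        refine integral_congr_ae ?_
        filter_upwards [hHs'] with s hs
        simp only [F]
        rw [map_neg, neg_neg, ← L.integral_comp_comm hs]
        refine integral_congr_ae (Filter.Eventually.of_forall fun x => ?_)
        simp only [H]
        rw [map_add, map_sum, hL']
        simp_rw [hL']
        rw [mul_add, Finset.mul_sum, mul_assoc]
        simp_rw [mul_assoc]
      have e3 : ∫ s in (0 : ℝ)..t, ∫ x, w s x * (-(∑ i, (k i : ℝ) ^ 2) * L (torusMonomial k x))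
          = -(∑ i, (k i : ℝ) ^ 2) * L (∫ s in Ioc 0 t, W k s) := by
        rw [← L.integral_comp_comm hWt', intervalIntegral.integral_of_le htT.1.le,
          ← integral_const_mul]
        refine integral_congr_ae ?_
        filter_upwards [hWs'] with s hs
        simp only [W]
        rw [← L.integral_comp_comm hs, ← integral_const_mul]
        refine integral_congr_ae (Filter.Eventually.of_forall fun x => ?_)
        simp only [W0]
        rw [hL']
        ring
      rw [e1, e2, e3] at hLe
      rw [map_sub, hL', hLe]
      ring
    refine Complex.ext ?_ ?_
    · refine clm Complex.reCLM (fun _ c z => by simp) ?_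
      simpa only [torusPartial_re, torusLaplacian_re, Complex.reCLM_apply] using h1
    · refine clm Complex.imCLM (fun _ c z => by simp) ?_
      simpa only [torusPartial_im, torusLaplacian_im, Complex.imCLM_apply] using h2
  -- There are countably many modes, so a single null set of times works for all `k`, hence for all
  -- polynomials at once. Duality at fixed `t` needs this.
  have hduh : ∀ᵐ t ∂μ, ∀ k, W k t = ∫ s in Ioc 0 t,
      (Real.exp (-(ν * ∑ i, (k i : ℝ) ^ 2) * (t - s)) : ℂ) * F k s :=
    ae_all_iff.mpr fun k => duhamel_of_ae_integral_eq (hW k) (hF k) (hmode k)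
  have hmem : ∀ᵐ t ∂μ, t ∈ Ioc 0 T := ae_restrict_mem measurableSet_Ioc
  filter_upwards [hduh, hmem, ae_all_iff.mpr hWs] with t ht htT hWt S c
  have hsub : Ioc 0 t ⊆ Ioc 0 T := Ioc_subset_Ioc_right htT.2
  have hHs' := ae_restrict_of_ae_restrict_of_subset hsub (ae_all_iff.mpr hHs)
  have hint : ∀ k, IntegrableOn (fun s =>
      c k * ((Real.exp (-(ν * ∑ i, (k i : ℝ) ^ 2) * (t - s)) : ℂ) * F k s)) (Ioc 0 t) := by
    intro k
    refine Integrable.const_mul ?_ _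
    obtain ⟨K, hK⟩ : ∃ K, ∀ s ∈ Icc 0 t,
        ‖Real.exp (-(ν * ∑ i, (k i : ℝ) ^ 2) * (t - s))‖ ≤ K :=
      isCompact_Icc.exists_bound_of_continuousOn (by fun_prop)
    refine Integrable.bdd_mul (c := K) ((hF k).mono_set hsub) (by fun_prop) ?_
    refine (ae_restrict_iff' measurableSet_Ioc).mpr (Filter.Eventually.of_forall fun s hs => ?_)
    rw [Complex.norm_real]
    exact hK s (Ioc_subset_Icc_self hs)
  have e1 : ∫ x, (w t x : ℂ) * trigPoly S c x = ∫ s in Ioc 0 t, ∑ k ∈ S,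
      c k * ((Real.exp (-(ν * ∑ i, (k i : ℝ) ^ 2) * (t - s)) : ℂ) * F k s) := by
    rw [integral_finsetSum _ fun k _ => hint k]
    simp_rw [integral_const_mul, ← ht]
    have : ∀ x, (w t x : ℂ) * trigPoly S c x = ∑ k ∈ S, c k * W0 k (t, x) := by
      intro x
      rw [trigPoly_apply, Finset.mul_sum]
      exact Finset.sum_congr rfl fun k _ => by simp only [W0]; ring
    simp_rw [this]
    rw [integral_finsetSum _ fun k _ => (hWt k).const_mul _]
    simp_rw [integral_const_mul, W]
  rw [e1]
  refine (enorm_integral_le_lintegral_enorm _).trans (lintegral_mono_ae ?_)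
  filter_upwards [hHs'] with s hs
  have e2 : ∑ k ∈ S, c k * ((Real.exp (-(ν * ∑ i, (k i : ℝ) ^ 2) * (t - s)) : ℂ) * F k s)
      = -∫ x, ((w s x * g s x : ℝ) * heatTrig (ν * (t - s)) S c x +
        ∑ i, ((w s x * b s x i : ℝ) : ℂ) * heatTrigPartial (ν * (t - s)) S c i x) := by
    have : ∀ x, ((w s x * g s x : ℝ) : ℂ) * heatTrig (ν * (t - s)) S c x +
        ∑ i, ((w s x * b s x i : ℝ) : ℂ) * heatTrigPartial (ν * (t - s)) S c i x
        = ∑ k ∈ S, c k * ((Real.exp (-(ν * ∑ i, (k i : ℝ) ^ 2) * (t - s)) : ℂ) * H k (s, x)) := by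
      intro x
      have he : ∀ k : Fin d → ℤ, Real.exp (-(ν * (t - s)) * ∑ i, (k i : ℝ) ^ 2)
          = Real.exp (-(ν * ∑ i, (k i : ℝ) ^ 2) * (t - s)) := by
        intro k; congr 1; ring
      obtain ⟨E, hE⟩ : ∃ E : (Fin d → ℤ) → ℝ, ∀ k,
          Real.exp (-(ν * ∑ i, (k i : ℝ) ^ 2) * (t - s)) = E k := ⟨_, fun _ => rfl⟩
      simp only [heatTrig, heatTrigPartial, trigPoly_apply, H, he, hE]
      simp only [Finset.mul_sum, mul_add]
      rw [Finset.sum_comm, ← Finset.sum_add_distrib]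
      refine Finset.sum_congr rfl fun k _ => ?_
      congr 1
      · ring
      · exact Finset.sum_congr rfl fun i _ => by ring
    simp_rw [this]
    rw [integral_finsetSum _ fun k _ => ((hs k).const_mul _).const_mul _]
    simp_rw [integral_const_mul, F]
    rw [← Finset.sum_neg_distrib]
    exact Finset.sum_congr rfl fun k _ => by ring
  rw [e2, enorm_neg]
  refine (enorm_integral_le_lintegral_enorm _).trans (lintegral_mono fun x => ?_)
  refine (enorm_add_le _ _).trans (add_le_add ?_ ((enorm_sum_le _ _).trans
    (Finset.sum_le_sum fun i _ => ?_)))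
  · rw [enorm_mul, ← enorm_mul (w s x)]
    gcongr
    rw [← ofReal_norm, ← ofReal_norm, Complex.norm_real]
  · rw [enorm_mul, ← enorm_mul (w s x)]
    gcongr
    rw [← ofReal_norm, ← ofReal_norm, Complex.norm_real]

end Mild

/-! ### The Volterra inequality for spatial Lebesgue norms. -/

section SpaceEstimate
variable {d : ℕ}

lemma lintegral_enorm_mul_mul_le {α : Type*} [MeasurableSpace α] {μ : Measure α} {f g : α → ℝ}
    {h : α → ℂ} (hf : AEStronglyMeasurable f μ) (hg : AEStronglyMeasurable g μ)
    (hh : AEStronglyMeasurable h μ) {p q s : ℝ≥0∞} (hpqs : p⁻¹ + q⁻¹ + s⁻¹ = 1) :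
    ∫⁻ x, ‖f x‖ₑ * ‖g x‖ₑ * ‖h x‖ₑ ∂μ ≤ eLpNorm f p μ * eLpNorm g q μ * eLpNorm h s μ := by
  have h1 : ENNReal.HolderTriple p q (p⁻¹ + q⁻¹)⁻¹ := ⟨by rw [inv_inv]⟩
  have h2 : ENNReal.HolderTriple (p⁻¹ + q⁻¹)⁻¹ s 1 := ⟨by rw [inv_inv, inv_one, hpqs]⟩
  have e1 := eLpNorm_smul_le_mul_eLpNorm (p := p) (q := q) (r := (p⁻¹ + q⁻¹)⁻¹) hg hf
  have e2 := eLpNorm_smul_le_mul_eLpNorm (p := (p⁻¹ + q⁻¹)⁻¹) (q := s) (r := 1) hh (hf.smul hg)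
  rw [eLpNorm_one_eq_lintegral_enorm] at e2
  calc ∫⁻ x, ‖f x‖ₑ * ‖g x‖ₑ * ‖h x‖ₑ ∂μ = ∫⁻ x, ‖((f • g) • h) x‖ₑ ∂μ := by
        refine lintegral_congr fun x => ?_
        rw [Pi.smul_apply', Pi.smul_apply', enorm_smul, enorm_smul]
    _ ≤ _ := e2.trans (by gcongr)

lemma heatSupConst_rpow {Θ θ e : ℝ} (hθ : 0 < θ) :
    ENNReal.ofReal (heatSupConst d Θ θ) ^ e
      = ENNReal.ofReal (((2 * Real.sqrt Θ + 2) ^ d) ^ e * θ ^ (-(d / 2 * e))) := by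
  have h0 : 0 < Real.sqrt θ := Real.sqrt_pos.mpr hθ
  have h1 : 0 < 2 * Real.sqrt Θ + 2 := by positivity
  rw [heatSupConst, mul_pow, ENNReal.ofReal_rpow_of_pos (by positivity),
    Real.mul_rpow (by positivity) (by positivity)]
  congr 2
  rw [Real.sqrt_eq_rpow, ← Real.rpow_neg hθ.le, ← Real.rpow_natCast, ← Real.rpow_mul hθ.le,
    ← Real.rpow_mul hθ.le]
  congr 1
  ring

/-- The heat flow must carry the dual exponent `r = m'` to the third Hölder exponent `s`, where `1/s
= 1 - 1/q - 1/n`; its gain `1/r - 1/s` is `1/q + 1/n - 1/m`. The order hypotheses keep truncated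
subtraction exact. -/
lemma exponent_identity {m q n : ℝ≥0∞} (hm0 : m ≠ 0) (hnm : n ≤ m) (hqn : q⁻¹ + n⁻¹ ≤ 1) :
    (1 - m⁻¹)⁻¹ ≤ (1 - (q⁻¹ + n⁻¹))⁻¹ ∧
      ((1 - m⁻¹)⁻¹⁻¹ - (1 - (q⁻¹ + n⁻¹))⁻¹⁻¹).toReal = (q⁻¹ + n⁻¹ - m⁻¹).toReal := by
  have h1 : m⁻¹ ≤ q⁻¹ + n⁻¹ := (ENNReal.inv_le_inv.mpr hnm).trans le_add_self
  refine ⟨ENNReal.inv_le_inv.mpr (tsub_le_tsub_left h1 1), ?_⟩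
  rw [inv_inv, inv_inv]
  congr 1
  have hmt : m⁻¹ ≠ ∞ := ENNReal.inv_ne_top.mpr hm0
  have hqt : q⁻¹ + n⁻¹ ≠ ∞ := ne_top_of_le_ne_top ENNReal.one_ne_top hqn
  generalize q⁻¹ + n⁻¹ = a at *
  generalize m⁻¹ = c at *
  lift a to NNReal using hqt
  lift c to NNReal using hmt
  have h1' : c ≤ a := by exact_mod_cast h1
  have h2' : a ≤ 1 := by exact_mod_cast hqn
  rw [← ENNReal.coe_one, ← ENNReal.coe_sub, ← ENNReal.coe_sub, ← ENNReal.coe_sub,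
    ← ENNReal.coe_sub, ENNReal.coe_inj]
  apply NNReal.coe_injective
  rw [NNReal.coe_sub (tsub_le_tsub_left h1' 1), NNReal.coe_sub (h1'.trans h2'), NNReal.coe_sub h2',
    NNReal.coe_sub h1']
  ring

/-- Three-factor Hölder followed by smoothing of the test polynomial from `L^{m'}` to the third
exponent. When `1/q + 1/n = 1` that exponent is `∞`. -/
lemma lintegral_mul_heatTrig_le {θ Θ : ℝ} (hθ : 0 < θ) (hθ' : θ ≤ Θ) {m q n : ℝ≥0∞}
    (hm : 2 ≤ m) (hnm : n ≤ m) (hqn : q⁻¹ + n⁻¹ ≤ 1) {f g : Torus d → ℝ}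
    (hf : AEStronglyMeasurable f volume) (hg : AEStronglyMeasurable g volume)
    (S : Finset (Fin d → ℤ)) (c : (Fin d → ℤ) → ℂ) :
    ∫⁻ x, ‖f x‖ₑ * ‖g x‖ₑ * ‖heatTrig θ S c x‖ₑ
      ≤ ENNReal.ofReal (((2 * Real.sqrt Θ + 2) ^ d) ^ (q⁻¹ + n⁻¹ - m⁻¹).toReal *
          θ ^ (-(d / 2 * (q⁻¹ + n⁻¹ - m⁻¹).toReal))) *
        (eLpNorm g q volume * eLpNorm f n volume) *
        eLpNorm (trigPoly S c) (1 - m⁻¹)⁻¹ volume := by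
  have hm0 : m ≠ 0 := (two_pos.trans_le hm).ne'
  have hm1 : m⁻¹ < 1 := ENNReal.inv_lt_one.mpr (ENNReal.one_lt_two.trans_le hm)
  obtain ⟨h1, h2⟩ := exponent_identity hm0 hnm hqn
  have h3 := lintegral_enorm_mul_mul_le hf hg
    (heatTrig θ S c).continuous.aestronglyMeasurable (p := n) (q := q)
    (s := (1 - (q⁻¹ + n⁻¹))⁻¹) (μ := volume)
    (by rw [inv_inv, add_comm n⁻¹, add_tsub_cancel_of_le hqn])
  have h4 := eLpNorm_heatTrig_le hθ hθ' S c (r := (1 - m⁻¹)⁻¹)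
    (ENNReal.one_le_inv.mpr tsub_le_self) (ENNReal.inv_ne_top.mpr (tsub_pos_of_lt hm1).ne') h1
  rw [h2, heatSupConst_rpow hθ] at h4
  refine (h3.trans (mul_le_mul_right h4 _)).trans_eq ?_
  ring

lemma lintegral_mul_heatTrigPartial_le {θ Θ : ℝ} (hθ : 0 < θ) (hθ' : 2 * θ ≤ Θ) {m q n : ℝ≥0∞}
    (hm : 2 ≤ m) (hnm : n ≤ m) (hqn : q⁻¹ + n⁻¹ ≤ 1) {f g : Torus d → ℝ}
    (hf : AEStronglyMeasurable f volume) (hg : AEStronglyMeasurable g volume)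
    (S : Finset (Fin d → ℤ)) (c : (Fin d → ℤ) → ℂ) (j : Fin d) :
    ∫⁻ x, ‖f x‖ₑ * ‖g x‖ₑ * ‖heatTrigPartial θ S c j x‖ₑ
      ≤ ENNReal.ofReal (2 ^ d * ((2 * Real.sqrt Θ + 2) ^ d) ^ (q⁻¹ + n⁻¹ - m⁻¹).toReal *
          θ ^ (-(1 / 2 + d / 2 * (q⁻¹ + n⁻¹ - m⁻¹).toReal))) *
        (eLpNorm g q volume * eLpNorm f n volume) *
        eLpNorm (trigPoly S c) (1 - m⁻¹)⁻¹ volume := by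
  have hm0 : m ≠ 0 := (two_pos.trans_le hm).ne'
  have hm1 : m⁻¹ < 1 := ENNReal.inv_lt_one.mpr (ENNReal.one_lt_two.trans_le hm)
  obtain ⟨h1, h2⟩ := exponent_identity hm0 hnm hqn
  have h3 := lintegral_enorm_mul_mul_le hf hg
    (heatTrigPartial θ S c j).continuous.aestronglyMeasurable (p := n) (q := q)
    (s := (1 - (q⁻¹ + n⁻¹))⁻¹) (μ := volume)
    (by rw [inv_inv, add_comm n⁻¹, add_tsub_cancel_of_le hqn])
  have h4 := eLpNorm_heatTrigPartial_le hθ hθ' S c j (r := (1 - m⁻¹)⁻¹)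
    (ENNReal.one_le_inv.mpr tsub_le_self) (ENNReal.inv_ne_top.mpr (tsub_pos_of_lt hm1).ne') h1
  rw [h2, heatSupConst_rpow (by positivity), ← mul_assoc,
    ← ENNReal.ofReal_mul (by positivity)] at h4
  set e := (q⁻¹ + n⁻¹ - m⁻¹).toReal with he
  have h5 : 2 ^ d * (Real.sqrt θ)⁻¹ * (((2 * Real.sqrt Θ + 2) ^ d) ^ e *
      (2 * θ) ^ (-(d / 2 * e))) ≤ 2 ^ d * ((2 * Real.sqrt Θ + 2) ^ d) ^ e *
          θ ^ (-(1 / 2 + d / 2 * e)) := by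
    have h6 : (2 * θ) ^ (-(d / 2 * e)) ≤ θ ^ (-(d / 2 * e)) := by
      refine Real.rpow_le_rpow_of_nonpos hθ (by linarith) ?_
      have : 0 ≤ e := ENNReal.toReal_nonneg
      rw [neg_nonpos]; positivity
    have h7 : θ ^ (-(1 / 2 + d / 2 * e)) = (Real.sqrt θ)⁻¹ * θ ^ (-(d / 2 * e)) := by
      rw [neg_add, Real.rpow_add hθ, Real.sqrt_eq_rpow, Real.rpow_neg hθ.le]
    rw [h7]
    calc _ ≤ 2 ^ d * (Real.sqrt θ)⁻¹ * (((2 * Real.sqrt Θ + 2) ^ d) ^ e *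
          θ ^ (-(d / 2 * e))) := by gcongr
      _ = _ := by ring
  refine (h3.trans (mul_le_mul_right (h4.trans (mul_le_mul_left
    (ENNReal.ofReal_le_ofReal h5) _)) _)).trans_eq ?_
  ring

/-- The pairing of `w(t)` with any polynomial is at most the right side times its `L^{m'}` norm, and
duality turns this into a bound for `‖w(t)‖_m`. The exponents `m₁`, `m₂` may be smaller than `m`,
which permits a gain of integrability. -/
theorem exists_eLpNorm_le_lintegral {T ν : ℝ} (hν : 0 < ν) {w g : ℝ → Torus d → ℝ}
    {b : ℝ → Torus d → EuclideanSpace ℝ (Fin d)}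
    (hwm : ∀ t, Measurable (w t)) (hgm : ∀ t, Measurable (g t)) (hbm : ∀ t, Measurable (b t))
    (hw2 : ∀ᵐ t ∂(volume.restrict (Ioc 0 T)), MemLp (w t) 2 volume)
    (hw : Integrable (fun z : ℝ × Torus d => w z.1 z.2)
      ((volume.restrict (Ioc 0 T)).prod volume))
    (hwg : Integrable (fun z : ℝ × Torus d => w z.1 z.2 * g z.1 z.2)
      ((volume.restrict (Ioc 0 T)).prod volume))
    (hwb : ∀ i, Integrable (fun z : ℝ × Torus d => w z.1 z.2 * b z.1 z.2 i)
      ((volume.restrict (Ioc 0 T)).prod volume))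
    (hweak : ∀ φ : Torus d → ℝ, TorusSmooth φ → ∀ᵐ t ∂(volume.restrict (Ioc 0 T)),
      ∫ x, w t x * φ x = - (∫ s in (0 : ℝ)..t,
          ∫ x, w s x * (g s x * φ x + ∑ i : Fin d, b s x i * torusPartial i φ x))
        + ν * ∫ s in (0 : ℝ)..t, ∫ x, w s x * torusLaplacian φ x)
    {m q₁ m₁ q₂ m₂ : ℝ≥0∞} (hm : 2 ≤ m) (hm' : m ≠ ∞) (hm₁ : m₁ ≤ m) (hm₂ : m₂ ≤ m)
    (hq₁ : q₁⁻¹ + m₁⁻¹ ≤ 1) (hq₂ : q₂⁻¹ + m₂⁻¹ ≤ 1) :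
    ∃ K : ℝ, 0 ≤ K ∧ ∀ᵐ t ∂(volume.restrict (Ioc 0 T)), eLpNorm (w t) m volume ≤
      ∫⁻ s in Ioo 0 t,
        (ENNReal.ofReal (K * (t - s) ^ (-(1 / 2 + d / 2 * (q₁⁻¹ + m₁⁻¹ - m⁻¹).toReal))) *
          (eLpNorm (b s) q₁ volume * eLpNorm (w s) m₁ volume) +
        ENNReal.ofReal (K * (t - s) ^ (-(d / 2 * (q₂⁻¹ + m₂⁻¹ - m⁻¹).toReal))) *
          (eLpNorm (g s) q₂ volume * eLpNorm (w s) m₂ volume)) := by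
  -- The gradient estimate uses the heat flow at twice the time, hence the factor `2` in the upper
  -- bound for the times involved.
  set Θ := 2 * (ν * T) with hΘ
  set e₁ := (q₁⁻¹ + m₁⁻¹ - m⁻¹).toReal with he₁
  set e₂ := (q₂⁻¹ + m₂⁻¹ - m⁻¹).toReal with he₂
  set D := (2 * Real.sqrt Θ + 2) ^ d with hD
  have hD0 : 0 < D := by positivity
  set K₁ := d * (2 ^ d * D ^ e₁) * ν ^ (-(1 / 2 + d / 2 * e₁)) with hK₁
  set K₂ := D ^ e₂ * ν ^ (-(d / 2 * e₂)) with hK₂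
  have hK₁0 : 0 ≤ K₁ := by positivity
  have hK₂0 : 0 ≤ K₂ := by positivity
  refine ⟨max K₁ K₂, le_max_of_le_left hK₁0, ?_⟩
  have hmem : ∀ᵐ t ∂(volume.restrict (Ioc 0 T)), t ∈ Ioc 0 T := ae_restrict_mem measurableSet_Ioc
  have hm1 : m⁻¹ ≤ 1 := ENNReal.inv_le_one.mpr (one_le_two.trans hm)
  filter_upwards [enorm_integral_mul_trigPoly_le hw hwg hwb hweak, hw2, hmem] with t ht ht2 htT
  refine eLpNorm_le_of_trigPoly (hwm t) ht2 hm hm' (r := (1 - m⁻¹)⁻¹)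
    (by rw [inv_inv, add_tsub_cancel_of_le hm1]) fun S c => (ht S c).trans ?_
  -- The endpoint `s = t`, where the heat time vanishes, is removed.
  rw [← restrict_Ioo_eq_restrict_Ioc]
  have hNt : eLpNorm (trigPoly S c) (1 - m⁻¹)⁻¹ volume ≠ ∞ :=
    ((trigPoly S c).continuous.memLp_of_hasCompactSupport
      (HasCompactSupport.of_compactSpace _)).2.ne
  rw [← lintegral_mul_const' _ _ hNt]
  refine setLIntegral_mono' measurableSet_Ioo fun s hs => ?_
  have hts : 0 < t - s := sub_pos.mpr hs.2
  have htsT : t - s ≤ T := by linarith [hs.1, htT.2]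
  have hθ : 0 < ν * (t - s) := mul_pos hν hts
  have hθ2 : 2 * (ν * (t - s)) ≤ Θ := by rw [hΘ]; gcongr
  have hbi : ∀ i, Measurable fun x => b s x i := fun i =>
    (EuclideanSpace.proj (𝕜 := ℝ) i).continuous.measurable.comp (hbm s)
  have hm₀ : Measurable fun x => ‖w s x‖ₑ * ‖g s x‖ₑ * ‖heatTrig (ν * (t - s)) S c x‖ₑ :=
    ((hwm s).enorm.mul (hgm s).enorm).mul (heatTrig (ν * (t - s)) S c).continuous.measurable.enorm
  have hm₁' : ∀ i, Measurable fun x =>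
      ‖w s x‖ₑ * ‖b s x i‖ₑ * ‖heatTrigPartial (ν * (t - s)) S c i x‖ₑ := fun i =>
    ((hwm s).enorm.mul (hbi i).enorm).mul
      (heatTrigPartial (ν * (t - s)) S c i).continuous.measurable.enorm
  rw [lintegral_add_left hm₀,
    lintegral_finsetSum _ fun i _ => hm₁' i]
  have hA := lintegral_mul_heatTrig_le hθ (by linarith : ν * (t - s) ≤ Θ) hm hm₂ hq₂
    (hwm s).aestronglyMeasurable (hgm s).aestronglyMeasurable S c
  have hB : ∀ i, ∫⁻ x, ‖w s x‖ₑ * ‖b s x i‖ₑ * ‖heatTrigPartial (ν * (t - s)) S c i x‖ₑ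
      ≤ ENNReal.ofReal (2 ^ d * D ^ e₁ * (ν * (t - s)) ^ (-(1 / 2 + d / 2 * e₁))) *
        (eLpNorm (b s) q₁ volume * eLpNorm (w s) m₁ volume) *
        eLpNorm (trigPoly S c) (1 - m⁻¹)⁻¹ volume := by
    intro i
    refine (lintegral_mul_heatTrigPartial_le hθ hθ2 hm hm₁ hq₁
      (hwm s).aestronglyMeasurable (hbi i).aestronglyMeasurable S c i).trans ?_
    gcongr
    exact eLpNorm_mono fun x => PiLp.norm_apply_le _ _
  rw [add_comm]
  refine (add_le_add (Finset.sum_le_sum fun i _ => hB i) hA).trans ?_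
  rw [Finset.sum_const, Finset.card_univ, Fintype.card_fin, nsmul_eq_mul, add_mul]
  refine add_le_add ?_ ?_
  · rw [← mul_assoc, ← mul_assoc, ← ENNReal.ofReal_natCast, ← ENNReal.ofReal_mul (by positivity)]
    refine mul_le_mul_left (mul_le_mul_left (ENNReal.ofReal_le_ofReal ?_) _) _
    rw [Real.mul_rpow hν.le hts.le]
    calc (d : ℝ) * (2 ^ d * D ^ e₁ * (ν ^ (-(1 / 2 + d / 2 * e₁)) *
          (t - s) ^ (-(1 / 2 + d / 2 * e₁)))) = K₁ * (t - s) ^ (-(1 / 2 + d / 2 * e₁)) := by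
          rw [hK₁]; ring
      _ ≤ _ := by gcongr; exact le_max_left _ _
  · refine mul_le_mul_left (mul_le_mul_left (ENNReal.ofReal_le_ofReal ?_) _) _
    rw [Real.mul_rpow hν.le hts.le, ← mul_assoc]
    gcongr
    exact le_max_right _ _

end SpaceEstimate

/-! ### Convolution in time with damped singular kernels. -/

section TimeConvolution

/-- Young and Hölder combined: `‖k * (β Y)‖_a ≤ ‖k‖_{p'} ‖β‖_p ‖Y‖_a`. The integrand is split into
`(k^{p'} Y^a)^{1/a}`, `(β^p)^{1/p}` and `(k^{p'})^{1/p' - 1/a}`, whose exponents add up to `1`; the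
last is nonnegative because `p' ≤ a`. Integration in `t` then falls on the first factor only. -/
lemma lintegral_convolution_rpow_le {μ : Measure ℝ} [SFinite μ] (hμ : μ ≤ volume)
    {k β Y : ℝ → ℝ≥0∞} (hk : Measurable k) (hβ : Measurable β) (hY : Measurable Y)
    {p p' a : ℝ} (hp : 0 < p) (hp' : 0 < p') (hpp : 1 / p + 1 / p' = 1) (ha : p' ≤ a) :
    (∫⁻ t, (∫⁻ s, k (t - s) * (β s * Y s) ∂μ) ^ a ∂μ) ^ (1 / a)
      ≤ (∫⁻ τ, k τ ^ p') ^ (1 / p') * (∫⁻ s, β s ^ p ∂μ) ^ (1 / p) *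
        (∫⁻ s, Y s ^ a ∂μ) ^ (1 / a) := by
  have ha0 : 0 < a := hp'.trans_le ha
  have hexp : 0 ≤ 1 / p' - 1 / a := sub_nonneg.mpr (one_div_le_one_div_of_le hp' ha)
  set A := ∫⁻ τ, k τ ^ p' with hA
  set B := ∫⁻ s, β s ^ p ∂μ with hB
  have hkt : ∀ t, Measurable fun s => k (t - s) := fun t => hk.comp (measurable_const.sub measurable_id)
  have hkA : ∀ t, ∫⁻ s, k (t - s) ^ p' ∂μ ≤ A := fun t =>
    (lintegral_mono' hμ le_rfl).trans_eq (lintegral_sub_left_eq_self (fun τ => k τ ^ p') t)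
  have hpt : ∀ t, (∫⁻ s, k (t - s) * (β s * Y s) ∂μ) ^ a
      ≤ (∫⁻ s, k (t - s) ^ p' * Y s ^ a ∂μ) * (B ^ (1 / p) * A ^ (1 / p' - 1 / a)) ^ a := by
    intro t
    have h := ENNReal.lintegral_prod_norm_pow_le (μ := μ) (Finset.univ : Finset (Fin 3))
      (f := ![fun s => k (t - s) ^ p' * Y s ^ a, fun s => β s ^ p, fun s => k (t - s) ^ p'])
      (p := ![1 / a, 1 / p, 1 / p' - 1 / a])
      (by
        intro i _
        fin_cases i
        · exact (((hkt t).pow_const p').mul (hY.pow_const a)).aemeasurable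
        · exact (hβ.pow_const p).aemeasurable
        · exact ((hkt t).pow_const p').aemeasurable)
      (by simp [Fin.sum_univ_three]; simp at hpp; linarith)
      (by
        intro i _
        fin_cases i
        · change 0 ≤ 1 / a; positivity
        · change 0 ≤ 1 / p; positivity
        · exact hexp)
    simp only [Fin.prod_univ_three, Matrix.cons_val_zero, Matrix.cons_val_one,
      Matrix.cons_val] at h
    have e : ∀ s, (k (t - s) ^ p' * Y s ^ a) ^ (1 / a) * (β s ^ p) ^ (1 / p) *
        (k (t - s) ^ p') ^ (1 / p' - 1 / a) = k (t - s) * (β s * Y s) := by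
      intro s
      have hkk : k (t - s) = (k (t - s) ^ p') ^ (1 / a) * (k (t - s) ^ p') ^ (1 / p' - 1 / a) := by
        rw [← ENNReal.rpow_add_of_nonneg _ _ (by positivity) hexp, add_sub_cancel,
          ← ENNReal.rpow_mul, mul_one_div_cancel hp'.ne', ENNReal.rpow_one]
      nth_rw 3 [hkk]
      rw [ENNReal.mul_rpow_of_nonneg _ _ (by positivity : 0 ≤ 1 / a), ← ENNReal.rpow_mul (Y s),
        ← ENNReal.rpow_mul (β s), mul_one_div_cancel ha0.ne', mul_one_div_cancel hp.ne',
        ENNReal.rpow_one, ENNReal.rpow_one]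
      ring
    simp_rw [e] at h
    calc (∫⁻ s, k (t - s) * (β s * Y s) ∂μ) ^ a
        ≤ ((∫⁻ s, k (t - s) ^ p' * Y s ^ a ∂μ) ^ (1 / a) * B ^ (1 / p) *
            A ^ (1 / p' - 1 / a)) ^ a := by
          refine ENNReal.rpow_le_rpow (h.trans ?_) ha0.le
          gcongr
          exact hkA t
      _ = _ := by
          rw [mul_assoc, ENNReal.mul_rpow_of_nonneg _ _ ha0.le, ← ENNReal.rpow_mul,
            one_div_mul_cancel ha0.ne', ENNReal.rpow_one]
  have hdouble : ∫⁻ t, ∫⁻ s, k (t - s) ^ p' * Y s ^ a ∂μ ∂μ ≤ A * ∫⁻ s, Y s ^ a ∂μ := by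
    rw [lintegral_lintegral_swap]
    · rw [← lintegral_const_mul _ (hY.pow_const a)]
      refine lintegral_mono fun s => ?_
      have hks : Measurable fun t => k (t - s) ^ p' :=
        (hk.comp (measurable_id.sub_const s)).pow_const p'
      rw [lintegral_mul_const _ hks]
      gcongr
      exact (lintegral_mono' hμ le_rfl).trans_eq
        (lintegral_sub_right_eq_self (fun τ => k τ ^ p') s)
    · exact (((hk.comp (measurable_fst.sub measurable_snd)).pow_const p').mul
        ((hY.comp measurable_snd).pow_const a)).aemeasurable
  have hm : Measurable fun t => ∫⁻ s, k (t - s) ^ p' * Y s ^ a ∂μ :=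
    Measurable.lintegral_prod_right' (f := fun z : ℝ × ℝ => k (z.1 - z.2) ^ p' * Y z.2 ^ a)
      (((hk.comp (measurable_fst.sub measurable_snd)).pow_const p').mul
        ((hY.comp measurable_snd).pow_const a))
  calc (∫⁻ t, (∫⁻ s, k (t - s) * (β s * Y s) ∂μ) ^ a ∂μ) ^ (1 / a)
      ≤ ((A * ∫⁻ s, Y s ^ a ∂μ) * (B ^ (1 / p) * A ^ (1 / p' - 1 / a)) ^ a) ^ (1 / a) := by
        refine ENNReal.rpow_le_rpow ?_ (by positivity)
        refine (lintegral_mono hpt).trans ?_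
        rw [lintegral_mul_const _ hm]
        gcongr
    _ = A ^ (1 / p') * B ^ (1 / p) * (∫⁻ s, Y s ^ a ∂μ) ^ (1 / a) := by
        rw [ENNReal.mul_rpow_of_nonneg _ _ (by positivity),
          ENNReal.mul_rpow_of_nonneg _ _ (by positivity), ← ENNReal.rpow_mul,
          mul_one_div_cancel ha0.ne', ENNReal.rpow_one]
        have hAA : A ^ (1 / p') = A ^ (1 / a) * A ^ (1 / p' - 1 / a) := by
          rw [← ENNReal.rpow_add_of_nonneg _ _ (by positivity) hexp, add_sub_cancel]
        rw [hAA]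
        ring

/-- The exponentially damped singular kernel `e^{-nτ} K τ^{-κ}` on `(0,T]`. -/
noncomputable def timeKernel (T K κ : ℝ) (n : ℕ) (τ : ℝ) : ℝ≥0∞ :=
  (Ioc 0 T).indicator (fun τ => ENNReal.ofReal (Real.exp (-n * τ) * (K * τ ^ (-κ)))) τ

lemma measurable_timeKernel (T K κ : ℝ) (n : ℕ) : Measurable (timeKernel T K κ n) := by
  refine Measurable.indicator ?_ measurableSet_Ioc
  exact ((by fun_prop : Measurable fun τ : ℝ => Real.exp (-n * τ)).mul
    ((measurable_id.pow_const (-κ)).const_mul K)).ennreal_ofReal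

lemma timeKernel_rpow (T κ : ℝ) {K p' : ℝ} (hK : 0 ≤ K) (hp' : 0 < p') (n : ℕ) (τ : ℝ) :
    timeKernel T K κ n τ ^ p' = (Ioc 0 T).indicator
      (fun τ => ENNReal.ofReal (Real.exp (-n * τ) ^ p' * (K ^ p' * τ ^ (-(κ * p'))))) τ := by
  unfold timeKernel
  by_cases h : τ ∈ Ioc 0 T
  · have hτ : 0 < τ := h.1
    rw [indicator_of_mem h, indicator_of_mem h, ENNReal.ofReal_rpow_of_nonneg (by positivity) hp'.le,
      Real.mul_rpow (by positivity) (by positivity), Real.mul_rpow hK (by positivity),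
      ← Real.rpow_mul hτ.le, neg_mul κ p']
  · rw [indicator_of_notMem h, indicator_of_notMem h, ENNReal.zero_rpow_of_pos hp']

lemma lintegral_timeKernel_zero_ne_top (T κ : ℝ) {K p' : ℝ} (hK : 0 ≤ K) (hp' : 0 < p')
    (hκ : κ * p' < 1) : ∫⁻ τ, timeKernel T K κ 0 τ ^ p' ≠ ∞ := by
  simp_rw [timeKernel_rpow T κ hK hp']
  rw [lintegral_indicator measurableSet_Ioc]
  simp only [CharP.cast_eq_zero, neg_zero, zero_mul, Real.exp_zero, Real.one_rpow, one_mul]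
  rcases le_total T 0 with hT | hT
  · simp [Ioc_eq_empty (not_lt.mpr hT)]
  have h := (intervalIntegral.intervalIntegrable_rpow' (a := 0) (b := T) (r := -(κ * p'))
    (by linarith)).const_mul (K ^ p')
  rw [intervalIntegrable_iff_integrableOn_Ioc_of_le hT] at h
  exact h.lintegral_lt_top.ne

/-- Dominated convergence: the damping kills the kernel pointwise, and the undamped kernel is an
integrable majorant as `κ p' < 1`. -/
lemma tendsto_lintegral_timeKernel (T κ : ℝ) {K p' : ℝ} (hK : 0 ≤ K) (hp' : 0 < p')
    (hκ : κ * p' < 1) :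
    Filter.Tendsto (fun n => ∫⁻ τ, timeKernel T K κ n τ ^ p') Filter.atTop (nhds 0) := by
  have h0 : (0 : ℝ≥0∞) = ∫⁻ _τ : ℝ, 0 := by simp
  rw [h0]
  refine tendsto_lintegral_of_dominated_convergence (fun τ => timeKernel T K κ 0 τ ^ p')
    (fun n => (measurable_timeKernel T K κ n).pow_const p') (fun n => ?_)
    (lintegral_timeKernel_zero_ne_top T κ hK hp' hκ) ?_
  · refine Filter.Eventually.of_forall fun τ => ENNReal.rpow_le_rpow ?_ hp'.le
    unfold timeKernel
    by_cases hτ : τ ∈ Ioc 0 T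
    swap
    · simp only [indicator_of_notMem hτ, le_refl]
    rw [indicator_of_mem hτ, indicator_of_mem hτ]
    refine ENNReal.ofReal_le_ofReal ?_
    have := hτ.1
    refine mul_le_mul_of_nonneg_right (Real.exp_le_exp.mpr ?_) (by positivity)
    have : 0 ≤ (n : ℝ) * τ := by positivity
    simp only [CharP.cast_eq_zero, neg_zero, zero_mul]
    linarith
  · refine Filter.Eventually.of_forall fun τ => ?_
    have h1 : Filter.Tendsto (fun n => timeKernel T K κ n τ) Filter.atTop (nhds 0) := by
      unfold timeKernel
      by_cases hτ : τ ∈ Ioc 0 T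
      · simp only [indicator_of_mem hτ]
        rw [← ENNReal.ofReal_zero]
        refine ENNReal.tendsto_ofReal ?_
        have h2 : Filter.Tendsto (fun n : ℕ => Real.exp (-n * τ)) Filter.atTop (nhds 0) := by
          refine Real.tendsto_exp_atBot.comp ?_
          have := (tendsto_natCast_atTop_atTop (R := ℝ)).atTop_mul_const hτ.1
          have h3 := Filter.tendsto_neg_atTop_atBot.comp this
          refine h3.congr fun n => ?_
          simp
        simpa using h2.mul_const (K * τ ^ (-κ))
      · simp only [indicator_of_notMem hτ]
        exact tendsto_const_nhds
    have := (ENNReal.continuous_rpow_const (y := p')).continuousAt.tendsto.comp h1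
    simpa [Function.comp_def, ENNReal.zero_rpow_of_pos hp'] using this

lemma setLIntegral_Ioo_le_timeKernel {T t K κ : ℝ} (ht : t ∈ Ioc 0 T) (n : ℕ) (f : ℝ → ℝ≥0∞) :
    ∫⁻ s in Ioo 0 t, ENNReal.ofReal (Real.exp (-n * (t - s)) * (K * (t - s) ^ (-κ))) * f s
      ≤ ∫⁻ s in Ioc 0 T, timeKernel T K κ n (t - s) * f s := by
  calc _ = ∫⁻ s in Ioo 0 t, timeKernel T K κ n (t - s) * f s := by
        refine setLIntegral_congr_fun measurableSet_Ioo fun s hs => ?_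
        have hmem : t - s ∈ Ioc 0 T := ⟨by linarith [hs.2], by linarith [hs.1, ht.2]⟩
        rw [timeKernel, indicator_of_mem hmem]
    _ ≤ _ := lintegral_mono_set (show Ioo 0 t ⊆ Ioc 0 T from fun s hs => ⟨hs.1, hs.2.le.trans ht.2⟩)

end TimeConvolution

/-! ### Volterra inequalities: gain of integrability and vanishing. -/

section Volterra

lemma rpow_lintegral_timeKernel_le {T K κ : ℝ} (n : ℕ) {β Y : ℝ → ℝ≥0∞}
    (hβ : Measurable β) (hY : Measurable Y)
    {p p' a : ℝ} (hp : 0 < p) (hp' : 0 < p') (hpp : 1 / p + 1 / p' = 1) (ha : p' ≤ a) :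
    (∫⁻ t in Ioc 0 T, (∫⁻ s in Ioc 0 T, timeKernel T K κ n (t - s) * (β s * Y s)) ^ a) ^ (1 / a)
      ≤ (∫⁻ τ, timeKernel T K κ n τ ^ p') ^ (1 / p') * (∫⁻ s in Ioc 0 T, β s ^ p) ^ (1 / p) *
        (∫⁻ s in Ioc 0 T, Y s ^ a) ^ (1 / a) :=
  lintegral_convolution_rpow_le Measure.restrict_le_self (measurable_timeKernel T K κ n) hβ hY
    hp hp' hpp ha

lemma measurable_lintegral_timeKernel {T K κ : ℝ} (n : ℕ) {f : ℝ → ℝ≥0∞} (hf : Measurable f) :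
    Measurable fun t => ∫⁻ s in Ioc 0 T, timeKernel T K κ n (t - s) * f s :=
  Measurable.lintegral_prod_right' (f := fun z : ℝ × ℝ => timeKernel T K κ n (z.1 - z.2) * f z.2)
    (((measurable_timeKernel T K κ n).comp (measurable_fst.sub measurable_snd)).mul
      (hf.comp measurable_snd))

/-- The `L^a(0,T)` bound of the right side of a Volterra inequality weighted by `e^{-nt}`. -/
lemma rpow_lintegral_exp_mul_le {T K κ₁ κ₂ : ℝ} (n : ℕ)
    {β₁ β₂ Y₁ Y₂ Z : ℝ → ℝ≥0∞} (hβ₁ : Measurable β₁) (hβ₂ : Measurable β₂) (hY₁ : Measurable Y₁)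
    (hY₂ : Measurable Y₂)
    {p₁ p₁' p₂ p₂' a : ℝ} (hp₁ : 0 < p₁) (hp₁' : 0 < p₁') (hpp₁ : 1 / p₁ + 1 / p₁' = 1)
    (hp₂ : 0 < p₂) (hp₂' : 0 < p₂') (hpp₂ : 1 / p₂ + 1 / p₂' = 1) (ha : 1 ≤ a)
    (ha₁ : p₁' ≤ a) (ha₂ : p₂' ≤ a)
    (h : ∀ᵐ t ∂(volume.restrict (Ioc 0 T)), Z t ≤ ∫⁻ s in Ioo 0 t,
      (ENNReal.ofReal (K * (t - s) ^ (-κ₁)) * (β₁ s * Y₁ s) +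
        ENNReal.ofReal (K * (t - s) ^ (-κ₂)) * (β₂ s * Y₂ s))) :
    (∫⁻ t in Ioc 0 T, (ENNReal.ofReal (Real.exp (-n * t)) * Z t) ^ a) ^ (1 / a)
      ≤ (∫⁻ τ, timeKernel T K κ₁ n τ ^ p₁') ^ (1 / p₁') *
          (∫⁻ s in Ioc 0 T, β₁ s ^ p₁) ^ (1 / p₁) *
          (∫⁻ s in Ioc 0 T, (ENNReal.ofReal (Real.exp (-n * s)) * Y₁ s) ^ a) ^ (1 / a) +
        (∫⁻ τ, timeKernel T K κ₂ n τ ^ p₂') ^ (1 / p₂') *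
          (∫⁻ s in Ioc 0 T, β₂ s ^ p₂) ^ (1 / p₂) *
          (∫⁻ s in Ioc 0 T, (ENNReal.ofReal (Real.exp (-n * s)) * Y₂ s) ^ a) ^ (1 / a) := by
  have ha0 : 0 < a := one_pos.trans_le ha
  have hE : Measurable fun t : ℝ => ENNReal.ofReal (Real.exp (-n * t)) := by fun_prop
  have hYE₁ := hE.mul hY₁
  have hYE₂ := hE.mul hY₂
  have hm₁ := measurable_lintegral_timeKernel (T := T) (K := K) (κ := κ₁) n (hβ₁.mul hYE₁)
  have hm₂ := measurable_lintegral_timeKernel (T := T) (K := K) (κ := κ₂) n (hβ₂.mul hYE₂)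
  have hpt : ∀ᵐ t ∂(volume.restrict (Ioc 0 T)), ENNReal.ofReal (Real.exp (-n * t)) * Z t ≤
      (∫⁻ s in Ioc 0 T, timeKernel T K κ₁ n (t - s) *
        (β₁ s * (ENNReal.ofReal (Real.exp (-n * s)) * Y₁ s))) +
      ∫⁻ s in Ioc 0 T, timeKernel T K κ₂ n (t - s) *
        (β₂ s * (ENNReal.ofReal (Real.exp (-n * s)) * Y₂ s)) := by
    filter_upwards [h, ae_restrict_mem measurableSet_Ioc] with t ht htT
    refine (mul_le_mul_right ht _).trans ?_
    -- The weight splits as `e^{-nt} = e^{-n(t-s)} e^{-ns}`: one factor damps the kernel, the other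
    -- weights the unknown.
    have key : ∀ (κ s : ℝ) (x y : ℝ≥0∞), ENNReal.ofReal (Real.exp (-n * t)) *
        (ENNReal.ofReal (K * (t - s) ^ (-κ)) * (x * y)) =
        ENNReal.ofReal (Real.exp (-n * (t - s)) * (K * (t - s) ^ (-κ))) *
          (x * (ENNReal.ofReal (Real.exp (-n * s)) * y)) := by
      intro κ s x y
      have he : Real.exp (-n * t) = Real.exp (-n * (t - s)) * Real.exp (-n * s) := by
        rw [← Real.exp_add]; ring_nf
      rw [he, ENNReal.ofReal_mul (Real.exp_pos _).le, ENNReal.ofReal_mul (Real.exp_pos _).le]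
      ring
    rw [← lintegral_const_mul' _ _ ENNReal.ofReal_ne_top]
    simp_rw [mul_add, key]
    have hmk : Measurable fun s => ENNReal.ofReal (Real.exp (-n * (t - s)) *
        (K * (t - s) ^ (-κ₁))) * (β₁ s * (ENNReal.ofReal (Real.exp (-n * s)) * Y₁ s)) := by
      refine Measurable.mul ?_ (hβ₁.mul hYE₁)
      exact ((by fun_prop : Measurable fun s : ℝ => Real.exp (-n * (t - s))).mul
        (((measurable_const.sub measurable_id).pow_const (-κ₁)).const_mul K)).ennreal_ofReal
    rw [lintegral_add_left hmk]
    exact add_le_add (setLIntegral_Ioo_le_timeKernel htT n _)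
      (setLIntegral_Ioo_le_timeKernel htT n _)
  calc _ ≤ (∫⁻ t in Ioc 0 T, ((∫⁻ s in Ioc 0 T, timeKernel T K κ₁ n (t - s) *
        (β₁ s * (ENNReal.ofReal (Real.exp (-n * s)) * Y₁ s))) +
      ∫⁻ s in Ioc 0 T, timeKernel T K κ₂ n (t - s) *
        (β₂ s * (ENNReal.ofReal (Real.exp (-n * s)) * Y₂ s))) ^ a) ^ (1 / a) := by
        refine ENNReal.rpow_le_rpow (lintegral_mono_ae ?_) (by positivity)
        filter_upwards [hpt] with t ht
        exact ENNReal.rpow_le_rpow ht ha0.le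
    _ ≤ _ := ENNReal.lintegral_Lp_add_le hm₁.aemeasurable hm₂.aemeasurable ha
    _ ≤ _ := add_le_add (rpow_lintegral_timeKernel_le n hβ₁ hYE₁ hp₁ hp₁' hpp₁ ha₁)
        (rpow_lintegral_timeKernel_le n hβ₂ hYE₂ hp₂ hp₂' hpp₂ ha₂)

/-- A Volterra inequality with singular kernels gains integrability. -/
lemma lintegral_rpow_ne_top_of_le_volterra {T K κ₁ κ₂ : ℝ} (hK : 0 ≤ K)
    {β₁ β₂ Y₁ Y₂ Z : ℝ → ℝ≥0∞} (hβ₁ : Measurable β₁) (hβ₂ : Measurable β₂) (hY₁ : Measurable Y₁)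
    (hY₂ : Measurable Y₂)
    {p₁ p₁' p₂ p₂' a : ℝ} (hp₁ : 0 < p₁) (hp₁' : 0 < p₁') (hpp₁ : 1 / p₁ + 1 / p₁' = 1)
    (hp₂ : 0 < p₂) (hp₂' : 0 < p₂') (hpp₂ : 1 / p₂ + 1 / p₂' = 1) (ha : 1 ≤ a)
    (ha₁ : p₁' ≤ a) (ha₂ : p₂' ≤ a) (hκ₁ : κ₁ * p₁' < 1) (hκ₂ : κ₂ * p₂' < 1)
    (hB₁ : ∫⁻ s in Ioc 0 T, β₁ s ^ p₁ ≠ ∞) (hB₂ : ∫⁻ s in Ioc 0 T, β₂ s ^ p₂ ≠ ∞)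
    (hYa₁ : ∫⁻ s in Ioc 0 T, Y₁ s ^ a ≠ ∞) (hYa₂ : ∫⁻ s in Ioc 0 T, Y₂ s ^ a ≠ ∞)
    (h : ∀ᵐ t ∂(volume.restrict (Ioc 0 T)), Z t ≤ ∫⁻ s in Ioo 0 t,
      (ENNReal.ofReal (K * (t - s) ^ (-κ₁)) * (β₁ s * Y₁ s) +
        ENNReal.ofReal (K * (t - s) ^ (-κ₂)) * (β₂ s * Y₂ s))) :
    ∫⁻ s in Ioc 0 T, Z s ^ a ≠ ∞ := by
  have ha0 : 0 < a := one_pos.trans_le ha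
  have hb := rpow_lintegral_exp_mul_le 0 hβ₁ hβ₂ hY₁ hY₂ hp₁ hp₁' hpp₁ hp₂ hp₂' hpp₂ ha ha₁ ha₂ h
  simp only [CharP.cast_eq_zero, neg_zero, zero_mul, Real.exp_zero, ENNReal.ofReal_one,
    one_mul] at hb
  have hf : ∀ {x : ℝ≥0∞} {r : ℝ}, 0 < r → x ≠ ∞ → x ^ (1 / r) ≠ ∞ := fun hr hx =>
    ENNReal.rpow_ne_top_of_nonneg (by positivity) hx
  have hfin := ne_top_of_le_ne_top (ENNReal.add_ne_top.mpr
    ⟨ENNReal.mul_ne_top (ENNReal.mul_ne_top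
      (hf hp₁' (lintegral_timeKernel_zero_ne_top T κ₁ hK hp₁' hκ₁)) (hf hp₁ hB₁)) (hf ha0 hYa₁),
    ENNReal.mul_ne_top (ENNReal.mul_ne_top
      (hf hp₂' (lintegral_timeKernel_zero_ne_top T κ₂ hK hp₂' hκ₂)) (hf hp₂ hB₂))
      (hf ha0 hYa₂)⟩) hb
  intro htop
  rw [htop, ENNReal.top_rpow_of_pos (by positivity)] at hfin
  exact hfin rfl

/-- A homogeneous Volterra inequality with singular kernels has only the trivial solution. -/
lemma ae_eq_zero_of_le_volterra {T K κ₁ κ₂ : ℝ} (hK : 0 ≤ K)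
    {β₁ β₂ Y : ℝ → ℝ≥0∞} (hβ₁ : Measurable β₁) (hβ₂ : Measurable β₂) (hY : Measurable Y)
    {p₁ p₁' p₂ p₂' a : ℝ} (hp₁ : 0 < p₁) (hp₁' : 0 < p₁') (hpp₁ : 1 / p₁ + 1 / p₁' = 1)
    (hp₂ : 0 < p₂) (hp₂' : 0 < p₂') (hpp₂ : 1 / p₂ + 1 / p₂' = 1) (ha : 1 ≤ a)
    (ha₁ : p₁' ≤ a) (ha₂ : p₂' ≤ a) (hκ₁ : κ₁ * p₁' < 1) (hκ₂ : κ₂ * p₂' < 1)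
    (hB₁ : ∫⁻ s in Ioc 0 T, β₁ s ^ p₁ ≠ ∞) (hB₂ : ∫⁻ s in Ioc 0 T, β₂ s ^ p₂ ≠ ∞)
    (hYa : ∫⁻ s in Ioc 0 T, Y s ^ a ≠ ∞)
    (h : ∀ᵐ t ∂(volume.restrict (Ioc 0 T)), Y t ≤ ∫⁻ s in Ioo 0 t,
      (ENNReal.ofReal (K * (t - s) ^ (-κ₁)) * (β₁ s * Y s) +
        ENNReal.ofReal (K * (t - s) ^ (-κ₂)) * (β₂ s * Y s))) :
    ∀ᵐ t ∂(volume.restrict (Ioc 0 T)), Y t = 0 := by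
  have ha0 : 0 < a := one_pos.trans_le ha
  have hlim : ∀ {κ p p' : ℝ} {B : ℝ≥0∞}, 0 < p → 0 < p' → κ * p' < 1 → B ≠ ∞ →
      Filter.Tendsto (fun n => (∫⁻ τ, timeKernel T K κ n τ ^ p') ^ (1 / p') * B ^ (1 / p))
        Filter.atTop (nhds 0) := by
    intro κ p p' B hp hp' hκ hB
    have h1 := (ENNReal.continuous_rpow_const (y := 1 / p')).continuousAt.tendsto.comp
      (tendsto_lintegral_timeKernel T κ hK hp' hκ)
    rw [ENNReal.zero_rpow_of_pos (by positivity)] at h1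
    have h2 := ENNReal.Tendsto.mul_const h1
      (Or.inr (ENNReal.rpow_ne_top_of_nonneg (by positivity : 0 ≤ 1 / p) hB))
    rwa [zero_mul] at h2
  have hsum := (hlim hp₁ hp₁' hκ₁ hB₁).add (hlim hp₂ hp₂' hκ₂ hB₂)
  rw [add_zero] at hsum
  -- With this damping the sum of the two operator bounds is less than `1`.
  obtain ⟨n, hn⟩ := (hsum.eventually_lt_const (one_pos : (0 : ℝ≥0∞) < 1)).exists
  have hb := rpow_lintegral_exp_mul_le n hβ₁ hβ₂ hY hY hp₁ hp₁' hpp₁ hp₂ hp₂' hpp₂ ha ha₁ ha₂ h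
  rw [← add_mul] at hb
  have hE : Measurable fun t : ℝ => ENNReal.ofReal (Real.exp (-n * t)) := by fun_prop
  have hYE : Measurable fun t => (ENNReal.ofReal (Real.exp (-n * t)) * Y t) ^ a :=
    (hE.mul hY).pow_const a
  set J := ∫⁻ t in Ioc 0 T, (ENNReal.ofReal (Real.exp (-n * t)) * Y t) ^ a with hJ
  -- Finiteness is what lets `J^{1/a} ≤ c J^{1/a}` with `c < 1` force `J = 0`.
  have hJfin : J ≠ ∞ := by
    refine ne_top_of_le_ne_top hYa (lintegral_mono_ae ?_)
    filter_upwards [ae_restrict_mem measurableSet_Ioc] with t ht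
    refine ENNReal.rpow_le_rpow ?_ ha0.le
    refine mul_le_of_le_one_left zero_le ?_
    rw [ENNReal.ofReal_le_one, Real.exp_le_one_iff]
    have := ht.1
    have : 0 ≤ (n : ℝ) * t := by positivity
    linarith
  have hJ0 : J ^ (1 / a) = 0 := by
    by_contra hne
    have hlt := ENNReal.mul_lt_mul_left hne
      (ENNReal.rpow_ne_top_of_nonneg (by positivity : 0 ≤ 1 / a) hJfin) hn
    rw [one_mul] at hlt
    exact absurd hb (not_le.mpr hlt)
  rw [ENNReal.rpow_eq_zero_iff_of_pos (by positivity), hJ, lintegral_eq_zero_iff hYE] at hJ0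
  filter_upwards [hJ0] with t ht
  simp only [Pi.zero_apply] at ht
  rw [ENNReal.rpow_eq_zero_iff_of_pos ha0, mul_eq_zero] at ht
  refine ht.resolve_left ?_
  simp [Real.exp_pos]

end Volterra

/-! ### Raising integrability until the contraction applies. -/

section Bootstrap

lemma one_div_conjugate {x : ℝ} : 1 / (1 / x) + 1 / (1 / (1 - x)) = 1 := by simp

lemma mul_one_div_one_sub_lt_one {κ x : ℝ} (hx : x < 1) (h : κ < 1 - x) :
    κ * (1 / (1 - x)) < 1 := by
  rw [mul_one_div, div_lt_one (by linarith)]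
  exact h

lemma one_div_one_sub_le_two {x : ℝ} (h : x ≤ 1 / 2) : 1 / (1 - x) ≤ 2 := by
  rw [div_le_iff₀ (by linarith)]
  linarith

/-- The scale of Lebesgue norms is indexed by reciprocal exponents. -/
lemma exists_ae_eq_zero_of_volterra_scale {T : ℝ} {d : ℕ} (hd : 2 ≤ d) {X B G : ℝ → ℝ → ℝ≥0∞}
    (hX : ∀ μ, 0 < μ → Measurable (X μ)) (hB : ∀ y, 0 < y → Measurable (B y))
    (hG : ∀ y, 0 < y → Measurable (G y))
    (hstar : ∀ {μ μ₁ μ₂ y₁ y₂ : ℝ}, 0 < μ → μ ≤ 1 / 2 → μ ≤ μ₁ → μ ≤ μ₂ → 0 < y₁ → 0 < y₂ →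
      y₁ + μ₁ ≤ 1 → y₂ + μ₂ ≤ 1 → ∃ K : ℝ, 0 ≤ K ∧ ∀ᵐ t ∂(volume.restrict (Ioc 0 T)),
        X μ t ≤ ∫⁻ s in Ioo 0 t,
          (ENNReal.ofReal (K * (t - s) ^ (-(1 / 2 + d / 2 * (y₁ + μ₁ - μ)))) *
              (B y₁ s * X μ₁ s) +
            ENNReal.ofReal (K * (t - s) ^ (-(d / 2 * (y₂ + μ₂ - μ)))) * (G y₂ s * X μ₂ s)))
    {x₁ y₁ x₂ y₂ : ℝ} (hx₁ : 0 < x₁) (hy₁ : 0 < y₁) (hx₂ : 0 < x₂) (hy₂ : 0 < y₂)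
    (h₁ : 2 * x₁ + d * y₁ < 1) (h₂ : 2 * x₂ + d * y₂ < 2)
    (hBf : ∫⁻ s in Ioc 0 T, B y₁ s ^ (1 / x₁) ≠ ∞)
    (hGf : ∫⁻ s in Ioc 0 T, G y₂ s ^ (1 / x₂) ≠ ∞)
    (hG2 : ∫⁻ s in Ioc 0 T, G (1 / 2) s ^ (2 : ℝ) ≠ ∞)
    {C : ℝ≥0∞} (hC : C ≠ ∞) (hXC : ∀ᵐ t ∂(volume.restrict (Ioc 0 T)), X (1 / 2) t ≤ C) :
    ∃ μ, 0 < μ ∧ ∀ᵐ t ∂(volume.restrict (Ioc 0 T)), X μ t = 0 := by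
  have hd' : (2 : ℝ) ≤ d := by exact_mod_cast hd
  have hy₁' : 2 * y₁ < 1 := by nlinarith
  have hdy₁ : 0 < d * y₁ := by positivity
  have hdy₂ : 0 < d * y₂ := by positivity
  have hx₁' : x₁ < 1 / 2 := by linarith
  have hx₂' : x₂ < 1 := by linarith
  have hXa : ∀ a : ℝ, 0 < a → ∫⁻ s in Ioc 0 T, X (1 / 2) s ^ a ≠ ∞ := by
    intro a ha
    refine ne_top_of_le_ne_top (b := ∫⁻ _s in Ioc 0 T, C ^ a) ?_ (lintegral_mono_ae ?_)
    · rw [setLIntegral_const]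
      exact ENNReal.mul_ne_top (ENNReal.rpow_ne_top_of_nonneg ha.le hC) (by simp)
    · filter_upwards [hXC] with t ht
      exact ENNReal.rpow_le_rpow ht ha.le
  have hp : ∀ {x : ℝ}, 0 < x → 0 < 1 / x := fun h => one_div_pos.mpr h
  -- Here `μ` is the reciprocal of the spatial exponent. If `y₂ ≤ 1/2`, Hölder already holds at `μ =
  -- 1/2`, and boundedness in time makes every power `a` available.
  rcases le_or_gt y₂ (1 / 2) with hc | hc
  · refine ⟨1 / 2, by norm_num, ?_⟩
    obtain ⟨K, hK, hle⟩ := hstar (μ := 1 / 2) (μ₁ := 1 / 2) (μ₂ := 1 / 2) (y₁ := y₁) (y₂ := y₂)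
      (by norm_num) le_rfl le_rfl le_rfl hy₁ hy₂ (by linarith) (by linarith)
    set a := max (max (1 / (1 - x₁)) (1 / (1 - x₂))) 1 with ha
    have ha1 : 1 ≤ a := le_max_right _ _
    exact ae_eq_zero_of_le_volterra hK (hB y₁ hy₁) (hG y₂ hy₂) (hX _ (by norm_num))
      (hp hx₁) (hp (by linarith)) one_div_conjugate (hp hx₂) (hp (by linarith))
      one_div_conjugate ha1 ((le_max_left _ _).trans (le_max_left _ _))
      ((le_max_right _ _).trans (le_max_left _ _))
      (mul_one_div_one_sub_lt_one (by linarith) (by linarith))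
      (mul_one_div_one_sub_lt_one (by linarith) (by linarith)) hBf hGf
      (hXa a (one_pos.trans_le ha1)) hle
  · have hx₂'' : x₂ < 1 / 2 := by nlinarith
    have hy₂' : y₂ < 1 := by nlinarith
    have hμ0 : 0 < 1 - y₂ := by linarith
    -- Otherwise the largest admissible `μ` is `1 - y₂ < 1/2`. It is reached from `1/2` in `N` equal
    -- steps `ε`, with `N` so large that `d ε` fits in the gap `1 - 2 x₁ - d y₁`.
    have hL2 : ∫⁻ s in Ioc 0 T, X (1 - y₂) s ^ (2 : ℝ) ≠ ∞ := by
      obtain ⟨N, hN⟩ := exists_nat_gt (d / (1 - 2 * x₁ - d * y₁))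
      have hs : 0 < 1 - 2 * x₁ - d * y₁ := by linarith
      have hN0 : (0 : ℝ) < N := lt_of_le_of_lt (by positivity) hN
      rw [div_lt_iff₀ hs] at hN
      set ε := (y₂ - 1 / 2) / N with hε
      have hε0 : 0 < ε := div_pos (by linarith) hN0
      have hNε : N * ε = y₂ - 1 / 2 := by rw [hε]; field_simp
      have hdε : d * ε < 1 - 2 * x₁ - d * y₁ := by
        have : N * (d * ε) < N * (1 - 2 * x₁ - d * y₁) := by nlinarith
        exact lt_of_mul_lt_mul_left this hN0.le
      have hstep : ∀ j : ℕ, j ≤ N → ∫⁻ s in Ioc 0 T, X (1 / 2 - j * ε) s ^ (2 : ℝ) ≠ ∞ := by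
        intro j
        induction j with
        | zero => intro _; simpa using hXa 2 two_pos
        | succ j ih =>
          intro hj
          have hjN : ((j : ℝ) + 1) * ε ≤ y₂ - 1 / 2 := by
            rw [← hNε]
            gcongr
            exact_mod_cast hj
          have hj0 : 0 ≤ (j : ℝ) * ε := by positivity
          push_cast
          have hpos : 0 < 1 / 2 - ((j : ℝ) + 1) * ε := by linarith
          obtain ⟨K, hK, hle⟩ := hstar (μ := 1 / 2 - ((j : ℝ) + 1) * ε) (μ₁ := 1 / 2 - j * ε)
            (μ₂ := 1 / 2) (y₁ := y₁) (y₂ := 1 / 2)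
            hpos (by linarith) (by linarith) (by linarith) hy₁ (by norm_num) (by linarith)
            (by norm_num)
          -- The divergence term uses `L^2` for both `g` and `w`, so its kernel exponent is `(d/2)(1
          -- - μ)`. This is at most `(d/2) y₂ < 1` because `μ ≥ 1 - y₂`.
          have hκ : d / 2 * (1 / 2 + 1 / 2 - (1 / 2 - ((j : ℝ) + 1) * ε)) ≤ d / 2 * y₂ := by
            gcongr
            linarith
          have hx : (1 - d / 2 * y₂) / 2 ≤ 1 / 2 := by linarith
          have hx0 : 0 < (1 - d / 2 * y₂) / 2 := by linarith
          have hGX : ∫⁻ s in Ioc 0 T, (G (1 / 2) s * X (1 / 2) s) ^ (2 : ℝ) ≠ ∞ := by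
            refine ne_top_of_le_ne_top
              (b := ∫⁻ s in Ioc 0 T, G (1 / 2) s ^ (2 : ℝ) * C ^ (2 : ℝ)) ?_ (lintegral_mono_ae ?_)
            · rw [lintegral_mul_const' _ _ (ENNReal.rpow_ne_top_of_nonneg two_pos.le hC)]
              exact ENNReal.mul_ne_top hG2 (ENNReal.rpow_ne_top_of_nonneg two_pos.le hC)
            · filter_upwards [hXC] with t ht
              rw [← ENNReal.mul_rpow_of_nonneg _ _ two_pos.le]
              exact ENNReal.rpow_le_rpow (mul_le_mul_right ht _) two_pos.le
          -- The product `g w` is a known source in `L^2` in time, paired with the constant `1`.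
          -- Since `1` lies in every `L^{1/x}`, the value `x = (1 - (d/2) y₂)/2` serves: it is
          -- positive and keeps `(d/2) y₂ < 1 - x`.
          refine lintegral_rpow_ne_top_of_le_volterra (β₂ := fun _ => 1)
            (Y₂ := fun s => G (1 / 2) s * X (1 / 2) s) hK (hB y₁ hy₁) measurable_const
            (hX _ (by linarith)) ((hG _ (by norm_num)).mul (hX _ (by norm_num)))
            (hp hx₁) (hp (by linarith)) one_div_conjugate (hp hx0) (hp (by linarith))
            one_div_conjugate one_le_two (one_div_one_sub_le_two hx₁'.le)
            (one_div_one_sub_le_two hx)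
            (mul_one_div_one_sub_lt_one (by linarith) ?_)
            (mul_one_div_one_sub_lt_one (by linarith) (hκ.trans_lt ?_)) hBf (by simp)
            (ih (by omega)) hGX (by simpa only [one_mul] using hle)
          · have : y₁ + (1 / 2 - j * ε) - (1 / 2 - ((j : ℝ) + 1) * ε) = y₁ + ε := by ring
            rw [this]
            linarith
          · linarith
      have := hstep N le_rfl
      rwa [hNε, show 1 / 2 - (y₂ - 1 / 2) = 1 - y₂ by ring] at this
    refine ⟨1 - y₂, hμ0, ?_⟩
    obtain ⟨K, hK, hle⟩ := hstar (μ := 1 - y₂) (μ₁ := 1 - y₂) (μ₂ := 1 - y₂) (y₁ := y₁) (y₂ := y₂)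
      hμ0 (by linarith) le_rfl le_rfl hy₁ hy₂ (by linarith) (by linarith)
    exact ae_eq_zero_of_le_volterra hK (hB y₁ hy₁) (hG y₂ hy₂) (hX _ hμ0)
      (hp hx₁) (hp (by linarith)) one_div_conjugate (hp hx₂) (hp (by linarith))
      one_div_conjugate one_le_two (one_div_one_sub_le_two hx₁'.le)
      (one_div_one_sub_le_two hx₂''.le)
      (mul_one_div_one_sub_lt_one (by linarith) (by linarith))
      (mul_one_div_one_sub_lt_one (by linarith) (by linarith)) hBf hGf hL2 hle

end Bootstrap

/-! ### Smooth functions on the torus and their derivatives. -/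

section SmoothFunctions

variable {d : ℕ}

lemma isOpenQuotientMap_torusMk : IsOpenQuotientMap (torusMk (d := d)) :=
  IsOpenQuotientMap.piMap fun _ => QuotientAddGroup.isOpenQuotientMap_mk

lemma TorusSmooth.continuous {φ : Torus d → ℝ} (hφ : TorusSmooth φ) : Continuous φ :=
  isOpenQuotientMap_torusMk.isQuotientMap.continuous_iff.mpr (ContDiff.continuous hφ)

/-- The lift of the partial derivative is a directional derivative of the smooth lift. It follows
that derivatives of test functions are continuous, hence bounded. -/
lemma TorusSmooth.torusPartial {φ : Torus d → ℝ} (hφ : TorusSmooth φ) (i : Fin d) :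
    TorusSmooth (torusPartial i φ) := by
  have hφ' : ContDiff ℝ ((⊤ : ℕ∞) : WithTop ℕ∞) (fun y : Fin d → ℝ => φ (torusMk y)) := hφ
  have h : (fun y : Fin d → ℝ => _root_.torusPartial i φ (torusMk y)) =
      fun y => fderiv ℝ (fun y : Fin d → ℝ => φ (torusMk y)) y (Pi.single i 1) := by
    funext y
    have hF : HasFDerivAt (fun y : Fin d → ℝ => φ (torusMk y))
        (fderiv ℝ (fun y : Fin d → ℝ => φ (torusMk y)) y) (y + (0 : ℝ) • Pi.single i 1) := by
      rw [zero_smul, add_zero]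
      exact (hφ'.differentiable (by simp)).differentiableAt.hasFDerivAt
    have hL : HasDerivAt (fun s : ℝ => y + s • (Pi.single i 1 : Fin d → ℝ))
        (Pi.single i 1) 0 := by
      simpa using ((hasDerivAt_id (0 : ℝ)).smul_const (Pi.single i 1 : Fin d → ℝ)).const_add y
    have h1 := (hF.comp_hasDerivAt (0 : ℝ) hL).deriv
    rw [← h1, _root_.torusPartial]
    congr 1
    funext s
    simp only [Function.comp_apply]
    congr 1
    funext j
    rcases eq_or_ne j i with rfl | hj
    · simp [torusMk]
    · simp [torusMk, hj]
  change ContDiff ℝ _ (fun y : Fin d → ℝ => _root_.torusPartial i φ (torusMk y))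
  rw [h]
  exact (hφ'.fderiv_right (m := ((⊤ : ℕ∞) : WithTop ℕ∞)) le_rfl).clm_apply contDiff_const

lemma TorusSmooth.continuous_torusLaplacian {φ : Torus d → ℝ} (hφ : TorusSmooth φ) :
    Continuous (torusLaplacian φ) :=
  continuous_finsetSum _ fun i _ => ((hφ.torusPartial i).torusPartial i).continuous

end SmoothFunctions

/-! ### Mixed Lebesgue norms and the choice of finite exponents. -/

section MixedNorms

variable {d : ℕ} {E : Type*} [NormedAddCommGroup E]

lemma measurable_eLpNorm_section [MeasurableSpace E] [OpensMeasurableSpace E]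
    {f : ℝ → Torus d → E} (hf : Measurable fun z : ℝ × Torus d => f z.1 z.2)
    {q : ℝ≥0∞} (hq0 : q ≠ 0) (hq : q ≠ ∞) :
    Measurable fun t => eLpNorm (f t) q volume := by
  simp_rw [eLpNorm_eq_lintegral_rpow_enorm_toReal hq0 hq]
  exact (Measurable.lintegral_prod_right' (f := fun z : ℝ × Torus d => ‖f z.1 z.2‖ₑ ^ q.toReal)
    (hf.enorm.pow_const _)).pow_const _

/-- Both `(0,T]` and the torus have finite measure, so exponents may be lowered, with reciprocals
`x`, `y` above the original ones. -/
lemma MemLpLq.lintegral_rpow_ne_top [MeasurableSpace E] [BorelSpace E]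
    [SecondCountableTopology E] {T : ℝ} {p q : ℝ≥0∞}
    {f : ℝ → Torus d → E} (h : MemLpLq T p q f)
    (hf : Measurable fun z : ℝ × Torus d => f z.1 z.2)
    {x y : ℝ} (hx : 0 < x) (hy : 0 < y) (hpx : p⁻¹ ≤ ENNReal.ofReal x)
    (hqy : q⁻¹ ≤ ENNReal.ofReal y) :
    ∫⁻ s in Ioc 0 T, eLpNorm (f s) (ENNReal.ofReal y)⁻¹ volume ^ (1 / x) ≠ ∞ := by
  have hx' : ENNReal.ofReal x ≠ 0 := by simpa using hx
  have hy' : ENNReal.ofReal y ≠ 0 := by simpa using hy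
  set r := (ENNReal.ofReal y)⁻¹ with hr
  have hr0 : r ≠ 0 := ENNReal.inv_ne_zero.mpr ENNReal.ofReal_ne_top
  have hrt : r ≠ ∞ := ENNReal.inv_ne_top.mpr hy'
  have hrq : r ≤ q := ENNReal.inv_le_iff_inv_le.mp hqy
  set σ := (ENNReal.ofReal x)⁻¹ with hσ
  have hσ0 : σ ≠ 0 := ENNReal.inv_ne_zero.mpr ENNReal.ofReal_ne_top
  have hσt : σ ≠ ∞ := ENNReal.inv_ne_top.mpr hx'
  have hσp : σ ≤ p := ENNReal.inv_le_iff_inv_le.mp hpx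
  have hσr : σ.toReal = 1 / x := by
    rw [hσ, ENNReal.toReal_inv, ENNReal.toReal_ofReal hx.le, one_div]
  have hm := measurable_eLpNorm_section hf hr0 hrt
  have hfs : ∀ t, AEStronglyMeasurable (f t) volume := fun t =>
    (hf.comp measurable_prodMk_left).aestronglyMeasurable
  have hD : (volume : Measure (Torus d)) univ ^ (1 / r.toReal - 1 / q.toReal) ≠ ∞ := by
    refine ENNReal.rpow_ne_top_of_nonneg ?_ (measure_ne_top _ _)
    rw [one_div, one_div, ← ENNReal.toReal_inv, ← ENNReal.toReal_inv, sub_nonneg]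
    exact ENNReal.toReal_mono (ENNReal.inv_ne_top.mpr hr0) (ENNReal.inv_le_inv.mpr hrq)
  -- The spatial exponent is lowered first, by pure comparison: for `q = ∞` this needs no
  -- measurability of `t ↦ ‖f t‖_q`, whereas the lowering in time uses measurability for the finite
  -- `r`.
  have h1 : eLpNorm (fun t => eLpNorm (f t) r volume) p (volume.restrict (Ioc 0 T)) < ∞ := by
    lift (volume : Measure (Torus d)) univ ^ (1 / r.toReal - 1 / q.toReal) to NNReal using hD
      with D hDD
    refine (eLpNorm_le_mul_eLpNorm_of_ae_le_mul' (c := D)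
      (g := fun t => eLpNorm (f t) q volume) (Filter.Eventually.of_forall fun t => ?_) p).trans_lt
      (ENNReal.mul_lt_top ENNReal.coe_lt_top h.2)
    rw [enorm_eq_self, enorm_eq_self, hDD]
    exact (eLpNorm_le_eLpNorm_mul_rpow_measure_univ hrq (hfs t)).trans_eq (mul_comm _ _)
  have h2 : eLpNorm (fun t => eLpNorm (f t) r volume) σ (volume.restrict (Ioc 0 T)) < ∞ :=
    (MemLp.mono_exponent (⟨hm.aestronglyMeasurable, h1⟩ : MemLp _ p _) hσp).2
  have h3 := lintegral_rpow_enorm_lt_top_of_eLpNorm_lt_top hσ0 hσt h2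
  simpa only [hσr, enorm_eq_self] using h3.ne

lemma lintegral_enorm_mul_le_eLpNorm_two {α : Type*} [MeasurableSpace α] {μ : Measure α}
    {f g : α → ℝ} (hf : AEStronglyMeasurable f μ) (hg : AEStronglyMeasurable g μ) :
    ∫⁻ x, ‖f x * g x‖ₑ ∂μ ≤ eLpNorm f 2 μ * eLpNorm g 2 μ := by
  have := eLpNorm_smul_le_mul_eLpNorm (p := 2) (q := 2) (r := 1) hg hf
  rwa [eLpNorm_one_eq_lintegral_enorm] at this

lemma integrable_prod_mul {T : ℝ} {w h : ℝ → Torus d → ℝ}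
    (hw : Measurable fun z : ℝ × Torus d => w z.1 z.2)
    (hh : Measurable fun z : ℝ × Torus d => h z.1 z.2) {C : ℝ≥0∞} (hC : C ≠ ∞)
    (hwC : ∀ᵐ t ∂(volume.restrict (Ioc 0 T)), eLpNorm (w t) 2 volume ≤ C)
    (hfin : ∫⁻ t in Ioc 0 T, eLpNorm (h t) 2 volume ≠ ∞) :
    Integrable (fun z : ℝ × Torus d => w z.1 z.2 * h z.1 z.2)
      ((volume.restrict (Ioc 0 T)).prod volume) := by
  have hwh : Measurable fun z : ℝ × Torus d => w z.1 z.2 * h z.1 z.2 := hw.mul hh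
  refine ⟨hwh.aestronglyMeasurable, ?_⟩
  rw [hasFiniteIntegral_iff_enorm, lintegral_prod _ hwh.enorm.aemeasurable]
  refine lt_of_le_of_lt (b := ∫⁻ t in Ioc 0 T, C * eLpNorm (h t) 2 volume)
    (lintegral_mono_ae ?_) ?_
  · filter_upwards [hwC] with t ht
    refine (lintegral_enorm_mul_le_eLpNorm_two
      (hw.comp measurable_prodMk_left).aestronglyMeasurable
      (hh.comp measurable_prodMk_left).aestronglyMeasurable).trans ?_
    exact mul_le_mul_left ht _
  · rw [lintegral_const_mul' _ _ hC]
    exact (ENNReal.mul_ne_top hC hfin).lt_top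

/-- Strict subcriticality leaves room for finite exponents. -/
lemma exists_real_inv_exponents {p q c : ℝ≥0∞} (hc : c ≠ ∞) {d : ℕ}
    (h : 2 / p + (d : ℝ≥0∞) / q < c) (hd : d ≠ 0) :
    ∃ x y : ℝ, 0 < x ∧ 0 < y ∧ 2 * x + d * y < c.toReal ∧ p⁻¹ ≤ ENNReal.ofReal x ∧
      q⁻¹ ≤ ENNReal.ofReal y := by
  have hp : p⁻¹ ≠ ∞ := by
    intro h'
    rw [div_eq_mul_inv, h', ENNReal.mul_top (by simp), top_add] at h
    exact not_top_lt h
  have hq : q⁻¹ ≠ ∞ := by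
    intro h'
    rw [div_eq_mul_inv (d : ℝ≥0∞), h', ENNReal.mul_top (by simpa using hd), add_top] at h
    exact not_top_lt h
  rw [div_eq_mul_inv, div_eq_mul_inv] at h
  have h' := (ENNReal.toReal_lt_toReal (h.ne_top) hc).mpr h
  rw [ENNReal.toReal_add (ENNReal.mul_ne_top (by simp) hp) (ENNReal.mul_ne_top (by simp) hq),
    ENNReal.toReal_mul, ENNReal.toReal_mul] at h'
  simp only [ENNReal.toReal_ofNat, ENNReal.toReal_natCast] at h'
  set x₀ := (p⁻¹).toReal with hx₀
  set y₀ := (q⁻¹).toReal with hy₀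
  have hx0 : 0 ≤ x₀ := ENNReal.toReal_nonneg
  have hy0 : 0 ≤ y₀ := ENNReal.toReal_nonneg
  have hd0 : (0 : ℝ) ≤ d := Nat.cast_nonneg d
  -- Both reciprocals are raised by `ε`, so they become positive even when `p` or `q` is `∞`. This
  -- uses `(2 + d) ε` of the gap; the extra `1` in the denominator keeps the inequality strict.
  set ε := (c.toReal - (2 * x₀ + d * y₀)) / (2 + d + 1) with hε
  have hε0 : 0 < ε := div_pos (by linarith) (by positivity)
  have hεe : ε * (2 + d + 1) = c.toReal - (2 * x₀ + d * y₀) := by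
    rw [hε]; field_simp
  refine ⟨x₀ + ε, y₀ + ε, by positivity, by positivity, by nlinarith, ?_, ?_⟩
  · rw [← ENNReal.ofReal_toReal hp]
    exact ENNReal.ofReal_le_ofReal (by linarith)
  · rw [← ENNReal.ofReal_toReal hq]
    exact ENNReal.ofReal_le_ofReal (by linarith)

end MixedNorms

/-! ### Vanishing of solutions with zero data. -/

section Core

variable {d : ℕ}

lemma inv_ofReal_one_half : (ENNReal.ofReal (1 / 2))⁻¹ = 2 := by
  rw [one_div, ENNReal.ofReal_inv_of_pos two_pos, inv_inv, ENNReal.ofReal_ofNat]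

lemma toReal_inv_inv_exponents {y μ₁ μ : ℝ} (hy : 0 < y) (hμ : 0 < μ) (hμ₁ : μ ≤ μ₁) :
    ((ENNReal.ofReal y)⁻¹⁻¹ + (ENNReal.ofReal μ₁)⁻¹⁻¹ - (ENNReal.ofReal μ)⁻¹⁻¹).toReal =
      y + μ₁ - μ := by
  rw [inv_inv, inv_inv, inv_inv, ← ENNReal.ofReal_add hy.le (hμ.le.trans hμ₁),
    ← ENNReal.ofReal_sub _ hμ.le, ENNReal.toReal_ofReal (by linarith)]

lemma MemLpLq.lintegral_eLpNorm_two_ne_top {E : Type*} [NormedAddCommGroup E] [MeasurableSpace E]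
    [BorelSpace E] [SecondCountableTopology E] {T : ℝ} {f : ℝ → Torus d → E}
    (hf : MemLpLq T 2 2 f) (hfm : Measurable fun z : ℝ × Torus d => f z.1 z.2) :
    ∫⁻ t in Ioc 0 T, eLpNorm (f t) 2 volume ≠ ∞ := by
  have := hf.lintegral_rpow_ne_top hfm (x := 1) (y := 1 / 2) one_pos (by norm_num)
    (by simp) (by rw [← inv_inv (ENNReal.ofReal (1 / 2)), inv_ofReal_one_half])
  simpa only [inv_ofReal_one_half, div_one, ENNReal.rpow_one] using this

lemma integrable_weak_products {T : ℝ} {w g : ℝ → Torus d → ℝ}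
    {b : ℝ → Torus d → EuclideanSpace ℝ (Fin d)}
    (hwm : Measurable fun z : ℝ × Torus d => w z.1 z.2)
    (hgm : Measurable fun z : ℝ × Torus d => g z.1 z.2)
    (hbm : Measurable fun z : ℝ × Torus d => b z.1 z.2)
    {C : ℝ≥0∞} (hC : C ≠ ∞)
    (hwC : ∀ᵐ t ∂(volume.restrict (Ioc 0 T)), eLpNorm (w t) 2 volume ≤ C)
    (hb2 : MemLpLq T 2 2 b) (hg2 : MemLpLq T 2 2 g) :
    Integrable (fun z : ℝ × Torus d => w z.1 z.2) ((volume.restrict (Ioc 0 T)).prod volume) ∧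
    Integrable (fun z : ℝ × Torus d => w z.1 z.2 * g z.1 z.2)
      ((volume.restrict (Ioc 0 T)).prod volume) ∧
    ∀ i, Integrable (fun z : ℝ × Torus d => w z.1 z.2 * b z.1 z.2 i)
      ((volume.restrict (Ioc 0 T)).prod volume) := by
  refine ⟨?_, integrable_prod_mul hwm hgm hC hwC (hg2.lintegral_eLpNorm_two_ne_top hgm),
    fun i => ?_⟩
  · have := integrable_prod_mul (h := fun _ _ => 1) hwm measurable_const hC hwC (by
      rw [lintegral_const]
      exact ENNReal.mul_ne_top (memLp_const (1 : ℝ)).2.ne (by simp))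
    simpa only [mul_one] using this
  · have hbim : Measurable fun z : ℝ × Torus d => b z.1 z.2 i :=
      (EuclideanSpace.proj (𝕜 := ℝ) i).continuous.measurable.comp hbm
    exact integrable_prod_mul (h := fun t x => b t x i) hwm hbim hC hwC
      (ne_top_of_le_ne_top (hb2.lintegral_eLpNorm_two_ne_top hbm) (lintegral_mono fun t =>
        eLpNorm_mono fun x => PiLp.norm_apply_le _ _))

/-- A bounded-in-`L²` solution of the weak formulation with zero data vanishes. -/
theorem ae_eq_zero_of_weak_formulation (hd : 2 ≤ d) {T ν : ℝ} (hν : 0 < ν)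
    {w g : ℝ → Torus d → ℝ} {b : ℝ → Torus d → EuclideanSpace ℝ (Fin d)}
    (hwm : Measurable fun z : ℝ × Torus d => w z.1 z.2)
    (hgm : Measurable fun z : ℝ × Torus d => g z.1 z.2)
    (hbm : Measurable fun z : ℝ × Torus d => b z.1 z.2)
    {C : ℝ≥0∞} (hC : C ≠ ∞)
    (hwC : ∀ᵐ t ∂(volume.restrict (Ioc 0 T)), eLpNorm (w t) 2 volume ≤ C)
    (hb2 : MemLpLq T 2 2 b) (hg2 : MemLpLq T 2 2 g)
    {p₁ q₁ p₂ q₂ : ℝ≥0∞}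
    (h₁ : 2 / p₁ + (d : ℝ≥0∞) / q₁ < 1) (hb : MemLpLq T p₁ q₁ b)
    (h₂ : 2 / p₂ + (d : ℝ≥0∞) / q₂ < 2) (hg : MemLpLq T p₂ q₂ g)
    (hweak : ∀ φ : Torus d → ℝ, TorusSmooth φ → ∀ᵐ t ∂(volume.restrict (Ioc 0 T)),
      ∫ x, w t x * φ x = - (∫ s in (0 : ℝ)..t,
          ∫ x, w s x * (g s x * φ x + ∑ i : Fin d, b s x i * torusPartial i φ x))
        + ν * ∫ s in (0 : ℝ)..t, ∫ x, w s x * torusLaplacian φ x) :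
    ∀ᵐ t ∂(volume.restrict (Ioc 0 T)), w t =ᵐ[volume] 0 := by
  have hd0 : d ≠ 0 := by omega
  obtain ⟨x₁, y₁, hx₁, hy₁, h₁', hpx₁, hqy₁⟩ := exists_real_inv_exponents ENNReal.one_ne_top h₁ hd0
  obtain ⟨x₂, y₂, hx₂, hy₂, h₂', hpx₂, hqy₂⟩ :=
    exists_real_inv_exponents (by simp) h₂ hd0
  rw [ENNReal.toReal_one] at h₁'
  rw [ENNReal.toReal_ofNat] at h₂'
  obtain ⟨hw, hwg, hwb⟩ := integrable_weak_products hwm hgm hbm hC hwC hb2 hg2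
  have hws : ∀ t, Measurable (w t) := fun t => hwm.comp measurable_prodMk_left
  have hgs : ∀ t, Measurable (g t) := fun t => hgm.comp measurable_prodMk_left
  have hbs : ∀ t, Measurable (b t) := fun t => hbm.comp measurable_prodMk_left
  have hw2 : ∀ᵐ t ∂(volume.restrict (Ioc 0 T)), MemLp (w t) 2 volume := by
    filter_upwards [hwC] with t ht
    exact ⟨(hws t).aestronglyMeasurable, ht.trans_lt hC.lt_top⟩
  have hr0 : ∀ r : ℝ, (ENNReal.ofReal r)⁻¹ ≠ 0 := fun r =>
    ENNReal.inv_ne_zero.mpr ENNReal.ofReal_ne_top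
  have hrt : ∀ r : ℝ, 0 < r → (ENNReal.ofReal r)⁻¹ ≠ ∞ := fun r hr =>
    ENNReal.inv_ne_top.mpr (by simpa using hr)
  obtain ⟨μ, hμ, hzero⟩ := exists_ae_eq_zero_of_volterra_scale (T := T) hd
    (X := fun μ t => eLpNorm (w t) (ENNReal.ofReal μ)⁻¹ volume)
    (B := fun y t => eLpNorm (b t) (ENNReal.ofReal y)⁻¹ volume)
    (G := fun y t => eLpNorm (g t) (ENNReal.ofReal y)⁻¹ volume)
    (fun μ hμ => measurable_eLpNorm_section hwm (hr0 μ) (hrt μ hμ))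
    (fun μ hμ => measurable_eLpNorm_section hbm (hr0 μ) (hrt μ hμ))
    (fun μ hμ => measurable_eLpNorm_section hgm (hr0 μ) (hrt μ hμ))
    (by
      intro μ μ₁ μ₂ y₁ y₂ hμ hμ2 hμ₁ hμ₂ hy₁ hy₂ hs₁ hs₂
      have hle1 : ∀ {x y : ℝ}, 0 < x → 0 < y → x + y ≤ 1 →
          (ENNReal.ofReal x)⁻¹⁻¹ + (ENNReal.ofReal y)⁻¹⁻¹ ≤ 1 := by
        intro x y hx hy hxy
        rw [inv_inv, inv_inv, ← ENNReal.ofReal_add hx.le hy.le]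
        exact ENNReal.ofReal_le_one.mpr hxy
      have := exists_eLpNorm_le_lintegral hν hws hgs hbs hw2 hw hwg hwb hweak
        (m := (ENNReal.ofReal μ)⁻¹) (q₁ := (ENNReal.ofReal y₁)⁻¹) (m₁ := (ENNReal.ofReal μ₁)⁻¹)
        (q₂ := (ENNReal.ofReal y₂)⁻¹) (m₂ := (ENNReal.ofReal μ₂)⁻¹)
        (by
          rw [← inv_ofReal_one_half]
          exact ENNReal.inv_le_inv.mpr (ENNReal.ofReal_le_ofReal hμ2))
        (hrt μ hμ) (ENNReal.inv_le_inv.mpr (ENNReal.ofReal_le_ofReal hμ₁))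
        (ENNReal.inv_le_inv.mpr (ENNReal.ofReal_le_ofReal hμ₂))
        (hle1 hy₁ (hμ.trans_le hμ₁) hs₁) (hle1 hy₂ (hμ.trans_le hμ₂) hs₂)
      rw [toReal_inv_inv_exponents hy₁ hμ hμ₁, toReal_inv_inv_exponents hy₂ hμ hμ₂] at this
      exact this)
    hx₁ hy₁ hx₂ hy₂ h₁' h₂' (hb.lintegral_rpow_ne_top hbm hx₁ hy₁ hpx₁ hqy₁)
    (hg.lintegral_rpow_ne_top hgm hx₂ hy₂ hpx₂ hqy₂)
    (by
      have := hg2.lintegral_rpow_ne_top hgm (x := 1 / 2) (y := 1 / 2) (by norm_num) (by norm_num)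
        (by rw [← inv_inv (ENNReal.ofReal (1 / 2)), inv_ofReal_one_half])
        (by rw [← inv_inv (ENNReal.ofReal (1 / 2)), inv_ofReal_one_half])
      simpa only [one_div_one_div] using this)
    hC (by simpa only [inv_ofReal_one_half] using hwC)
  filter_upwards [hzero] with t ht
  exact (eLpNorm_eq_zero_iff (hws t).aestronglyMeasurable (hr0 μ)).mp ht

end Core

/-! ### Measurable representatives, differences of solutions and weak continuity. -/

section Reduction

variable {d : ℕ}

lemma MemLpLq.exists_stronglyMeasurable {E : Type*} [NormedAddCommGroup E] {T : ℝ} {p q : ℝ≥0∞} {f : ℝ → Torus d → E} (hf : MemLpLq T p q f) :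
    ∃ f' : ℝ → Torus d → E, StronglyMeasurable (fun z : ℝ × Torus d => f' z.1 z.2) ∧
      ∀ᵐ t ∂(volume.restrict (Ioc 0 T)), f t =ᵐ[volume] f' t :=
  ⟨fun t x => hf.1.mk _ (t, x), hf.1.stronglyMeasurable_mk,
    Measure.ae_ae_of_ae_prod hf.1.ae_eq_mk⟩

lemma MemLpLq.congr {E : Type*} [NormedAddCommGroup E]
    {T : ℝ} {p q : ℝ≥0∞} {f f' : ℝ → Torus d → E} (hf : MemLpLq T p q f)
    (hf' : StronglyMeasurable fun z : ℝ × Torus d => f' z.1 z.2)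
    (h : ∀ᵐ t ∂(volume.restrict (Ioc 0 T)), f t =ᵐ[volume] f' t) : MemLpLq T p q f' := by
  refine ⟨hf'.aestronglyMeasurable, ?_⟩
  rw [← eLpNorm_congr_ae (f := fun t : ℝ => eLpNorm (f t) q volume)]
  · exact hf.2
  · filter_upwards [h] with t ht
    exact eLpNorm_congr_ae ht

lemma MemLpLq.exists_ae_eLpNorm_le {E : Type*} [NormedAddCommGroup E]
    {T : ℝ} {q : ℝ≥0∞} {f : ℝ → Torus d → E} (hf : MemLpLq T ∞ q f) :
    ∃ C : ℝ≥0∞, C ≠ ∞ ∧ ∀ᵐ t ∂(volume.restrict (Ioc 0 T)), eLpNorm (f t) q volume ≤ C := by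
  refine ⟨_, hf.2.ne, ?_⟩
  rw [eLpNorm_exponent_top]
  simpa only [enorm_eq_self] using
    enorm_ae_le_eLpNormEssSup (fun t : ℝ => eLpNorm (f t) q volume) (volume.restrict (Ioc 0 T))

lemma integrable_mul_continuous_snd {μ : Measure ℝ} {f : ℝ × Torus d → ℝ}
    (hf : Integrable f (μ.prod volume)) {φ : Torus d → ℝ} (hφ : Continuous φ) :
    Integrable (fun z => f z * φ z.2) (μ.prod volume) := by
  obtain ⟨c, hc⟩ := isCompact_univ.exists_bound_of_continuousOn hφ.continuousOn
  exact hf.mul_bdd (c := c) (hφ.comp continuous_snd).aestronglyMeasurable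
    (Filter.Eventually.of_forall fun z => hc _ (mem_univ _))

/-- The weak formulation is insensitive to changes of the data on null sets. -/
lemma IsWeakSol.congr {T ν : ℝ} {b b' : ℝ → Torus d → EuclideanSpace ℝ (Fin d)}
    {g g' : ℝ → Torus d → ℝ} {u₀ : Torus d → ℝ} {u u' : ℝ → Torus d → ℝ}
    (h : IsWeakSol T ν b g u₀ u)
    (hu : ∀ᵐ t ∂(volume.restrict (Ioc 0 T)), u t =ᵐ[volume] u' t)
    (hg : ∀ᵐ t ∂(volume.restrict (Ioc 0 T)), g t =ᵐ[volume] g' t)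
    (hb : ∀ᵐ t ∂(volume.restrict (Ioc 0 T)), b t =ᵐ[volume] b' t)
    (hu' : StronglyMeasurable fun z : ℝ × Torus d => u' z.1 z.2) :
    IsWeakSol T ν b' g' u₀ u' := by
  refine ⟨h.1.congr hu' hu, fun φ hφ => ?_⟩
  filter_upwards [h.2 φ hφ, hu, ae_restrict_mem measurableSet_Ioc] with t ht hut htT
  have hsub : Ioc 0 t ⊆ Ioc 0 T := Ioc_subset_Ioc_right htT.2
  have e0 : ∫ x, u t x * φ x = ∫ x, u' t x * φ x := by
    refine integral_congr_ae ?_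
    filter_upwards [hut] with x hx
    rw [hx]
  have e1 : ∫ s in (0 : ℝ)..t, ∫ x, u s x * (g s x * φ x + ∑ i, b s x i * torusPartial i φ x) =
      ∫ s in (0 : ℝ)..t, ∫ x, u' s x * (g' s x * φ x + ∑ i, b' s x i * torusPartial i φ x) := by
    refine intervalIntegral.integral_congr_ae_restrict ?_
    rw [uIoc_of_le htT.1.le]
    filter_upwards [ae_restrict_of_ae_restrict_of_subset hsub hu,
      ae_restrict_of_ae_restrict_of_subset hsub hg,
      ae_restrict_of_ae_restrict_of_subset hsub hb] with s h1 h2 h3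
    refine integral_congr_ae ?_
    filter_upwards [h1, h2, h3] with x hx1 hx2 hx3
    simp only [hx1, hx2, hx3]
  have e2 : ∫ s in (0 : ℝ)..t, ∫ x, u s x * torusLaplacian φ x =
      ∫ s in (0 : ℝ)..t, ∫ x, u' s x * torusLaplacian φ x := by
    refine intervalIntegral.integral_congr_ae_restrict ?_
    rw [uIoc_of_le htT.1.le]
    filter_upwards [ae_restrict_of_ae_restrict_of_subset hsub hu] with s h1
    refine integral_congr_ae ?_
    filter_upwards [h1] with x hx1
    simp only [hx1]
  rw [← e0, ← e1, ← e2]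
  exact ht

/-- Uniqueness for jointly measurable representatives. -/
lemma IsWeakSol.ae_eq_of_measurable (hd : 2 ≤ d) {T ν : ℝ} (hν : 0 < ν)
    {b : ℝ → Torus d → EuclideanSpace ℝ (Fin d)} {g : ℝ → Torus d → ℝ}
    (hgm : Measurable fun z : ℝ × Torus d => g z.1 z.2)
    (hbm : Measurable fun z : ℝ × Torus d => b z.1 z.2)
    (hb2 : MemLpLq T 2 2 b) (hg2 : MemLpLq T 2 2 g)
    {p₁ q₁ p₂ q₂ : ℝ≥0∞}
    (h₁ : 2 / p₁ + (d : ℝ≥0∞) / q₁ < 1) (hb : MemLpLq T p₁ q₁ b)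
    (h₂ : 2 / p₂ + (d : ℝ≥0∞) / q₂ < 2) (hg : MemLpLq T p₂ q₂ g)
    {u₀ : Torus d → ℝ} {u v : ℝ → Torus d → ℝ}
    (hum : Measurable fun z : ℝ × Torus d => u z.1 z.2)
    (hvm : Measurable fun z : ℝ × Torus d => v z.1 z.2)
    (hu : IsWeakSol T ν b g u₀ u) (hv : IsWeakSol T ν b g u₀ v) :
    ∀ᵐ t ∂(volume.restrict (Ioc 0 T)), u t =ᵐ[volume] v t := by
  obtain ⟨Cu, hCu, huC⟩ := hu.1.exists_ae_eLpNorm_le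
  obtain ⟨Cv, hCv, hvC⟩ := hv.1.exists_ae_eLpNorm_le
  have hus : ∀ t, Measurable (u t) := fun t => hum.comp measurable_prodMk_left
  have hvs : ∀ t, Measurable (v t) := fun t => hvm.comp measurable_prodMk_left
  have hwC : ∀ᵐ t ∂(volume.restrict (Ioc 0 T)),
      eLpNorm (fun x => u t x - v t x) 2 volume ≤ Cu + Cv := by
    filter_upwards [huC, hvC] with t h1 h2
    exact (eLpNorm_sub_le (hus t).aestronglyMeasurable (hvs t).aestronglyMeasurable
      one_le_two).trans (add_le_add h1 h2)
  have hu2 : ∀ᵐ t ∂(volume.restrict (Ioc 0 T)), MemLp (u t) 2 volume := by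
    filter_upwards [huC] with t ht
    exact ⟨(hus t).aestronglyMeasurable, ht.trans_lt hCu.lt_top⟩
  have hv2 : ∀ᵐ t ∂(volume.restrict (Ioc 0 T)), MemLp (v t) 2 volume := by
    filter_upwards [hvC] with t ht
    exact ⟨(hvs t).aestronglyMeasurable, ht.trans_lt hCv.lt_top⟩
  have hweak : ∀ φ : Torus d → ℝ, TorusSmooth φ → ∀ᵐ t ∂(volume.restrict (Ioc 0 T)),
      ∫ x, (u t x - v t x) * φ x = - (∫ s in (0 : ℝ)..t,
          ∫ x, (u s x - v s x) * (g s x * φ x + ∑ i : Fin d, b s x i * torusPartial i φ x))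
        + ν * ∫ s in (0 : ℝ)..t, ∫ x, (u s x - v s x) * torusLaplacian φ x := by
    intro φ hφ
    -- Every term is integrable in space-time for each solution separately, so the integrals in the
    -- two weak formulations may be subtracted term by term.
    have hint : ∀ {y : ℝ → Torus d → ℝ} {C : ℝ≥0∞},
        Measurable (fun z : ℝ × Torus d => y z.1 z.2) → C ≠ ∞ →
        (∀ᵐ t ∂(volume.restrict (Ioc 0 T)), eLpNorm (y t) 2 volume ≤ C) →
        Integrable (fun z : ℝ × Torus d => y z.1 z.2 *
          (g z.1 z.2 * φ z.2 + ∑ i : Fin d, b z.1 z.2 i * torusPartial i φ z.2))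
          ((volume.restrict (Ioc 0 T)).prod volume) ∧
        Integrable (fun z : ℝ × Torus d => y z.1 z.2 * torusLaplacian φ z.2)
          ((volume.restrict (Ioc 0 T)).prod volume) := by
      intro y C hy hC hyC
      obtain ⟨h0, h1, h2⟩ := integrable_weak_products hy hgm hbm hC hyC hb2 hg2
      refine ⟨?_, integrable_mul_continuous_snd h0 hφ.continuous_torusLaplacian⟩
      refine ((integrable_mul_continuous_snd h1 hφ.continuous).add
        (integrable_finsetSum Finset.univ fun i _ =>
          integrable_mul_continuous_snd (h2 i) (hφ.torusPartial i).continuous)).congr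
        (Filter.Eventually.of_forall fun z => ?_)
      simp only [Pi.add_apply]
      rw [mul_add, Finset.mul_sum, mul_assoc]
      simp only [mul_assoc]
    obtain ⟨hu1, hu3⟩ := hint hum hCu huC
    obtain ⟨hv1, hv3⟩ := hint hvm hCv hvC
    filter_upwards [hu.2 φ hφ, hv.2 φ hφ, hu2, hv2, ae_restrict_mem measurableSet_Ioc]
      with t htu htv hut hvt htT
    have hsub : Ioc 0 t ⊆ Ioc 0 T := Ioc_subset_Ioc_right htT.2
    have hφ2 : MemLp φ 2 volume := hφ.continuous.memLp_of_hasCompactSupport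
      (HasCompactSupport.of_compactSpace _)
    have hutφ : Integrable fun x => u t x * φ x := hut.integrable_mul hφ2
    have hvtφ : Integrable fun x => v t x * φ x := hvt.integrable_mul hφ2
    have e0 : ∫ x, (u t x - v t x) * φ x = (∫ x, u t x * φ x) - ∫ x, v t x * φ x := by
      rw [← integral_sub hutφ hvtφ]
      simp only [sub_mul]
    have hdiff : ∀ {Φ : ℝ → Torus d → ℝ},
        Integrable (fun z : ℝ × Torus d => u z.1 z.2 * Φ z.1 z.2)
          ((volume.restrict (Ioc 0 T)).prod volume) →
        Integrable (fun z : ℝ × Torus d => v z.1 z.2 * Φ z.1 z.2)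
          ((volume.restrict (Ioc 0 T)).prod volume) →
        ∫ s in (0 : ℝ)..t, ∫ x, (u s x - v s x) * Φ s x =
          (∫ s in (0 : ℝ)..t, ∫ x, u s x * Φ s x) - ∫ s in (0 : ℝ)..t, ∫ x, v s x * Φ s x := by
      intro Φ hU hV
      have hUi : IntegrableOn (fun s => ∫ x, u s x * Φ s x) (Ioc 0 T) := hU.integral_prod_left
      have hVi : IntegrableOn (fun s => ∫ x, v s x * Φ s x) (Ioc 0 T) := hV.integral_prod_left
      simp only [intervalIntegral.integral_of_le htT.1.le]
      rw [← integral_sub (hUi.mono_set hsub) (hVi.mono_set hsub)]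
      refine integral_congr_ae ?_
      filter_upwards [ae_restrict_of_ae_restrict_of_subset hsub hU.prod_right_ae,
        ae_restrict_of_ae_restrict_of_subset hsub hV.prod_right_ae] with s h1 h2
      rw [← integral_sub h1 h2]
      simp only [sub_mul]
    rw [e0, hdiff (Φ := fun s x => g s x * φ x + ∑ i : Fin d, b s x i * torusPartial i φ x) hu1 hv1,
      hdiff (Φ := fun _ x => torusLaplacian φ x) hu3 hv3]
    linarith
  filter_upwards [ae_eq_zero_of_weak_formulation hd hν (w := fun t x => u t x - v t x)
    (hum.sub hvm) hgm hbm (ENNReal.add_ne_top.mpr ⟨hCu, hCv⟩) hwC hb2 hg2 h₁ hb h₂ hg hweak]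
    with t ht
  filter_upwards [ht] with x hx
  exact sub_eq_zero.mp hx

/-- At a fixed `t` both functions are paired with `f = u(t) - v(t)`. The pairings are continuous in
time and agree a.e., hence everywhere, and at time `t` this says `∫ f² = 0`. -/
lemma WeaklyContinuousL2.ae_eq_of_ae {T : ℝ} (hT : 0 < T) {u v : ℝ → Torus d → ℝ}
    (hu : WeaklyContinuousL2 T u) (hv : WeaklyContinuousL2 T v)
    (h : ∀ᵐ t ∂(volume.restrict (Ioc 0 T)), u t =ᵐ[volume] v t) :
    ∀ t ∈ Icc 0 T, u t =ᵐ[volume] v t := by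
  intro t ht
  have hut := hu.1 t ht
  have hvt := hv.1 t ht
  set f : Torus d → ℝ := fun x => u t x - v t x with hf
  have hf2 : MemLp f 2 volume := hut.sub hvt
  have heq : EqOn (fun t => ∫ x, u t x * f x) (fun t => ∫ x, v t x * f x) (Icc 0 T) := by
    refine Measure.eqOn_Icc_of_ae_eq volume hT.ne ?_ (hu.2 f hf2) (hv.2 f hf2)
    rw [← restrict_Ioc_eq_restrict_Icc]
    filter_upwards [h] with s hs
    refine integral_congr_ae ?_
    filter_upwards [hs] with x hx
    rw [hx]
  have hutf : Integrable fun x => u t x * f x := hut.integrable_mul hf2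
  have hvtf : Integrable fun x => v t x * f x := hvt.integrable_mul hf2
  have h0 : ∫ x, f x ^ 2 = 0 := by
    have h1 : ∫ x, f x ^ 2 = (∫ x, u t x * f x) - ∫ x, v t x * f x := by
      rw [← integral_sub hutf hvtf]
      refine integral_congr_ae (Filter.Eventually.of_forall fun x => ?_)
      simp only [hf]
      ring
    rw [h1, sub_eq_zero]
    exact heq ht
  rw [integral_eq_zero_iff_of_nonneg (fun x => sq_nonneg _) hf2.integrable_sq] at h0
  filter_upwards [h0] with x hx
  exact sub_eq_zero.mp (pow_eq_zero_iff two_ne_zero |>.mp hx)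

end Reduction

/-! ### The uniqueness theorem. -/

theorem mainTheorem2 (d : ℕ) (hd : 2 ≤ d) (T : ℝ) (hT : 0 < T)
    (b : ℝ → Torus d → EuclideanSpace ℝ (Fin d)) (g : ℝ → Torus d → ℝ)
    (hdiv : ∀ᵐ t ∂(volume.restrict (Ioc 0 T)), IsTorusDiv (b t) (g t))
    (hb2 : MemLpLq T 2 2 b) (hg2 : MemLpLq T 2 2 g)
    (p₁ q₁ p₂ q₂ : ℝ≥0∞)
    (h₁ : 2 / p₁ + (d : ℝ≥0∞) / q₁ < 1) (hb : MemLpLq T p₁ q₁ b)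
    (h₂ : 2 / p₂ + (d : ℝ≥0∞) / q₂ < 2) (hg : MemLpLq T p₂ q₂ g)
    (ν : ℝ) (hν : 0 < ν) (u₀ : Torus d → ℝ) (hu₀ : MemLp u₀ 2 volume)
    (u v : ℝ → Torus d → ℝ)
    (hu : IsWeakSol T ν b g u₀ u) (hv : IsWeakSol T ν b g u₀ v) :
    (∀ᵐ t ∂(volume.restrict (Ioc 0 T)), u t =ᵐ[volume] v t) ∧
      (WeaklyContinuousL2 T u → WeaklyContinuousL2 T v →
        ∀ t ∈ Icc 0 T, u t =ᵐ[volume] v t) := by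
  have hae : ∀ᵐ t ∂(volume.restrict (Ioc 0 T)), u t =ᵐ[volume] v t := by
    -- All data are replaced by jointly measurable representatives, so that every time slice is
    -- measurable and not just almost every one.
    obtain ⟨b', hb'm, hb'⟩ := hb2.exists_stronglyMeasurable
    obtain ⟨g', hg'm, hg'⟩ := hg2.exists_stronglyMeasurable
    obtain ⟨u', hu'm, hu'⟩ := hu.1.exists_stronglyMeasurable
    obtain ⟨v', hv'm, hv'⟩ := hv.1.exists_stronglyMeasurable
    have h := (hu.congr hu' hg' hb' hu'm).ae_eq_of_measurable hd hν hg'm.measurable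
      hb'm.measurable (hb2.congr hb'm hb') (hg2.congr hg'm hg') h₁ (hb.congr hb'm hb') h₂
      (hg.congr hg'm hg') hu'm.measurable hv'm.measurable (hv.congr hv' hg' hb' hv'm)
    filter_upwards [h, hu', hv'] with t h1 h2 h3
    exact h2.trans (h1.trans h3.symm)
  exact ⟨hae, fun hcu hcv => hcu.ae_eq_of_ae hT hcv hae⟩
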